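/- **Theorem.** Let $X$ be a complex manifold of dimension $d$ (for instance a closed Kähler manifold), let $E$ be a smooth complex vector bundle of rank $n$ on $X$, and let $\nabla''$ be a Higgs operator on $E$: a $\mathbb C$-linear operator from sections of $E$ to $E$-valued $1$-forms that satisfies the $\bar\partial$-Leibniz rule $\nabla''(fs)=\bar\partial f\otimes s+f\,\nabla''s$ and $(\nabla'')^2=0$. Write $\nabla''=\bar\partial_E+\Theta$ with $\bar\partial_E$ of type $(0,1)$ and $\Theta$ of type $(1,0)$. For a smooth Hermitian metric $H$ on $E$ let $D'_H$ be the $(1,0)$-part of the Chern connection of $(\bar\partial_E,H)$, let $\Theta^*_H$ be the $H$-adjoint of $\Theta$, put $\nabla'_H=D'_H+\Theta^*_H$, and let $F_H=(\nabla''+\nabla'_H)^2\in\Omega^2(X,\operatorname{End}E)$ be the curvature of the Higgs connection $\nabla''+\nabla'_H$. Let $k\ge 1$ and let $\varphi$ be a $GL(n,\mathbb C)$-invariant $k$-linear function on $\mathrm{Mat}_n(\mathbb C)$, extended to matrix-valued forms by $\varphi(a_1\otimes\alpha_1,\dots,a_k\otimes\alpha_k)=\varphi(a_1,\dots,a_k)\,\alpha_1\wedge\dots\wedge\alpha_k$.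 Put $\varphi_{Higgs}(H)=\varphi(F_H,\dots,F_H)$. For a smooth path of metrics $\gamma=(H(t))_{0\le t\le 1}$ put $L_t=H(t)^{-1}\dot H(t)$, $F_t=F_{H(t)}$ and $$R_\gamma=-i\int_0^1\sum_{j=1}^k\varphi(F_t,\dots,F_t,\underset{j}{L_t},F_t,\dots,F_t)\,dt .$$ Then there is a function $R_{Higgs}$ that assigns to each pair of smooth Hermitian metrics $(H,K)$ on $E$ a form $R_{Higgs}(H,K)$ such that, for all $H$ and $K$: 1. $R_{Higgs}(H,K)\in\Omega^{2k-2}(X,\mathbb C)$. 2. $R_{Higgs}(H,K)$ is well defined modulo $\operatorname{Im}\bar\partial+\operatorname{Im}\partial$, where $\operatorname{Im}\bar\partial=\bar\partial(\Omega^{2k-3}(X,\mathbb C))$ and $\operatorname{Im}\partial=\partial(\Omega^{2k-3}(X,\mathbb C))$ (both zero if $k=1$): there are smooth paths of metrics from $K$ to $H$, and for every such path $\gamma$ the form $R_\gamma$ lies in $\Omega^{2k-2}(X,\mathbb C)$ and satisfies $R_{Higgs}(H,K)-R_\gamma\in\operatorname{Im}\bar\partial+\operatorname{Im}\partial$. 3.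 $\varphi_{Higgs}(H)-\varphi_{Higgs}(K)=i\,\bar\partial\partial R_{Higgs}(H,K)$, and the same identity holds with $R_\gamma$ in place of $R_{Higgs}(H,K)$ for every smooth path $\gamma$ from $K$ to $H$. -/

import Mathlib

open Bundle Set
open scoped Manifold ContDiff Topology Matrix ComplexConjugate

noncomputable section

/-! ### Flat complex coordinates -/

/-- The model space `ℂ^d` of complex manifolds of dimension `d`. -/
abbrev Cd (d : ℕ) : Type := EuclideanSpace ℂ (Fin d)

/-- The space `Mat_n` of complex `n × n` matrices. -/
abbrev Mat (n : ℕ) : Type := Matrix (Fin n) (Fin n) ℂ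

/-- Arrays of `n × n` complex entries with their sup norm. Matrix valued functions and forms take
values in this normed space; `Matrix.of` turns an array into a matrix. -/
abbrev Arr (n : ℕ) : Type := Fin n → Fin n → ℂ

section Flat

variable {d n m p : ℕ}

/-- Multiplication by `i` on real tangent vectors. -/
def mulI (d : ℕ) : Cd d →L[ℝ] Cd d :=
  (Complex.I • ContinuousLinearMap.id ℂ (Cd d)).restrictScalars ℝ

section Types

variable {M : Type*} [NormedAddCommGroup M] [NormedSpace ℝ M] [NormedSpace ℂ M]
  [SMulCommClass ℝ ℂ M]

/-- The part of type `(1,0)` of a real linear map, `v ↦ (L v - i L (i v)) / 2`. -/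
def part10 (L : Cd d →L[ℝ] M) : Cd d →L[ℝ] M :=
  (1 / 2 : ℂ) • (L - Complex.I • L.comp (mulI d))

/-- The part of type `(0,1)` of a real linear map, `v ↦ (L v + i L (i v)) / 2`. -/
def part01 (L : Cd d →L[ℝ] M) : Cd d →L[ℝ] M :=
  (1 / 2 : ℂ) • (L + Complex.I • L.comp (mulI d))

theorem part10_add_part01 (L : Cd d →L[ℝ] M) : part10 L + part01 L = L := by
  rw [part10, part01, ← smul_add, sub_add_add_cancel, ← two_smul ℂ, smul_smul]
  norm_num

end Types

/-- The operator `∂` on complex valued `p`-forms in flat coordinates: the exterior derivative in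
which the differential of the coefficients is replaced by its part of type `(1,0)`. -/
def flatDel (η : Cd d → Cd d [⋀^Fin p]→L[ℝ] ℂ) (y : Cd d) : Cd d [⋀^Fin (p + 1)]→L[ℝ] ℂ :=
  .alternatizeUncurryFin (part10 (fderiv ℝ η y))

/-- The operator `∂̄` on complex valued `p`-forms in flat coordinates. -/
def flatDelBar (η : Cd d → Cd d [⋀^Fin p]→L[ℝ] ℂ) (y : Cd d) : Cd d [⋀^Fin (p + 1)]→L[ℝ] ℂ :=
  .alternatizeUncurryFin (part01 (fderiv ℝ η y))

/-- The operators `∂` and `∂̄` add up to the exterior derivative. -/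
theorem flatDel_add_flatDelBar (η : Cd d → Cd d [⋀^Fin p]→L[ℝ] ℂ) (y : Cd d) :
    flatDel η y + flatDelBar η y = extDeriv η y := by
  rw [flatDel, flatDelBar, extDeriv, ← ContinuousAlternatingMap.alternatizeUncurryFin_add,
    part10_add_part01]

/-- The product of two matrix valued linear maps, as the bilinear map `(v, w) ↦ A v * B w`. -/
def mulForm (A B : Cd d →L[ℝ] Arr n) : Cd d →L[ℝ] Cd d →L[ℝ] Arr n :=
  LinearMap.toContinuousBilinearMap
    (LinearMap.mk₂ ℝ (fun v w => Matrix.of.symm (Matrix.of (A v) * Matrix.of (B w)))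
      (fun v v' w => by rw [map_add, ← Matrix.of_add_of, add_mul]; rfl)
      (fun c v w => by rw [map_smul]; exact Matrix.smul_mul c (Matrix.of (A v)) _)
      (fun v w w' => by rw [map_add, ← Matrix.of_add_of, mul_add]; rfl)
      (fun c v w => by rw [map_smul]; exact Matrix.mul_smul (Matrix.of (A v)) c _))

/-- The curvature `d A + A ∧ A` of the connection `d + A`, as the bilinear map
`(v, w) ↦ (D_v A) w - (D_w A) v + A v * A w - A w * A v`. -/
def curvature (A : Cd d → Cd d →L[ℝ] Arr n) (y : Cd d) : Cd d →L[ℝ] Cd d →L[ℝ] Arr n :=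
  fderiv ℝ A y - (fderiv ℝ A y).flip + (mulForm (A y) (A y) - (mulForm (A y) (A y)).flip)

/-- The pointwise adjoint `v ↦ (A v)ᴴ` of a matrix valued form, that is, the transpose of the
complex conjugate form. -/
def starForm (A : Cd d →L[ℝ] Arr n) : Cd d →L[ℝ] Arr n :=
  LinearMap.toContinuousLinearMap
    { toFun := fun v => Matrix.of.symm (Matrix.of (A v))ᴴ
      map_add' := fun v w => by funext i j; simp
      map_smul' := fun c v => by funext i j; simp }

/-- The form `v ↦ P * A v * Q`, for a matrix valued form `A` and matrices `P`, `Q`. -/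
def sandwich (P : Mat n) (A : Cd d →L[ℝ] Arr n) (Q : Mat n) : Cd d →L[ℝ] Arr n :=
  LinearMap.toContinuousLinearMap
    { toFun := fun v => Matrix.of.symm (P * Matrix.of (A v) * Q)
      map_add' := fun v w => by
        rw [map_add, ← Matrix.of_add_of, mul_add, add_mul]; rfl
      map_smul' := fun c v => by
        rw [map_smul]
        change P * (c • Matrix.of (A v)) * Q = c • (P * Matrix.of (A v) * Q)
        rw [Matrix.mul_smul, Matrix.smul_mul] }

/-- In a local frame in which the metric has matrix `G` and the partial connection is
`∂̄ + a` with `a` of type `(0,1)`, the part `D'` of type `(1,0)` of the Chern connection is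
`∂ + G⁻¹ ∂G - G⁻¹ aᴴ G`; this is its matrix of `(1,0)`-forms. It is determined by
`∂ (s, t) = (D' s, t) + (s, (∂̄ + a) t)`. -/
def chernForm (a : Cd d → Cd d →L[ℝ] Arr n) (G : Cd d → Arr n) (y : Cd d) :
    Cd d →L[ℝ] Arr n :=
  sandwich (Matrix.of (G y))⁻¹ (part10 (fderiv ℝ G y)) 1
    - sandwich (Matrix.of (G y))⁻¹ (starForm (a y)) (Matrix.of (G y))

/-- The adjoint `Θ* = G⁻¹ Θᴴ G` of a matrix valued form with respect to the metric `G`. -/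
def adjointForm (Θ : Cd d → Cd d →L[ℝ] Arr n) (G : Cd d → Arr n) (y : Cd d) :
    Cd d →L[ℝ] Arr n :=
  sandwich (Matrix.of (G y))⁻¹ (starForm (Θ y)) (Matrix.of (G y))

/-- In a local frame in which the metric has matrix `G` and the Higgs operator is `∂̄ + A`, with
`A = a + Θ`, `a` of type `(0,1)` and `Θ` (the Higgs field) of type `(1,0)`, the Higgs connection
`(∂̄ + a + Θ) + (D' + Θ*)` is `d` plus this matrix of `1`-forms. -/
def higgsConnForm (A : Cd d → Cd d →L[ℝ] Arr n) (G : Cd d → Arr n) (y : Cd d) :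
    Cd d →L[ℝ] Arr n :=
  A y + (chernForm (fun z => part01 (A z)) G y + adjointForm (fun z => part10 (A z)) G y)

/-- The extension of `∂̄ + A` to vector valued `1`-forms, `β ↦ ∂̄ β + A ∧ β`, evaluated on
vectors `v`, `w`. -/
def flatExtend (A : Cd d → Cd d →L[ℝ] Arr n) (β : Cd d → Cd d →L[ℝ] (Fin n → ℂ)) (y : Cd d)
    (v w : Cd d) : Fin n → ℂ :=
  part01 (fderiv ℝ β y) v w - part01 (fderiv ℝ β y) w v
    + (Matrix.of (A y v) *ᵥ β y w - Matrix.of (A y w) *ᵥ β y v)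

theorem continuous_multilinear {ι : Type*} [Fintype ι]
    (f : MultilinearMap ℝ (fun _ : ι => Cd d) ℂ) : Continuous f := by
  classical
  let b := Module.finBasis ℝ (Cd d)
  have h : ∀ v, f v = ∑ r : ι → Fin (Module.finrank ℝ (Cd d)),
      (∏ i, b.repr (v i) (r i)) • f (fun i => b (r i)) := by
    intro v
    conv_lhs => rw [show v = fun i => ∑ j, b.repr (v i) j • b j from
      funext fun i => (b.sum_repr (v i)).symm]
    rw [f.map_sum]
    exact Finset.sum_congr rfl fun r _ => f.map_smul_univ _ _
  rw [show (f : (ι → Cd d) → ℂ) = fun v => _ from funext h]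
  refine continuous_finsetSum _ fun r _ => ?_
  refine Continuous.fun_smul (continuous_finsetProd _ fun i _ => ?_) continuous_const
  exact (LinearMap.continuous_of_finiteDimensional (b.coord (r i))).comp (continuous_apply i)

theorem block_update (F : Fin m → Cd d →L[ℝ] Cd d →L[ℝ] Arr n) [DecidableEq (Fin m × Fin 2)]
    (v : Fin m × Fin 2 → Cd d) (i : Fin m) (b : Fin 2) (z : Cd d) :
    (fun l => Matrix.of (F l (Function.update v (i, b) z (l, 0))
      (Function.update v (i, b) z (l, 1)))) =
    Function.update (fun l => Matrix.of (F l (v (l, 0)) (v (l, 1)))) i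
      (Matrix.of (F i (Function.update v (i, b) z (i, 0))
        (Function.update v (i, b) z (i, 1)))) := by
  funext l
  by_cases h : l = i
  · subst h; simp
  · simp [h, Function.update_apply]

/-- The multilinear map `v ↦ ψ (F_1 (v_{1,0}, v_{1,1}), …, F_m (v_{m,0}, v_{m,1}))`. -/
def blockMap (ψ : MultilinearMap ℂ (fun _ : Fin m => Mat n) ℂ)
    (F : Fin m → Cd d →L[ℝ] Cd d →L[ℝ] Arr n) :
    MultilinearMap ℝ (fun _ : Fin m × Fin 2 => Cd d) ℂ :=
  MultilinearMap.mk' (fun v => ψ fun i => Matrix.of (F i (v (i, 0)) (v (i, 1))))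
    (fun v a x y => by
      obtain ⟨i, b⟩ := a
      rw [block_update, block_update, block_update, ← ψ.map_update_add]
      congr 2
      fin_cases b <;> simp)
    (fun v a c x => by
      obtain ⟨i, b⟩ := a
      rw [block_update, block_update, ← Complex.coe_smul c (ψ _), ← ψ.map_update_smul]
      congr 2
      fin_cases b <;> simp)

/-- The extension of an `m`-linear function `ψ` on matrices to matrix valued `2`-forms
`F_1, …, F_m`, characterised by
`ψ(a_1 ⊗ α_1, …, a_m ⊗ α_m) = ψ(a_1, …, a_m) α_1 ∧ … ∧ α_m`. On vectors it is
`2^(-m) ∑_σ sign(σ) ψ(F_1(v_{σ 0}, v_{σ 1}), …, F_m(v_{σ (2m-2)}, v_{σ (2m-1)}))`. -/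
def evalTwoForms (ψ : MultilinearMap ℂ (fun _ : Fin m => Mat n) ℂ)
    (F : Fin m → Cd d →L[ℝ] Cd d →L[ℝ] Arr n) : Cd d [⋀^Fin (2 * m)]→L[ℝ] ℂ :=
  let g : Cd d [⋀^Fin (2 * m)]→ₗ[ℝ] ℂ := ((1 / 2 : ℝ) ^ m) •
    MultilinearMap.alternatization ((blockMap ψ F).domDomCongr
      (finProdFinEquiv.trans (finCongr (Nat.mul_comm m 2))))
  { g with cont := continuous_multilinear g.toMultilinearMap }

/-- `φ(F, …, F)`, for a `k`-linear function `φ` and a matrix valued `2`-form `F`; here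
`k = m + 1`. -/
def phiOf (φ : MultilinearMap ℂ (fun _ : Fin (m + 1) => Mat n) ℂ)
    (F : Cd d →L[ℝ] Cd d →L[ℝ] Arr n) : Cd d [⋀^Fin (2 * (m + 1))]→L[ℝ] ℂ :=
  evalTwoForms φ fun _ => F

/-- `φ'(F, L) = ∑_j φ(F, …, F, L, F, …, F)` with `L` in the `j`-th of the `k = m + 1` slots, for a
matrix valued `2`-form `F` and a matrix valued `0`-form `L`. -/
def phiPrime (φ : MultilinearMap ℂ (fun _ : Fin (m + 1) => Mat n) ℂ)
    (F : Cd d →L[ℝ] Cd d →L[ℝ] Arr n) (L : Mat n) : Cd d [⋀^Fin (2 * m)]→L[ℝ] ℂ :=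
  ∑ j : Fin (m + 1), evalTwoForms (φ.curryMid j L) fun _ => F

end Flat

/-- Invariance of a multilinear function on `Mat_n` under simultaneous conjugation by
`GL(n, ℂ)`. -/
def IsGLInvariant {n k : ℕ} (φ : MultilinearMap ℂ (fun _ : Fin k => Mat n) ℂ) : Prop :=
  ∀ (g : GL (Fin n) ℂ) (a : Fin k → Mat n),
    φ (fun i => (g : Mat n) * a i * ((g⁻¹ : GL (Fin n) ℂ) : Mat n)) = φ a

/-- A complex manifold is a smooth real manifold. -/
instance isManifold_real {d : ℕ} (X : Type*) [TopologicalSpace X] [ChartedSpace (Cd d) X]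
    [IsManifold 𝓘(ℂ, Cd d) ω X] : IsManifold 𝓘(ℝ, Cd d) ∞ X := by
  apply isManifold_of_contDiffOn
  intro e e' he he'
  have h := (contDiffGroupoid ω 𝓘(ℂ, Cd d)).compatible he he'
  rw [contDiffGroupoid, mem_groupoid_of_pregroupoid] at h
  exact (ContDiffOn.restrict_scalars ℝ h.1).of_le (by simp)

/-! ### Differential forms on a complex manifold -/

section Forms

variable {d p : ℕ} {X : Type*} [TopologicalSpace X] [ChartedSpace (Cd d) X]

/-- Families of alternating `p`-forms on the tangent spaces of `X`, with complex values. The real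
tangent space at `x` is `ℂ^d`, by means of the chart `chartAt x`. -/
abbrev PForm (d p : ℕ) (X : Type*) [TopologicalSpace X] [ChartedSpace (Cd d) X] : Type _ :=
  ∀ x : X, TangentSpace 𝓘(ℝ, Cd d) x [⋀^Fin p]→L[ℝ] ℂ

/-- The expression of a form in the chart around `x₀`: its pullback by the inverse chart. -/
def inChart (η : PForm d p X) (x₀ : X) (y : Cd d) : Cd d [⋀^Fin p]→L[ℝ] ℂ :=
  (η ((chartAt (Cd d) x₀).symm y)).compContinuousLinearMap
    (mfderiv 𝓘(ℝ, Cd d) 𝓘(ℝ, Cd d) (chartAt (Cd d) x₀).symm y)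

/-- Membership in `Ω^p(X, ℂ)`: the form is smooth in the charts. -/
def IsSmoothForm (η : PForm d p X) : Prop :=
  ∀ x₀ : X, ContDiffOn ℝ ∞ (inChart η x₀) (chartAt (Cd d) x₀).target

/-- The operator `∂` on forms. -/
def del (η : PForm d p X) : PForm d (p + 1) X :=
  fun x => flatDel (inChart η x) (chartAt (Cd d) x x)

/-- The operator `∂̄` on forms. -/
def delBar (η : PForm d p X) : PForm d (p + 1) X :=
  fun x => flatDelBar (inChart η x) (chartAt (Cd d) x x)

/-- Membership of a `p`-form in `Im ∂̄ + Im ∂ = ∂̄ Ω^{p-1} + ∂ Ω^{p-1}`. There are no nonzero forms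
of degree `-1`. -/
def MemImDelBarAddImDel : {p : ℕ} → PForm d p X → Prop
  | 0, η => η = 0
  | q + 1, η => ∃ α β : PForm d q X, IsSmoothForm α ∧ IsSmoothForm β ∧ η = delBar α + del β

/-- The form `∂̄f` at `x`, for a complex valued function `f`. -/
def delBarFun (f : X → ℂ) (x : X) : TangentSpace 𝓘(ℝ, Cd d) x →L[ℝ] ℂ :=
  part01 (M := ℂ) (mfderiv 𝓘(ℝ, Cd d) 𝓘(ℝ, ℂ) f x)

end Forms

/-! ### Higgs bundles and Hermitian metrics -/

section Bundles

variable {d n m : ℕ} {X : Type*} [TopologicalSpace X] [ChartedSpace (Cd d) X]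
  {V : X → Type*} [TopologicalSpace (TotalSpace (Fin n → ℂ) V)]
  [∀ x, AddCommGroup (V x)] [∀ x, Module ℂ (V x)] [∀ x, TopologicalSpace (V x)]
  [FiberBundle (Fin n → ℂ) V]

/-- The `j`-th section of the local frame given by a trivialization (zero outside its base set). -/
def frame (e : Trivialization (Fin n → ℂ) (TotalSpace.proj : TotalSpace (Fin n → ℂ) V → X))
    (j : Fin n) (x : X) : V x :=
  e.symm x (Pi.single j 1)

variable [VectorBundle ℝ (Fin n → ℂ) V]

/-- The components, in the chart and the local frame around `x₀`, of a `V`-valued `1`-form. -/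
def inFrame (β : ∀ x, TangentSpace 𝓘(ℝ, Cd d) x →L[ℝ] V x) (x₀ : X) (y : Cd d) :
    Cd d →L[ℝ] (Fin n → ℂ) :=
  ((trivializationAt (Fin n → ℂ) V x₀).continuousLinearMapAt ℝ ((chartAt (Cd d) x₀).symm y)).comp
    ((β ((chartAt (Cd d) x₀).symm y)).comp
      (mfderiv 𝓘(ℝ, Cd d) 𝓘(ℝ, Cd d) (chartAt (Cd d) x₀).symm y))

/-- The matrix of `1`-forms `A`, in the chart and the local frame around `x₀`, of an operator `N`
on sections: the `j`-th column of `A` consists of the components of `N e_j`. -/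
def connForm (N : (∀ x, V x) → ∀ x, TangentSpace 𝓘(ℝ, Cd d) x →L[ℝ] V x) (x₀ : X) (y : Cd d) :
    Cd d →L[ℝ] Arr n :=
  ContinuousLinearMap.pi fun i => ContinuousLinearMap.pi fun j =>
    (ContinuousLinearMap.proj i).comp
      (inFrame (N (frame (trivializationAt (Fin n → ℂ) V x₀) j)) x₀ y)

variable (d n V) in
/-- A Higgs operator `∇''` on a smooth complex vector bundle `V` of rank `n`. As for Mathlib's
covariant derivatives, it takes as argument any family of vectors, and its properties are required
where the argument is differentiable; `toFun σ x v` is `(∇'' σ)(v)` at `x`. Additivity and the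
`∂̄`-Leibniz rule (which contains `ℂ`-linearity) make the operator local, smoothness says that it
maps smooth (local) sections to smooth `V`-valued `1`-forms, and the last field is
`(∇'')² σ = 0`, in which `∇''` is extended to `V`-valued `1`-forms by
`∇''(α ⊗ e) = ∂̄α ⊗ e - α ∧ ∇''e`, written in local frames. -/
structure HiggsOperator [∀ x, IsTopologicalAddGroup (V x)] [∀ x, ContinuousSMul ℝ (V x)]
    [IsManifold 𝓘(ℝ, Cd d) ∞ X] where
  toFun : (∀ x, V x) → ∀ x, TangentSpace 𝓘(ℝ, Cd d) x →L[ℝ] V x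
  add : ∀ (σ τ : ∀ x, V x) (x : X),
    MDifferentiableAt 𝓘(ℝ, Cd d) (𝓘(ℝ, Cd d).prod 𝓘(ℝ, Fin n → ℂ))
      (fun y => TotalSpace.mk' (Fin n → ℂ) y (σ y)) x →
    MDifferentiableAt 𝓘(ℝ, Cd d) (𝓘(ℝ, Cd d).prod 𝓘(ℝ, Fin n → ℂ))
      (fun y => TotalSpace.mk' (Fin n → ℂ) y (τ y)) x →
    toFun (fun y => σ y + τ y) x = toFun σ x + toFun τ x
  leibniz : ∀ (f : X → ℂ) (σ : ∀ x, V x) (x : X),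
    MDifferentiableAt 𝓘(ℝ, Cd d) 𝓘(ℝ, ℂ) f x →
    MDifferentiableAt 𝓘(ℝ, Cd d) (𝓘(ℝ, Cd d).prod 𝓘(ℝ, Fin n → ℂ))
      (fun y => TotalSpace.mk' (Fin n → ℂ) y (σ y)) x →
    ∀ v, toFun (fun y => f y • σ y) x v = delBarFun f x v • σ x + f x • toFun σ x v
  smooth : ∀ (U : Set X) (σ : ∀ x, V x), IsOpen U →
    ContMDiffOn 𝓘(ℝ, Cd d) (𝓘(ℝ, Cd d).prod 𝓘(ℝ, Fin n → ℂ)) ∞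
      (fun y => TotalSpace.mk' (Fin n → ℂ) y (σ y)) U →
    ContMDiffOn 𝓘(ℝ, Cd d) (𝓘(ℝ, Cd d).prod 𝓘(ℝ, Cd d →L[ℝ] (Fin n → ℂ))) ∞
      (fun y => TotalSpace.mk' (Cd d →L[ℝ] (Fin n → ℂ))
        (E := fun y => TangentSpace 𝓘(ℝ, Cd d) y →L[ℝ] V y) y (toFun σ y)) U
  sq_zero : ∀ (U : Set X) (σ : ∀ x, V x), IsOpen U →
    ContMDiffOn 𝓘(ℝ, Cd d) (𝓘(ℝ, Cd d).prod 𝓘(ℝ, Fin n → ℂ)) ∞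
      (fun y => TotalSpace.mk' (Fin n → ℂ) y (σ y)) U →
    ∀ x ∈ U, ∀ v w : Cd d,
      flatExtend (connForm (n := n) toFun x) (inFrame (n := n) (toFun σ) x) (chartAt (Cd d) x x) v w = 0

variable (d n V) in
/-- A smooth Hermitian metric on `V`, linear in the first variable. -/
structure HermitianMetric where
  toFun : ∀ x, V x →ₗ[ℂ] V x →ₗ⋆[ℂ] ℂ
  symm : ∀ x u v, toFun x u v = conj (toFun x v u)
  pos : ∀ x u, u ≠ 0 → 0 < (toFun x u u).re
  smooth : ∀ (e : Trivialization (Fin n → ℂ) (TotalSpace.proj : TotalSpace (Fin n → ℂ) V → X))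
    [MemTrivializationAtlas e] (i j : Fin n),
    ContMDiffOn 𝓘(ℝ, Cd d) 𝓘(ℝ, ℂ) ∞ (fun x => toFun x (frame e i x) (frame e j x)) e.baseSet

/-- The matrix `H_{ji} = (e_i, e_j)_H` of a metric in the chart and the local frame around `x₀`. -/
def gram (H : HermitianMetric d n V) (x₀ : X) (y : Cd d) : Arr n := fun j i =>
  H.toFun ((chartAt (Cd d) x₀).symm y)
    (frame (trivializationAt (Fin n → ℂ) V x₀) i ((chartAt (Cd d) x₀).symm y))
    (frame (trivializationAt (Fin n → ℂ) V x₀) j ((chartAt (Cd d) x₀).symm y))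

/-- A smooth path of metrics `H(t)`, `0 ≤ t ≤ 1`, from `K` to `H`. -/
structure MetricPath (K H : HermitianMetric d n V) where
  toFun : ℝ → HermitianMetric d n V
  source : toFun 0 = K
  target : toFun 1 = H
  smooth : ∀ (e : Trivialization (Fin n → ℂ) (TotalSpace.proj : TotalSpace (Fin n → ℂ) V → X))
    [MemTrivializationAtlas e] (i j : Fin n),
    ContMDiffOn (𝓘(ℝ, ℝ).prod 𝓘(ℝ, Cd d)) 𝓘(ℝ, ℂ) ∞
      (fun q : ℝ × X => (toFun q.1).toFun q.2 (frame e i q.2) (frame e j q.2))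
      (Icc 0 1 ×ˢ e.baseSet)

/-- The matrix `L_t = H(t)⁻¹ (d/dt) H(t)` at `x`, in the local frame around `x`. -/
def metricLogDeriv {K H : HermitianMetric d n V} (γ : MetricPath K H) (t : ℝ) (x : X) : Mat n :=
  (Matrix.of (gram (γ.toFun t) x (chartAt (Cd d) x x)))⁻¹ *
    Matrix.of (derivWithin (fun s => gram (γ.toFun s) x (chartAt (Cd d) x x)) (Icc 0 1) t)

variable [∀ x, IsTopologicalAddGroup (V x)] [∀ x, ContinuousSMul ℝ (V x)]
  [IsManifold 𝓘(ℝ, Cd d) ∞ X]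

/-- The curvature at `x`, in the local frame around `x`, of the Higgs connection
`∇'' + ∇'_H`. -/
def higgsCurvature (D : HiggsOperator d n V) (H : HermitianMetric d n V) (x : X) :
    Cd d →L[ℝ] Cd d →L[ℝ] Arr n :=
  curvature (higgsConnForm (connForm D.toFun x) (gram H x)) (chartAt (Cd d) x x)

/-- The form `φ_Higgs(H) = φ(F, …, F)`, where `F` is the Higgs curvature. -/
def phiHiggs (D : HiggsOperator d n V) (φ : MultilinearMap ℂ (fun _ : Fin (m + 1) => Mat n) ℂ)
    (H : HermitianMetric d n V) : PForm d (2 * (m + 1)) X :=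
  fun x => phiOf φ (higgsCurvature D H x)

/-- The Higgs Bott–Chern form `-i ∫₀¹ φ'(F_t, L_t) dt` of a path of metrics. -/
def bottChern (D : HiggsOperator d n V) (φ : MultilinearMap ℂ (fun _ : Fin (m + 1) => Mat n) ℂ)
    {K H : HermitianMetric d n V} (γ : MetricPath K H) : PForm d (2 * m) X :=
  fun x => -Complex.I • ∫ t in (0 : ℝ)..1,
    phiPrime φ (higgsCurvature D (γ.toFun t) x) (metricLogDeriv γ t x)

end Bundles

end

set_option linter.unusedSectionVars false

open Bundle Set
open scoped Manifold ContDiff Topology Matrix ComplexConjugate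

noncomputable section

/-! ### Complex directional derivatives -/

section DirectionalDerivative

variable {Z Z' M : Type*} [NormedAddCommGroup Z] [NormedSpace ℝ Z]
  [NormedAddCommGroup Z'] [NormedSpace ℝ Z']
  [NormedAddCommGroup M] [NormedSpace ℝ M] [NormedSpace ℂ M] [SMulCommClass ℝ ℂ M]

/-! The Higgs field is treated on the same footing as the connection. In a chart and a frame the
Higgs operator is `∂̄ + A` with `A = a + Θ`. For a real vector `v` let `∇''_v` be the derivative
along the `(0,1)`-part of `v` plus the matrix `A(v)`, with no splitting of `A` into types. Then
`(∇'')² = 0` says exactly that the `∇''_v`, for constant `v`, commute with each other. Conjugate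
transposition gives commuting operators `∂_v + B(v)` along the `(1,0)`-parts, with `B = Θᴴ - aᴴ`
(`conjCoeff`). The operator `∇' = D' + Θ*` is their gauge transform by the matrix `G` of the metric,
so it is flat too. Hence the Higgs curvature is purely mixed: `F(v,w) = [∇''_v, ∇'_w] - [∇''_w,
∇'_v]`. All that follows uses only such a pair of flat partial connections (`FlatPair`).

Parameters of a family of metrics are adjoined to the coordinates. If `L = G⁻¹ ∂_T G`, then `∂_T +
L` is the gauge transform of `∂_T` by `G`, so it commutes with `∇'`; and `∂_T` commutes with `∇''`,
which does not involve the metric (`IsVariation`). The Jacobi identity for `∂_T + L`, `∇''_v`,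
`∇'_w` gives `∂_T [∇''_v, ∇'_w] = ∇''_v ∇'_w L` (`cdir_mixed`).

By invariance of `φ`, the operators `∂` and `∂̄` on scalar forms such as `φ'(F, L)` can be computed
with `∇'` and `∇''` on the arguments: the commutator terms, those with `Θ` and `Θ*` included, add up
to zero. The terms in which `F` is differentiated vanish after alternation, since the Bianchi
identity holds for `∇'` and `∇''` separately. Therefore `∂̄∂ φ'(F, L) = φ'(F, ∇''∇'L) = ∂_T φ(F, …,
F)`, and integration over a path gives the transgression formula (`cdir_chern`, `phiHiggs_sub`).

For a two-parameter family with logarithmic derivatives `N`, `L` in the directions `S`, `T`,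
flatness of `∂_S + N`, `∂_T + L` and the same calculus give `∂_S φ'(F, L) - ∂_T φ'(F, N) = ∂̄ φ''(F,
∇'N, L) + ∂ φ''(F, ∇''L, N)` for `k ≥ 2`, and zero for `k = 1` (`cdir_bott_sub`, `cdir_bott_eq`).
Stokes' formula on a square, two of whose edges are constant at `K`, compares an arbitrary path from
`K` to `H` with the standard one (`memIm_bottForm_sub_bottChern`).

The local forms glue because a holomorphic change of chart and a change of frame conjugate
curvature, logarithmic derivative and covariant derivatives (`FlatData.Transition`), while `∂`
commutes with holomorphic pullback (`flatDel_pullback`). Paths are smooth only on `[0,1]`; composing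
them with `Real.smoothTransition` gives families over the whole line without changing the integral.
`R_Higgs(H, K)` is the form of the convex combinations of `K` and `H`, reparametrised in this way.
-/

/-- The derivative of `f` at `z` along the complexified tangent vector `u + i v`, where
`X = (u, v)`. -/
def cdir (f : Z → M) (X : Z × Z) (z : Z) : M :=
  fderiv ℝ f z X.1 + Complex.I • fderiv ℝ f z X.2

theorem Filter.EventuallyEq.cdir_eq {f g : Z → M} {z : Z} (h : f =ᶠ[𝓝 z] g) (X : Z × Z) :
    cdir f X z = cdir g X z := by
  rw [cdir, cdir, h.fderiv_eq]

theorem ContDiffAt.cdir {f : Z → M} {z : Z} (hf : ContDiffAt ℝ ∞ f z) (X : Z × Z) :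
    ContDiffAt ℝ ∞ (cdir f X) z := by
  have h : ContDiffAt ℝ ∞ (fderiv ℝ f) z := hf.fderiv_right (by simp)
  have h1 : ContDiffAt ℝ ∞ (fun y => fderiv ℝ f y X.1) z := h.clm_apply contDiffAt_const
  have h2 : ContDiffAt ℝ ∞ (fun y => fderiv ℝ f y X.2) z := h.clm_apply contDiffAt_const
  exact h1.add (h2.const_smul Complex.I)

theorem ContDiffAt.differentiableAt_infty {f : Z → M} {z : Z} (hf : ContDiffAt ℝ ∞ f z) :
    DifferentiableAt ℝ f z :=
  hf.differentiableAt (by simp)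

@[simp]
theorem cdir_const (c : M) (X : Z × Z) (z : Z) : cdir (fun _ => c) X z = 0 := by
  simp [cdir]

theorem cdir_add {f g : Z → M} {z : Z} (hf : DifferentiableAt ℝ f z)
    (hg : DifferentiableAt ℝ g z) (X : Z × Z) :
    cdir (fun y => f y + g y) X z = cdir f X z + cdir g X z := by
  simp only [cdir, fderiv_fun_add hf hg, _root_.add_apply, smul_add]
  abel

theorem cdir_sub {f g : Z → M} {z : Z} (hf : DifferentiableAt ℝ f z)
    (hg : DifferentiableAt ℝ g z) (X : Z × Z) :
    cdir (fun y => f y - g y) X z = cdir f X z - cdir g X z := by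
  simp only [cdir, fderiv_fun_sub hf hg, _root_.sub_apply, smul_sub]
  abel

theorem cdir_sum {ι : Type*} {s : Finset ι} {f : ι → Z → M} {z : Z}
    (hf : ∀ i ∈ s, DifferentiableAt ℝ (f i) z) (X : Z × Z) :
    cdir (fun y => ∑ i ∈ s, f i y) X z = ∑ i ∈ s, cdir (f i) X z := by
  simp only [cdir, fderiv_fun_sum hf, _root_.sum_apply, Finset.smul_sum,
    Finset.sum_add_distrib]

theorem cdir_const_smul {f : Z → M} {z : Z} (hf : DifferentiableAt ℝ f z) (c : ℂ) (X : Z × Z) :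
    cdir (fun y => c • f y) X z = c • cdir f X z := by
  simp only [cdir, fderiv_fun_const_smul hf, _root_.smul_apply, smul_add]
  rw [smul_comm]

theorem cdir_continuousLinearMap_comp {N : Type*} [NormedAddCommGroup N] [NormedSpace ℝ N]
    [NormedSpace ℂ N] {f : Z → M} {z : Z} (hf : DifferentiableAt ℝ f z)
    (l : M →L[ℝ] N) (hl : ∀ x, l (Complex.I • x) = Complex.I • l x) (X : Z × Z) :
    cdir (fun y => l (f y)) X z = l (cdir f X z) := by
  simp only [cdir, map_add, hl]
  have h : fderiv ℝ (fun y => l (f y)) z = l.comp (fderiv ℝ f z) :=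
    (l.hasFDerivAt.comp z hf.hasFDerivAt).fderiv
  simp only [h, ContinuousLinearMap.comp_apply]

/-- Moving `i` through an antilinear map changes its sign, so the direction `u + iv` becomes `u -
iv`. Conjugate transposition is the case of interest: it exchanges derivatives of type `(1,0)` and
`(0,1)`. -/
theorem cdir_continuousLinearMap_comp_conj {N : Type*} [NormedAddCommGroup N] [NormedSpace ℝ N]
    [NormedSpace ℂ N] {f : Z → M} {z : Z} (hf : DifferentiableAt ℝ f z)
    (l : M →L[ℝ] N) (hl : ∀ x, l (Complex.I • x) = -(Complex.I • l x)) (X : Z × Z) :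
    cdir (fun y => l (f y)) X z = l (cdir f (X.1, -X.2) z) := by
  have h : fderiv ℝ (fun y => l (f y)) z = l.comp (fderiv ℝ f z) :=
    (l.hasFDerivAt.comp z hf.hasFDerivAt).fderiv
  simp only [cdir, map_add, hl, h, ContinuousLinearMap.comp_apply, map_neg, smul_neg, neg_neg]

/-- The chain rule along a map `τ` whose differential commutes with complex structures. -/
theorem cdir_comp {f : Z → M} {τ : Z' → Z} {z : Z'} (hf : DifferentiableAt ℝ f (τ z))
    (hτ : DifferentiableAt ℝ τ z) (X : Z' × Z') :
    cdir (fun y => f (τ y)) X z = cdir f (fderiv ℝ τ z X.1, fderiv ℝ τ z X.2) (τ z) := by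
  simp only [cdir]
  rw [show (fun y => f (τ y)) = f ∘ τ from rfl, fderiv_comp _ hf hτ]
  rfl

/-- Constant complexified vector fields commute; this is the symmetry of the second derivative,
extended bilinearly over `ℂ`. It is why no Lie bracket of vector fields occurs in the curvature
below. -/
theorem cdir_comm {f : Z → M} {z : Z} (hf : ContDiffAt ℝ ∞ f z) (X Y : Z × Z) :
    cdir (cdir f X) Y z = cdir (cdir f Y) X z := by
  have hsymm : IsSymmSndFDerivAt ℝ f z := hf.isSymmSndFDerivAt (by simpa using ENat.LEInfty.out)
  have h : DifferentiableAt ℝ (fderiv ℝ f) z :=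
    ContDiffAt.differentiableAt_infty (hf.fderiv_right (m := ∞) (by simp))
  have key : ∀ u v : Z, fderiv ℝ (fun y => fderiv ℝ f y u) z v = fderiv ℝ (fderiv ℝ f) z v u := by
    intro u v
    rw [fderiv_clm_apply h (differentiableAt_const u)]
    simp
  have hd : ∀ u : Z, DifferentiableAt ℝ (fun y => fderiv ℝ f y u) z := fun u =>
    h.clm_apply (differentiableAt_const u)
  have expand : ∀ X Y : Z × Z, cdir (cdir f X) Y z =
      fderiv ℝ (fderiv ℝ f) z Y.1 X.1 + Complex.I • fderiv ℝ (fderiv ℝ f) z Y.1 X.2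
      + Complex.I • (fderiv ℝ (fderiv ℝ f) z Y.2 X.1
        + Complex.I • fderiv ℝ (fderiv ℝ f) z Y.2 X.2) := by
    intro X Y
    have : fderiv ℝ (cdir f X) z = fderiv ℝ (fun y => fderiv ℝ f y X.1) z
        + Complex.I • fderiv ℝ (fun y => fderiv ℝ f y X.2) z := by
      rw [show cdir f X = fun y => fderiv ℝ f y X.1 + Complex.I • fderiv ℝ f y X.2 from rfl,
        fderiv_fun_add (hd _) ((hd _).fun_const_smul _), fderiv_fun_const_smul (hd _)]
    rw [cdir, this]
    simp only [_root_.add_apply, _root_.smul_apply, key]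
  rw [expand, expand, hsymm.eq Y.1 X.1, hsymm.eq Y.1 X.2, hsymm.eq Y.2 X.1, hsymm.eq Y.2 X.2]
  simp only [smul_add]
  abel

end DirectionalDerivative

/-! ### Covariant derivatives, curvature and gauge transformations in constant directions -/

section Covariant

variable {Z 𝔸 : Type*} [NormedAddCommGroup Z] [NormedSpace ℝ Z]
  [NormedRing 𝔸] [NormedAlgebra ℂ 𝔸]

theorem cdir_mul {f g : Z → 𝔸} {z : Z} (hf : DifferentiableAt ℝ f z)
    (hg : DifferentiableAt ℝ g z) (X : Z × Z) :
    cdir (fun y => f y * g y) X z = cdir f X z * g z + f z * cdir g X z := by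
  simp only [cdir, fderiv_fun_mul' hf hg, _root_.add_apply,
    _root_.smul_apply, smul_eq_mul, MulOpposite.smul_eq_mul_unop, smul_add,
    mul_add, add_mul, mul_smul_comm, smul_mul_assoc, MulOpposite.unop_op]
  abel

/-- The covariant derivative `f ↦ ∂_X f + [α, f]` on endomorphism valued functions. -/
def covDir (X : Z × Z) (α f : Z → 𝔸) (z : Z) : 𝔸 :=
  cdir f X z + (α z * f z - f z * α z)

/-- The curvature `[∂_X + α, ∂_Y + β]`. -/
def curvDir (X Y : Z × Z) (α β : Z → 𝔸) (z : Z) : 𝔸 :=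
  cdir β X z - cdir α Y z + (α z * β z - β z * α z)

theorem ContDiffAt.covDir {X : Z × Z} {α f : Z → 𝔸} {z : Z} (hα : ContDiffAt ℝ ∞ α z)
    (hf : ContDiffAt ℝ ∞ f z) : ContDiffAt ℝ ∞ (covDir X α f) z :=
  (hf.cdir X).add ((hα.mul hf).sub (hf.mul hα))

theorem ContDiffAt.curvDir {X Y : Z × Z} {α β : Z → 𝔸} {z : Z} (hα : ContDiffAt ℝ ∞ α z)
    (hβ : ContDiffAt ℝ ∞ β z) : ContDiffAt ℝ ∞ (curvDir X Y α β) z :=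
  ((hβ.cdir X).sub (hα.cdir Y)).add ((hα.mul hβ).sub (hβ.mul hα))

theorem curvDir_swap (X Y : Z × Z) (α β : Z → 𝔸) (z : Z) :
    curvDir Y X β α z = -curvDir X Y α β z := by
  simp only [curvDir]
  abel

theorem Filter.EventuallyEq.covDir_eq {f g : Z → 𝔸} {z : Z} (h : f =ᶠ[𝓝 z] g) (X : Z × Z)
    (α : Z → 𝔸) : covDir X α f z = covDir X α g z := by
  rw [covDir, covDir, h.cdir_eq, h.eq_of_nhds]

/-- The operators `∂_X + [α, ·]` and `∂_Y + [β, ·]` act by commutators, so their commutator is the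
commutator with the curvature. -/
theorem covDir_covDir_sub {X Y : Z × Z} {α β f : Z → 𝔸} {z : Z} (hα : ContDiffAt ℝ ∞ α z)
    (hβ : ContDiffAt ℝ ∞ β z) (hf : ContDiffAt ℝ ∞ f z) :
    covDir X α (covDir Y β f) z - covDir Y β (covDir X α f) z =
      curvDir X Y α β z * f z - f z * curvDir X Y α β z := by
  have dα := hα.differentiableAt_infty
  have dβ := hβ.differentiableAt_infty
  have df := hf.differentiableAt_infty
  have e : ∀ (U V : Z × Z) (γ : Z → 𝔸), DifferentiableAt ℝ γ z →
      cdir (covDir U γ f) V z = cdir (cdir f U) V z + ((cdir γ V z * f z + γ z * cdir f V z)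
        - (cdir f V z * γ z + f z * cdir γ V z)) := by
    intro U V γ dγ
    rw [show covDir U γ f = fun y => cdir f U y + (γ y * f y - f y * γ y) from rfl,
      cdir_add (hf.cdir U).differentiableAt_infty ((dγ.fun_mul df).fun_sub (df.fun_mul dγ)),
      cdir_sub (dγ.fun_mul df) (df.fun_mul dγ), cdir_mul dγ df, cdir_mul df dγ]
  simp only [covDir, curvDir, e _ _ _ dα, e _ _ _ dβ, cdir_comm hf X Y]
  noncomm_ring

theorem cdir_curvDir {X Y W : Z × Z} {α β : Z → 𝔸} {z : Z} (hα : ContDiffAt ℝ ∞ α z)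
    (hβ : ContDiffAt ℝ ∞ β z) :
    cdir (curvDir X Y α β) W z = cdir (cdir β X) W z - cdir (cdir α Y) W z
      + ((cdir α W z * β z + α z * cdir β W z) - (cdir β W z * α z + β z * cdir α W z)) := by
  have dα := hα.differentiableAt_infty
  have dβ := hβ.differentiableAt_infty
  rw [show curvDir X Y α β =
      fun y => (cdir β X y - cdir α Y y) + (α y * β y - β y * α y) from rfl,
    cdir_add ((hβ.cdir X).differentiableAt_infty.fun_sub (hα.cdir Y).differentiableAt_infty)
      ((dα.fun_mul dβ).fun_sub (dβ.fun_mul dα)),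
    cdir_sub (hβ.cdir X).differentiableAt_infty (hα.cdir Y).differentiableAt_infty,
    cdir_sub (dα.fun_mul dβ) (dβ.fun_mul dα), cdir_mul dα dβ, cdir_mul dβ dα]

/-- The Bianchi identity. -/
theorem covDir_curvDir_cyclic {X Y W : Z × Z} {α β γ : Z → 𝔸} {z : Z} (hα : ContDiffAt ℝ ∞ α z)
    (hβ : ContDiffAt ℝ ∞ β z) (hγ : ContDiffAt ℝ ∞ γ z) :
    covDir X α (curvDir Y W β γ) z + covDir Y β (curvDir W X γ α) z
      + covDir W γ (curvDir X Y α β) z = 0 := by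
  simp only [covDir, cdir_curvDir hα hβ, cdir_curvDir hβ hγ, cdir_curvDir hγ hα]
  -- Jacobi identity for the three operators: second derivatives cancel in pairs by symmetry, and a
  -- formal identity in a noncommutative ring remains.
  rw [cdir_comm hγ Y X, cdir_comm hβ W X, cdir_comm hα W Y]
  simp only [curvDir]
  noncomm_ring

/-- Gauge covariance of the curvature. -/
theorem curvDir_gauge {X Y : Z × Z} {α β α₀ β₀ g : Z → 𝔸} {z : Z}
    (hα : ContDiffAt ℝ ∞ α z) (hβ : ContDiffAt ℝ ∞ β z)
    (hα₀ : ContDiffAt ℝ ∞ α₀ z) (hβ₀ : ContDiffAt ℝ ∞ β₀ z) (hg : ContDiffAt ℝ ∞ g z)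
    (hX : ∀ᶠ y in 𝓝 z, g y * α y = α₀ y * g y + cdir g X y)
    (hY : ∀ᶠ y in 𝓝 z, g y * β y = β₀ y * g y + cdir g Y y) :
    g z * curvDir X Y α β z = curvDir X Y α₀ β₀ z * g z := by
  have dg := hg.differentiableAt_infty
  -- The gauge relation holds near the point, so it may be differentiated. The second derivative of
  -- `g` that appears is the same for both directions and drops out of the curvature.
  have e : ∀ {U V : Z × Z} {γ γ₀ : Z → 𝔸}, ContDiffAt ℝ ∞ γ z → ContDiffAt ℝ ∞ γ₀ z →
      (∀ᶠ y in 𝓝 z, g y * γ y = γ₀ y * g y + cdir g U y) →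
      cdir g V z * γ z + g z * cdir γ V z =
        cdir γ₀ V z * g z + γ₀ z * cdir g V z + cdir (cdir g U) V z := by
    intro U V γ γ₀ hγ hγ₀ h
    have := Filter.EventuallyEq.cdir_eq h V
    rwa [cdir_mul dg hγ.differentiableAt_infty,
      cdir_add (hγ₀.differentiableAt_infty.fun_mul dg) (hg.cdir U).differentiableAt_infty,
      cdir_mul hγ₀.differentiableAt_infty dg] at this
  have e1 := e (V := Y) hα hα₀ hX
  have e2 := e (V := X) hβ hβ₀ hY
  rw [cdir_comm hg X Y] at e1
  have pX := hX.self_of_nhds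
  have pY := hY.self_of_nhds
  have r1 : g z * cdir α Y z = cdir α₀ Y z * g z + α₀ z * cdir g Y z + cdir (cdir g Y) X z
      - cdir g Y z * α z := by rw [← e1]; abel
  have r2 : g z * cdir β X z = cdir β₀ X z * g z + β₀ z * cdir g X z + cdir (cdir g Y) X z
      - cdir g X z * β z := by rw [← e2]; abel
  have q1 : g z * (α z * β z) = α₀ z * (β₀ z * g z + cdir g Y z) + cdir g X z * β z := by
    rw [← pY, ← mul_assoc, pX]; noncomm_ring
  have q2 : g z * (β z * α z) = β₀ z * (α₀ z * g z + cdir g X z) + cdir g Y z * α z := by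
    rw [← pX, ← mul_assoc, pY]; noncomm_ring
  simp only [curvDir, mul_add, mul_sub, r1, r2, q1, q2]
  noncomm_ring

/-- Gauge covariance of the covariant derivative. -/
theorem covDir_gauge {X : Z × Z} {α α₀ f f₀ g : Z → 𝔸} {z : Z}
    (hf : DifferentiableAt ℝ f z) (hf₀ : DifferentiableAt ℝ f₀ z) (dg : DifferentiableAt ℝ g z)
    (hX : g z * α z = α₀ z * g z + cdir g X z) (h : ∀ᶠ y in 𝓝 z, g y * f y = f₀ y * g y) :
    g z * covDir X α f z = covDir X α₀ f₀ z * g z := by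
  have e := Filter.EventuallyEq.cdir_eq h X
  rw [cdir_mul dg hf, cdir_mul hf₀ dg] at e
  have r : g z * cdir f X z = cdir f₀ X z * g z + f₀ z * cdir g X z - cdir g X z * f z := by
    rw [← e]; abel
  have p := h.self_of_nhds
  have q1 : g z * (α z * f z) = α₀ z * (f₀ z * g z) + cdir g X z * f z := by
    rw [← p, ← mul_assoc, hX]; noncomm_ring
  have q2 : g z * (f z * α z) = f₀ z * (α₀ z * g z + cdir g X z) := by
    rw [← hX, ← mul_assoc, p]; noncomm_ring
  simp only [covDir, mul_add, mul_sub, r, q1, q2]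
  noncomm_ring

end Covariant

/-! ### Alternating sums -/

section AltSum

variable {E N : Type*} [AddCommGroup N] {p : ℕ}

/-- The alternating sum of a function of `p` vectors over all permutations of the vectors. -/
def altSum (f : (Fin p → E) → N) (v : Fin p → E) : N :=
  ∑ σ : Equiv.Perm (Fin p), Equiv.Perm.sign σ • f (v ∘ σ)

theorem altSum_comp_perm (ρ : Equiv.Perm (Fin p)) (f : (Fin p → E) → N) (v : Fin p → E) :
    altSum (fun w => f (w ∘ ρ)) v = Equiv.Perm.sign ρ • altSum f v := by
  rw [altSum, altSum, Finset.smul_sum]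
  refine Fintype.sum_equiv (Equiv.mulRight ρ) _ _ fun σ => ?_
  rw [smul_smul, Equiv.coe_mulRight, Equiv.Perm.sign_mul, mul_comm, mul_assoc,
    Int.units_mul_self, mul_one]
  rfl

theorem altSum_add (f g : (Fin p → E) → N) (v : Fin p → E) :
    altSum (fun w => f w + g w) v = altSum f v + altSum g v := by
  simp only [altSum, smul_add, Finset.sum_add_distrib]

theorem altSum_sum {ι : Type*} (s : Finset ι) (f : ι → (Fin p → E) → N) (v : Fin p → E) :
    altSum (fun w => ∑ i ∈ s, f i w) v = ∑ i ∈ s, altSum (f i) v := by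
  simp only [altSum, Finset.smul_sum]
  exact Finset.sum_comm

theorem altSum_neg (f : (Fin p → E) → N) (v : Fin p → E) :
    altSum (fun w => -f w) v = -altSum f v := by
  simp only [altSum, smul_neg, Finset.sum_neg_distrib]

theorem altSum_sub (f g : (Fin p → E) → N) (v : Fin p → E) :
    altSum (fun w => f w - g w) v = altSum f v - altSum g v := by
  simp only [altSum, smul_sub, Finset.sum_sub_distrib]

/-- An alternating sum vanishes if the cyclic sums over three of the vectors vanish. -/
theorem altSum_eq_zero_of_cyclic {f : (Fin p → E) → ℂ} {a b c : Fin p} (hab : a ≠ b)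
    (hbc : b ≠ c)
    (h : ∀ v, f v + f (v ∘ (Equiv.swap a b * Equiv.swap b c : Equiv.Perm (Fin p)))
      + f (v ∘ (Equiv.swap b c * Equiv.swap a b : Equiv.Perm (Fin p))) = 0)
    (v : Fin p → E) : altSum f v = 0 := by
  -- Both permutations are 3-cycles, hence even. So three times the alternating sum of `f` is the
  -- alternating sum of the cyclic sums.
  have h1 := altSum_comp_perm (Equiv.swap a b * Equiv.swap b c) f v
  have h2 := altSum_comp_perm (Equiv.swap b c * Equiv.swap a b) f v
  rw [Equiv.Perm.sign_mul, Equiv.Perm.sign_swap hab, Equiv.Perm.sign_swap hbc, neg_mul_neg,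
    one_mul, one_smul] at h1 h2
  have h3 : altSum f v + altSum f v + altSum f v = 0 := by
    conv_lhs => enter [2]; rw [← h2]
    conv_lhs => enter [1, 2]; rw [← h1]
    rw [← altSum_add, ← altSum_add]
    simp only [h, altSum, smul_zero, Finset.sum_const_zero]
  have h4 : (3 : ℂ) * altSum f v = 0 := by rw [← h3]; ring
  simpa using h4

/-- The permutation of `0, …, p` that sends `0` to `i` and `k + 1` to `i.succAbove (σ k)`. -/
def permCons (q : Fin (p + 1) × Equiv.Perm (Fin p)) : Equiv.Perm (Fin (p + 1)) :=
  q.1.cycleRange.symm * Equiv.Perm.decomposeFin.symm (0, q.2)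

theorem permCons_zero (q : Fin (p + 1) × Equiv.Perm (Fin p)) : permCons q 0 = q.1 := by
  simp [permCons, Fin.cycleRange_symm_zero]

theorem permCons_succ (q : Fin (p + 1) × Equiv.Perm (Fin p)) (k : Fin p) :
    permCons q k.succ = q.1.succAbove (q.2 k) := by
  simp [permCons, Fin.cycleRange_symm_succ]

theorem permCons_bijective : Function.Bijective (permCons (p := p)) := by
  rw [Fintype.bijective_iff_injective_and_card]
  constructor
  · rintro ⟨i, σ⟩ ⟨j, τ⟩ h
    have h0 : i = j := by simpa [permCons_zero] using congrArg (fun ρ => ρ 0) h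
    subst h0
    congr 1
    ext1 k
    have hk := congrArg (fun ρ : Equiv.Perm (Fin (p + 1)) => ρ k.succ) h
    simpa [permCons_succ] using hk
  · simp [Fintype.card_perm, Nat.factorial_succ]

theorem sign_permCons (q : Fin (p + 1) × Equiv.Perm (Fin p)) :
    Equiv.Perm.sign (permCons q) = (-1) ^ (q.1 : ℕ) * Equiv.Perm.sign q.2 := by
  simp [permCons, Equiv.Perm.sign_mul, Equiv.Perm.sign_symm, Fin.sign_cycleRange]

/-- Choosing the vector that goes first and then a permutation of the others is choosing a
permutation of all of them, with matching signs. This turns the alternation in an exterior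
derivative and the alternation of the form into a single alternation. -/
theorem sum_altSum_removeNth (f : E → (Fin p → E) → N) (v : Fin (p + 1) → E) :
    ∑ i : Fin (p + 1), (-1 : ℤ) ^ (i : ℕ) • altSum (f (v i)) (i.removeNth v) =
      altSum (fun w => f (w 0) (Fin.tail w)) v := by
  rw [altSum, ← Fintype.sum_bijective permCons permCons_bijective (fun q =>
    (-1 : ℤ) ^ (q.1 : ℕ) • Equiv.Perm.sign q.2 • f (v q.1) (q.1.removeNth v ∘ q.2)) _ ?_,
    Fintype.sum_prod_type]
  · simp only [altSum, Finset.smul_sum]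
  · intro q
    rw [sign_permCons, mul_smul]
    have h1 : (v ∘ permCons q) 0 = v q.1 := by simp [permCons_zero]
    have h2 : Fin.tail (v ∘ permCons q) = q.1.removeNth v ∘ q.2 := by
      funext k
      simp [Fin.tail, permCons_succ, Fin.removeNth]
    rw [h1, h2, Units.smul_def ((-1) ^ (q.1 : ℕ))]
    simp

end AltSum

/-! ### Slots of multilinear functions -/

section Slots

variable {R 𝔸 : Type*} [CommRing R] [Ring 𝔸] [Algebra R 𝔸] {r : ℕ}

/-- The sum over all slots of the multilinear functions with `L` inserted in the slot. -/
def slotSum (ψ : MultilinearMap R (fun _ : Fin (r + 1) => 𝔸) R) :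
    𝔸 →ₗ[R] MultilinearMap R (fun _ : Fin r => 𝔸) R :=
  ∑ j, ψ.curryMid j

theorem slotSum_apply (ψ : MultilinearMap R (fun _ : Fin (r + 1) => 𝔸) R) (L : 𝔸)
    (B : Fin r → 𝔸) :
    slotSum ψ L B = ∑ j : Fin (r + 1), ψ (j.insertNth (α := fun _ => 𝔸) L B) := by
  simp only [slotSum, LinearMap.sum_apply, _root_.sum_apply]
  rfl

theorem linearDeriv_insertNth (ψ : MultilinearMap R (fun _ : Fin (r + 1) => 𝔸) R)
    (j : Fin (r + 1)) (L L' : 𝔸) (B B' : Fin r → 𝔸) :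
    ψ.linearDeriv (j.insertNth (α := fun _ => 𝔸) L B) (j.insertNth (α := fun _ => 𝔸) L' B') =
      ψ.curryMid j L' B + (ψ.curryMid j L).linearDeriv B B' := by
  rw [MultilinearMap.linearDeriv_apply, MultilinearMap.linearDeriv_apply,
    Fin.sum_univ_succAbove _ j]
  congr 1
  · rw [Fin.insertNth_apply_same, Fin.update_insertNth]
    rfl
  · refine Finset.sum_congr rfl fun i _ => ?_
    rw [Fin.insertNth_apply_succAbove]
    change _ = ψ (j.insertNth (α := fun _ => 𝔸) L (Function.update B i (B' i)))
    congr 1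
    exact (Fin.insertNth_update (α := fun _ => 𝔸) j L i (B' i) B).symm

/-- Leibniz rule for the sum over slots: either the inserted argument varies or one of the others
does. -/
theorem sum_linearDeriv_insertNth (ψ : MultilinearMap R (fun _ : Fin (r + 1) => 𝔸) R)
    (L L' : 𝔸) (B B' : Fin r → 𝔸) :
    ∑ j : Fin (r + 1), ψ.linearDeriv (j.insertNth (α := fun _ => 𝔸) L B)
        (j.insertNth (α := fun _ => 𝔸) L' B') =
      slotSum ψ L' B + (slotSum ψ L).linearDeriv B B' := by
  rw [Finset.sum_congr rfl fun j _ => linearDeriv_insertNth ψ j L L' B B',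
    Finset.sum_add_distrib]
  simp only [slotSum, LinearMap.sum_apply, _root_.sum_apply, MultilinearMap.linearDeriv_apply]
  congr 1
  exact Finset.sum_comm

/-- Both sides are sums over ordered pairs of distinct slots for `a` and `b`; only the order in
which the two slots are chosen differs. -/
theorem slotSum_comm (ψ : MultilinearMap R (fun _ : Fin (r + 2) => 𝔸) R) (a b : 𝔸) :
    slotSum (slotSum ψ a) b = slotSum (slotSum ψ b) a := by
  have key : ∀ (a b : 𝔸) (B : Fin r → 𝔸), slotSum (slotSum ψ a) b B =
      ∑ q : Fin (r + 2) × Fin (r + 1), ψ (q.1.insertNth (α := fun _ => 𝔸) a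
        (q.2.insertNth (α := fun _ => 𝔸) b B)) := by
    intro a b B
    rw [slotSum_apply, Fintype.sum_prod_type_right]
    exact Finset.sum_congr rfl fun i _ => slotSum_apply _ _ _
  ext B
  rw [key, key]
  -- A pair records the slot of the first element and the slot of the second among the remaining
  -- ones; `e` passes to the record with the roles exchanged.
  let e : Fin (r + 2) × Fin (r + 1) → Fin (r + 2) × Fin (r + 1) :=
    fun q => (q.1.succAbove q.2, q.2.predAbove q.1)
  have he : Function.Involutive e := by
    rintro ⟨i, j⟩
    simp [e, Fin.succAbove_succAbove_predAbove, Fin.predAbove_predAbove_succAbove]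
  refine Fintype.sum_bijective e he.bijective _ _ ?_
  rintro ⟨i, j⟩
  congr 1
  rw [Fin.eq_insertNth_iff]
  refine ⟨by simp [e], ?_⟩
  rw [Fin.eq_insertNth_iff]
  constructor
  · simp [e, Fin.removeNth, Fin.succAbove_succAbove_predAbove]
  · funext k
    simp [e, Fin.removeNth, Fin.succAbove_succAbove_succAbove_predAbove]

end Slots

/-! ### Pairs of vectors -/

section Pairs

variable {E 𝔸 : Type*} {r p : ℕ}

/-- The position of the `b`-th vector of the `i`-th of `r` pairs of vectors. -/
def pairIdx (i : Fin r) (b : Fin 2) : Fin (2 * r) :=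
  finProdFinEquiv.trans (finCongr (Nat.mul_comm r 2)) (i, b)

theorem val_pairIdx (i : Fin r) (b : Fin 2) : (pairIdx i b : ℕ) = b + 2 * i := rfl

theorem pairIdx_zero_zero : pairIdx (0 : Fin (r + 1)) 0 = (0 : Fin (2 * r + 1 + 1)) := by
  apply Fin.ext; simp [val_pairIdx]

theorem pairIdx_zero_one : pairIdx (0 : Fin (r + 1)) 1 = (1 : Fin (2 * r + 1 + 1)) := by
  apply Fin.ext
  rw [val_pairIdx]
  exact (Fin.val_one (2 * r)).symm

theorem pairIdx_succ (i : Fin r) (b : Fin 2) :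
    pairIdx i.succ b = ((pairIdx i b).succ.succ : Fin (2 * r + 1 + 1)) := by
  apply Fin.ext
  simp only [val_pairIdx, Fin.val_succ]
  ring

theorem pairIdx_injective {i j : Fin r} {b c : Fin 2} (h : pairIdx i b = pairIdx j c) :
    i = j ∧ b = c := by
  have := (finProdFinEquiv.trans (finCongr (Nat.mul_comm r 2))).injective h
  simpa using this

/-- The values of a bilinear function on `r` pairs of vectors. -/
def onPairs (F : E → E → 𝔸) (w : Fin (2 * r) → E) (i : Fin r) : 𝔸 :=
  F (w (pairIdx i 0)) (w (pairIdx i 1))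

variable [Ring 𝔸] [Algebra ℂ 𝔸]

/-- This is how the Bianchi identity acts on characteristic forms. When `F` in the pair `j` is
replaced by its derivative `T`, the cyclic sum over the direction `a` of differentiation and the two
vectors of that pair vanishes, so the alternating sum does. The function `Ψ` may depend on the
vectors in the other positions. -/
theorem altSum_linearDeriv_eq_zero {a : Fin p} {bk : Fin r → Fin 2 → Fin p}
    (ha : ∀ i b, bk i b ≠ a) (hbk : ∀ {i j b c}, bk i b = bk j c → i = j ∧ b = c)
    (Ψ : (Fin p → E) → MultilinearMap ℂ (fun _ : Fin r => 𝔸) ℂ)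
    (hΨ : ∀ (w : Fin p → E) (ρ : Equiv.Perm (Fin p)),
      (∀ k, k ≠ a → (∀ i b, k ≠ bk i b) → ρ k = k) → Ψ (w ∘ ρ) = Ψ w)
    (F : E → E → 𝔸) (T : E → E → E → 𝔸) (hT : ∀ u v w, T u v w + T v w u + T w u v = 0)
    (v : Fin p → E) :
    altSum (fun w => (Ψ w).linearDeriv (fun i => F (w (bk i 0)) (w (bk i 1)))
      (fun i => T (w a) (w (bk i 0)) (w (bk i 1)))) v = 0 := by
  simp only [MultilinearMap.linearDeriv_apply]
  rw [altSum_sum]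
  refine Finset.sum_eq_zero fun j _ => ?_
  have h01 : bk j 0 ≠ bk j 1 := fun h => by simpa using (hbk h).2
  have ha0 := ha j 0
  have ha1 := ha j 1
  have hother : ∀ i, i ≠ j → ∀ b c, bk i b ≠ bk j c := fun i hi b c h => hi (hbk h).1
  refine altSum_eq_zero_of_cyclic (a := a) (b := bk j 0) (c := bk j 1) ha0.symm h01
    (fun w => ?_) v
  -- Permuting only the three positions in question leaves `Ψ` and all slots other than `j`
  -- unchanged.
  have key : ∀ (ρ : Equiv.Perm (Fin p)), (∀ k, k ≠ a → k ≠ bk j 0 → k ≠ bk j 1 → ρ k = k) →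
      Ψ (w ∘ ρ) (Function.update (fun i => F ((w ∘ ρ) (bk i 0)) ((w ∘ ρ) (bk i 1))) j
        (T ((w ∘ ρ) a) ((w ∘ ρ) (bk j 0)) ((w ∘ ρ) (bk j 1)))) =
      Ψ w (Function.update (fun i => F (w (bk i 0)) (w (bk i 1))) j
        (T (w (ρ a)) (w (ρ (bk j 0))) (w (ρ (bk j 1))))) := by
    intro ρ hρ
    rw [hΨ w ρ fun k h1 h2 => hρ k h1 (h2 j 0) (h2 j 1)]
    congr 1
    funext i
    by_cases hi : i = j
    · subst hi; simp
    · simp only [Function.update_of_ne hi, Function.comp_apply]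
      rw [hρ _ (ha i 0) (hother i hi 0 0) (hother i hi 0 1),
        hρ _ (ha i 1) (hother i hi 1 0) (hother i hi 1 1)]
  rw [key _ fun k h1 h2 h3 => by
      rw [Equiv.Perm.mul_apply, Equiv.swap_apply_of_ne_of_ne h2 h3,
        Equiv.swap_apply_of_ne_of_ne h1 h2],
    key _ fun k h1 h2 h3 => by
      rw [Equiv.Perm.mul_apply, Equiv.swap_apply_of_ne_of_ne h1 h2,
        Equiv.swap_apply_of_ne_of_ne h2 h3],
    ← MultilinearMap.map_update_add, ← MultilinearMap.map_update_add]
  refine (Ψ w).map_coord_zero j ?_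
  rw [Function.update_self]
  simp only [Equiv.Perm.mul_apply, Equiv.swap_apply_left, Equiv.swap_apply_right,
    Equiv.swap_apply_of_ne_of_ne ha0.symm ha1.symm, Equiv.swap_apply_of_ne_of_ne ha1 h01.symm]
  exact hT _ _ _

theorem altSum_linearDeriv_onPairs_tail (ψ : MultilinearMap ℂ (fun _ : Fin r => 𝔸) ℂ)
    (F : E → E → 𝔸) (T : E → E → E → 𝔸) (hT : ∀ u v w, T u v w + T v w u + T w u v = 0)
    (v : Fin (2 * r + 1) → E) :
    altSum (fun w => ψ.linearDeriv (onPairs F (Fin.tail w)) (onPairs (T (w 0)) (Fin.tail w))) v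
      = 0 :=
  altSum_linearDeriv_eq_zero (a := 0) (bk := fun i b => (pairIdx i b).succ)
    (fun _ _ => Fin.succ_ne_zero _)
    (fun h => pairIdx_injective (Fin.succ_injective _ h)) (fun _ => ψ) (fun _ _ _ => rfl) F T hT v

/-- The variant with a free vector in position `1`, to be filled by a matrix valued `1`-form hidden
in `Ψ`. -/
theorem altSum_linearDeriv_onPairs_tail_tail
    (Ψ : E → MultilinearMap ℂ (fun _ : Fin r => 𝔸) ℂ)
    (F : E → E → 𝔸) (T : E → E → E → 𝔸) (hT : ∀ u v w, T u v w + T v w u + T w u v = 0)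
    (v : Fin (2 * r + 1 + 1) → E) :
    altSum (fun w => (Ψ (w 1)).linearDeriv (onPairs F (Fin.tail (Fin.tail w)))
      (onPairs (T (w 0)) (Fin.tail (Fin.tail w)))) v = 0 :=
  altSum_linearDeriv_eq_zero (a := 0) (bk := fun i b => (pairIdx i b).succ.succ)
    (fun _ _ => Fin.succ_ne_zero _)
    (fun h => pairIdx_injective (Fin.succ_injective _ (Fin.succ_injective _ h)))
    (fun w => Ψ (w 1))
    (fun w ρ h => by
      change Ψ (w (ρ 1)) = Ψ (w 1)
      rw [h 1 (by simp) fun i b hib => ?_]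
      rw [← Fin.succ_zero_eq_one] at hib
      exact Fin.succ_ne_zero _ (Fin.succ_injective _ hib).symm) F T hT v

/-- The anticommutation of two `1`-forms. -/
theorem altSum_swap_front {N : Type*} [AddCommGroup N] (h : E → E → (Fin p → E) → N)
    (v : Fin (p + 1 + 1) → E) :
    altSum (fun w => h (w 1) (w 0) (Fin.tail (Fin.tail w))) v =
      -altSum (fun w => h (w 0) (w 1) (Fin.tail (Fin.tail w))) v := by
  have := altSum_comp_perm (Equiv.swap 0 1)
    (fun w : Fin (p + 1 + 1) → E => h (w 0) (w 1) (Fin.tail (Fin.tail w))) v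
  rw [Equiv.Perm.sign_swap (by simp)] at this
  rw [Units.smul_def, Units.val_neg, Units.val_one, neg_one_smul] at this
  rw [← this]
  rfl

/-- Moving the pair in the slot `j` to the front does not change an alternating sum. -/
theorem altSum_update_onPairs (ψ : MultilinearMap ℂ (fun _ : Fin (r + 1) => 𝔸) ℂ)
    (F B : E → E → 𝔸) (j : Fin (r + 1)) (v : Fin (2 * (r + 1)) → E) :
    altSum (fun w => ψ (Function.update (onPairs F w) j (onPairs B w j))) v =
      altSum (p := 2 * r + 1 + 1)
        (fun w => ψ.curryMid j (B (w 0) (w 1)) (onPairs F (Fin.tail (Fin.tail w)))) v := by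
  let e := finProdFinEquiv.trans (finCongr (Nat.mul_comm (r + 1) 2))
  -- The cycle moves whole pairs, so it acts once on the first vectors and once on the second
  -- vectors; its sign is a square.
  let τ : Equiv.Perm (Fin (r + 1) × Fin 2) := Equiv.prodCongrLeft fun _ => j.cycleRange.symm
  let ρ : Equiv.Perm (Fin (2 * (r + 1))) := e.permCongr τ
  have hρ : ∀ i b, ρ (pairIdx i b) = pairIdx (j.cycleRange.symm i) b := by
    intro i b
    change e (τ (e.symm (e (i, b)))) = _
    rw [Equiv.symm_apply_apply]
    rfl
  have hs : Equiv.Perm.sign ρ = 1 := by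
    rw [Equiv.Perm.sign_permCongr, Equiv.Perm.sign_prodCongrLeft]
    simp
  have key := altSum_comp_perm (p := 2 * (r + 1)) ρ (fun w : Fin (2 * r + 1 + 1) → E =>
    ψ.curryMid j (B (w 0) (w 1)) (onPairs F (Fin.tail (Fin.tail w)))) v
  rw [hs, one_smul] at key
  rw [← key]
  congr 1
  funext w
  have h0 : ρ (0 : Fin (2 * r + 1 + 1)) = pairIdx j 0 := by
    rw [← pairIdx_zero_zero, hρ, Fin.cycleRange_symm_zero]
  have h1 : ρ (1 : Fin (2 * r + 1 + 1)) = pairIdx j 1 := by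
    rw [← pairIdx_zero_one, hρ, Fin.cycleRange_symm_zero]
  have h2 : ∀ i b, ρ ((pairIdx i b).succ.succ : Fin (2 * r + 1 + 1)) =
      pairIdx (j.succAbove i) b := by
    intro i b
    rw [← pairIdx_succ, hρ, Fin.cycleRange_symm_succ]
  change _ = ψ (j.insertNth (α := fun _ => 𝔸) (B (w (ρ _)) (w (ρ _))) _)
  rw [h0, h1]
  congr 1
  rw [Fin.eq_insertNth_iff]
  refine ⟨by simp [onPairs], ?_⟩
  funext i
  simp only [Fin.removeNth, Function.update_of_ne (Fin.succAbove_ne j i), onPairs, Fin.tail,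
    Function.comp_apply]
  rw [h2, h2]

/-- The alternating sum of the derivative of `ψ(F, …, F)` in the direction of `B`. -/
theorem altSum_linearDeriv_onPairs (ψ : MultilinearMap ℂ (fun _ : Fin (r + 1) => 𝔸) ℂ)
    (F B : E → E → 𝔸) (v : Fin (2 * (r + 1)) → E) :
    altSum (fun w => ψ.linearDeriv (onPairs F w) (onPairs B w)) v =
      altSum (p := 2 * r + 1 + 1)
        (fun w => slotSum ψ (B (w 0) (w 1)) (onPairs F (Fin.tail (Fin.tail w)))) v := by
  simp only [MultilinearMap.linearDeriv_apply, slotSum, LinearMap.sum_apply, _root_.sum_apply]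
  rw [altSum_sum, altSum_sum]
  exact Finset.sum_congr rfl fun j _ => altSum_update_onPairs ψ F B j v

end Pairs

/-! ### Derivatives of multilinear functions -/

section Multilinear

variable {Z 𝔸 : Type*} [NormedAddCommGroup Z] [NormedSpace ℝ Z]
  [NormedRing 𝔸] [NormedAlgebra ℂ 𝔸] [FiniteDimensional ℂ 𝔸] {k : ℕ}

theorem continuous_multilinear_complex (φ : MultilinearMap ℂ (fun _ : Fin k => 𝔸) ℂ) :
    Continuous φ := by
  let b := Module.finBasis ℂ 𝔸
  have h : ∀ v, φ v = ∑ r : Fin k → Fin (Module.finrank ℂ 𝔸),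
      (∏ i, b.repr (v i) (r i)) • φ (fun i => b (r i)) := by
    intro v
    conv_lhs => rw [show v = fun i => ∑ j, b.repr (v i) j • b j from
      funext fun i => (b.sum_repr (v i)).symm]
    rw [φ.map_sum]
    exact Finset.sum_congr rfl fun r _ => φ.map_smul_univ _ _
  rw [show (φ : (Fin k → 𝔸) → ℂ) = fun v => _ from funext h]
  refine continuous_finsetSum _ fun r _ => ?_
  refine Continuous.fun_smul (continuous_finsetProd _ fun i _ => ?_) continuous_const
  exact (LinearMap.continuous_of_finiteDimensional (b.coord (r i))).comp (continuous_apply i)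

theorem contDiff_multilinear (φ : MultilinearMap ℂ (fun _ : Fin k => 𝔸) ℂ) :
    ContDiff ℝ ∞ φ := by
  let φc : ContinuousMultilinearMap ℂ (fun _ : Fin k => 𝔸) ℂ :=
    ⟨φ, continuous_multilinear_complex φ⟩
  exact (φc.contDiff (n := ∞)).restrict_scalars ℝ

theorem ContDiffAt.multilinear (φ : MultilinearMap ℂ (fun _ : Fin k => 𝔸) ℂ)
    {B : Fin k → Z → 𝔸} {z : Z} (hB : ∀ i, ContDiffAt ℝ ∞ (B i) z) :
    ContDiffAt ℝ ∞ (fun y => φ fun i => B i y) z :=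
  (contDiff_multilinear φ).contDiffAt.comp z (contDiffAt_pi.2 hB)

theorem fderiv_multilinear (φ : MultilinearMap ℂ (fun _ : Fin k => 𝔸) ℂ)
    {B : Fin k → Z → 𝔸} {z : Z} (hB : ∀ i, DifferentiableAt ℝ (B i) z) (u : Z) :
    fderiv ℝ (fun y => φ fun i => B i y) z u =
      φ.linearDeriv (fun i => B i z) (fun i => fderiv ℝ (B i) z u) := by
  let φc : ContinuousMultilinearMap ℂ (fun _ : Fin k => 𝔸) ℂ :=
    ⟨φ, continuous_multilinear_complex φ⟩
  have h1 : HasFDerivAt φ ((φc.linearDeriv fun i => B i z).restrictScalars ℝ) (fun i => B i z) :=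
    (φc.hasFDerivAt (x := fun i => B i z)).restrictScalars ℝ
  have h2 : HasFDerivAt (fun y i => B i y) (ContinuousLinearMap.pi fun i => fderiv ℝ (B i) z) z :=
    hasFDerivAt_pi.2 fun i => (hB i).hasFDerivAt
  have h3 := h1.comp z h2
  rw [show (fun y => φ fun i => B i y) = φ ∘ fun y i => B i y from rfl, h3.fderiv]
  simp only [ContinuousLinearMap.comp_apply, ContinuousLinearMap.coe_restrictScalars',
    ContinuousMultilinearMap.linearDeriv_apply, MultilinearMap.linearDeriv_apply]
  rfl

theorem cdir_multilinear (φ : MultilinearMap ℂ (fun _ : Fin k => 𝔸) ℂ)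
    {B : Fin k → Z → 𝔸} {z : Z} (hB : ∀ i, DifferentiableAt ℝ (B i) z) (X : Z × Z) :
    cdir (fun y => φ fun i => B i y) X z =
      φ.linearDeriv (fun i => B i z) (fun i => cdir (B i) X z) := by
  rw [cdir, fderiv_multilinear φ hB, fderiv_multilinear φ hB, ← map_smul, ← map_add]
  rfl

/-- Infinitesimal invariance of a multilinear function under conjugation. -/
def IsAdInvariant (φ : MultilinearMap ℂ (fun _ : Fin k => 𝔸) ℂ) : Prop :=
  ∀ (a : 𝔸) (B : Fin k → 𝔸), φ.linearDeriv B (fun i => a * B i - B i * a) = 0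

/-- Apply invariance to the tuple `B i * g` to get `φ(g B) = φ(B g)`, and differentiate at `g = 1`
along `1 + t a`, which is invertible for small `t`. -/
theorem isAdInvariant_of_conj [CompleteSpace 𝔸] (φ : MultilinearMap ℂ (fun _ : Fin k => 𝔸) ℂ)
    (h : ∀ (g : 𝔸ˣ) (B : Fin k → 𝔸), φ (fun i => g * B i * ((g⁻¹ : 𝔸ˣ) : 𝔸)) = φ B) :
    IsAdInvariant φ := by
  intro a B
  have hg : ∀ᶠ t : ℝ in 𝓝 0, (φ fun i => (1 + t • a) * B i) = φ fun i => B i * (1 + t • a) := by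
    have hc : ContinuousAt (fun t : ℝ => 1 + t • a) 0 := by fun_prop
    have hU : ∀ᶠ x in 𝓝 ((fun t : ℝ => 1 + t • a) 0), IsUnit x := by
      apply Units.isOpen.mem_nhds
      simp
    filter_upwards [hc.eventually hU] with t ht
    obtain ⟨g, hg⟩ := ht
    rw [← hg, ← h g fun i => B i * g]
    simp [mul_assoc]
  have d1 : ∀ i, HasFDerivAt (fun t : ℝ => (1 + t • a) * B i)
      (ContinuousLinearMap.toSpanSingleton ℝ (a * B i)) 0 := by
    intro i
    have : (fun t : ℝ => (1 + t • a) * B i) = fun t => B i + t • (a * B i) := by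
      funext t; rw [add_mul, one_mul, smul_mul_assoc]
    rw [this]
    exact (ContinuousLinearMap.toSpanSingleton ℝ (a * B i)).hasFDerivAt.const_add (B i)
  have d2 : ∀ i, HasFDerivAt (fun t : ℝ => B i * (1 + t • a))
      (ContinuousLinearMap.toSpanSingleton ℝ (B i * a)) 0 := by
    intro i
    have : (fun t : ℝ => B i * (1 + t • a)) = fun t => B i + t • (B i * a) := by
      funext t; rw [mul_add, mul_one, mul_smul_comm]
    rw [this]
    exact (ContinuousLinearMap.toSpanSingleton ℝ (B i * a)).hasFDerivAt.const_add (B i)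
  have e := congrArg (fun l : ℝ →L[ℝ] ℂ => l 1) (Filter.EventuallyEq.fderiv_eq hg)
  rw [fderiv_multilinear φ (B := fun i (t : ℝ) => (1 + t • a) * B i)
      fun i => (d1 i).differentiableAt,
    fderiv_multilinear φ (B := fun i (t : ℝ) => B i * (1 + t • a))
      fun i => (d2 i).differentiableAt] at e
  simp only [(d1 _).fderiv, (d2 _).fderiv, ContinuousLinearMap.toSpanSingleton_apply, zero_smul,
    add_zero, one_mul, mul_one, one_smul] at e
  rw [show (fun i => a * B i - B i * a) = (fun i => a * B i) - fun i => B i * a from rfl,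
    map_sub, e, sub_self]

/-- The derivative of an invariant multilinear function, by means of covariant derivatives. -/
theorem IsAdInvariant.cdir_eq {φ : MultilinearMap ℂ (fun _ : Fin k => 𝔸) ℂ}
    (hφ : IsAdInvariant φ) {B : Fin k → Z → 𝔸} {z : Z}
    (hB : ∀ i, DifferentiableAt ℝ (B i) z) (X : Z × Z) (α : Z → 𝔸) :
    cdir (fun y => φ fun i => B i y) X z =
      φ.linearDeriv (fun i => B i z) (fun i => covDir X α (B i) z) := by
  have : (fun i => covDir X α (B i) z) = (fun i => cdir (B i) X z)
      + fun i => α z * B i z - B i z * α z := rfl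
  rw [this, map_add, hφ, add_zero, cdir_multilinear φ hB]

theorem insertNth_fun {k : ℕ} (j : Fin (k + 1)) {S : Type*} (L : S → 𝔸) (B : Fin k → S → 𝔸)
    (g : (S → 𝔸) → 𝔸) :
    (fun i => g (j.insertNth (α := fun _ => S → 𝔸) L B i)) =
      j.insertNth (α := fun _ => 𝔸) (g L) (fun i => g (B i)) := by
  rw [Fin.eq_insertNth_iff]
  refine ⟨by simp, ?_⟩
  funext i
  simp [Fin.removeNth]

/-- For fixed `L` the function `slotSum φ L` need not be invariant. Invariance of `φ` is therefore
applied to each tuple with `L` inserted, and `L` acquires a covariant derivative as well. -/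
theorem IsAdInvariant.cdir_slotSum {φ : MultilinearMap ℂ (fun _ : Fin (k + 1) => 𝔸) ℂ}
    (hφ : IsAdInvariant φ) {L : Z → 𝔸} {B : Fin k → Z → 𝔸} {z : Z}
    (hL : DifferentiableAt ℝ L z) (hB : ∀ i, DifferentiableAt ℝ (B i) z) (X : Z × Z)
    (α : Z → 𝔸) :
    cdir (fun y => slotSum φ (L y) fun i => B i y) X z =
      slotSum φ (covDir X α L z) (fun i => B i z) +
        (slotSum φ (L z)).linearDeriv (fun i => B i z) (fun i => covDir X α (B i) z) := by
  have hins : ∀ (j : Fin (k + 1)) i,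
      DifferentiableAt ℝ (j.insertNth (α := fun _ => Z → 𝔸) L B i) z := fun j i => by
    cases i using Fin.succAboveCases j <;> simp [hL, hB]
  have e : (fun y => slotSum φ (L y) fun i => B i y) =
      fun y => ∑ j : Fin (k + 1), φ fun i => j.insertNth (α := fun _ => Z → 𝔸) L B i y := by
    funext y
    rw [slotSum_apply]
    exact Finset.sum_congr rfl fun j _ => congrArg φ (insertNth_fun j L B fun f => f y).symm
  rw [e, cdir_sum fun j _ => ?_, ← sum_linearDeriv_insertNth]
  · refine Finset.sum_congr rfl fun j _ => ?_
    rw [hφ.cdir_eq (hins j) X α, insertNth_fun j L B fun f => f z,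
      insertNth_fun j L B fun f => covDir X α f z]
  · have := (contDiff_multilinear φ).differentiable (by simp)
    exact (this _).comp z (differentiableAt_pi.2 (hins j))

theorem IsAdInvariant.cdir_slotSum_slotSum {φ : MultilinearMap ℂ (fun _ : Fin (k + 2) => 𝔸) ℂ}
    (hφ : IsAdInvariant φ) {L N : Z → 𝔸} {B : Fin k → Z → 𝔸} {z : Z}
    (hL : DifferentiableAt ℝ L z) (hN : DifferentiableAt ℝ N z)
    (hB : ∀ i, DifferentiableAt ℝ (B i) z) (X : Z × Z) (α : Z → 𝔸) :
    cdir (fun y => slotSum (slotSum φ (L y)) (N y) fun i => B i y) X z =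
      slotSum (slotSum φ (covDir X α L z)) (N z) (fun i => B i z) +
      slotSum (slotSum φ (L z)) (covDir X α N z) (fun i => B i z) +
        (slotSum (slotSum φ (L z)) (N z)).linearDeriv (fun i => B i z)
          (fun i => covDir X α (B i) z) := by
  have hins : ∀ (j : Fin (k + 1)) i,
      DifferentiableAt ℝ (j.insertNth (α := fun _ => Z → 𝔸) N B i) z := fun j i => by
    cases i using Fin.succAboveCases j <;> simp [hN, hB]
  have e : (fun y => slotSum (slotSum φ (L y)) (N y) fun i => B i y) =
      fun y => ∑ j : Fin (k + 1),
        slotSum φ (L y) fun i => j.insertNth (α := fun _ => Z → 𝔸) N B i y := by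
    funext y
    rw [slotSum_apply]
    exact Finset.sum_congr rfl fun j _ =>
      congrArg (slotSum φ (L y)) (insertNth_fun j N B fun f => f y).symm
  rw [e, cdir_sum fun j _ => ?_, add_assoc, ← sum_linearDeriv_insertNth, slotSum_apply,
    ← Finset.sum_add_distrib]
  · refine Finset.sum_congr rfl fun j _ => ?_
    rw [hφ.cdir_slotSum hL (hins j) X α, insertNth_fun j N B fun f => f z,
      insertNth_fun j N B fun f => covDir X α f z]
  -- Only differentiability of the summands is left: each one is a sum of values of `φ` on tuples
  -- with both `L` and `N` inserted.
  · have h : (fun y => slotSum φ (L y) fun i => j.insertNth (α := fun _ => Z → 𝔸) N B i y) =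
        fun y => ∑ l : Fin (k + 2), φ fun i => l.insertNth (α := fun _ => Z → 𝔸) L
          (j.insertNth (α := fun _ => Z → 𝔸) N B) i y := by
      funext y
      rw [slotSum_apply]
      exact Finset.sum_congr rfl fun l _ => congrArg φ (insertNth_fun l L _ fun f => f y).symm
    rw [h]
    refine DifferentiableAt.fun_sum fun l _ => ?_
    have := (contDiff_multilinear φ).differentiable (by simp)
    refine (this _).comp z (differentiableAt_pi.2 fun i => ?_)
    cases i using Fin.succAboveCases l <;> simp [hL, hins]

theorem ContDiffAt.slotSum (φ : MultilinearMap ℂ (fun _ : Fin (k + 1) => 𝔸) ℂ)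
    {L : Z → 𝔸} {B : Fin k → Z → 𝔸} {z : Z} (hL : ContDiffAt ℝ ∞ L z)
    (hB : ∀ i, ContDiffAt ℝ ∞ (B i) z) :
    ContDiffAt ℝ ∞ (fun y => slotSum φ (L y) fun i => B i y) z := by
  simp only [slotSum_apply]
  refine ContDiffAt.sum fun j _ => ?_
  refine (contDiff_multilinear φ).contDiffAt.comp z (contDiffAt_pi.2 fun i => ?_)
  cases i using Fin.succAboveCases j <;> simp [hL, hB]

theorem ContDiffAt.slotSum_slotSum (φ : MultilinearMap ℂ (fun _ : Fin (k + 2) => 𝔸) ℂ)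
    {L N : Z → 𝔸} {B : Fin k → Z → 𝔸} {z : Z} (hL : ContDiffAt ℝ ∞ L z)
    (hN : ContDiffAt ℝ ∞ N z) (hB : ∀ i, ContDiffAt ℝ ∞ (B i) z) :
    ContDiffAt ℝ ∞ (fun y => _root_.slotSum (_root_.slotSum φ (L y)) (N y) fun i => B i y) z := by
  simp only [slotSum_apply (_root_.slotSum φ _)]
  refine ContDiffAt.sum fun j _ => ?_
  have h : (fun y => _root_.slotSum φ (L y) (j.insertNth (α := fun _ => 𝔸) (N y) fun i => B i y)) =
      fun y => _root_.slotSum φ (L y) fun i => j.insertNth (α := fun _ => Z → 𝔸) N B i y := by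
    funext y
    exact congrArg (_root_.slotSum φ (L y)) (insertNth_fun j N B fun f => f y).symm
  rw [h]
  refine ContDiffAt.slotSum φ hL fun i => ?_
  cases i using Fin.succAboveCases j <;> simp [hN, hB]

/-- The sum over `j` of the infinitesimal invariance of `φ` at the tuples with `L` in slot `j`. It
shifts a commutator from the curvatures to the inserted matrix. -/
theorem IsAdInvariant.slotSum_bracket {φ : MultilinearMap ℂ (fun _ : Fin (k + 1) => 𝔸) ℂ}
    (hφ : IsAdInvariant φ) (a L : 𝔸) (B : Fin k → 𝔸) :
    (slotSum φ L).linearDeriv B (fun i => a * B i - B i * a) =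
      -slotSum φ (a * L - L * a) B := by
  rw [eq_neg_iff_add_eq_zero, add_comm, ← sum_linearDeriv_insertNth]
  refine Finset.sum_eq_zero fun j _ => ?_
  rw [← hφ a (j.insertNth (α := fun _ => 𝔸) L B)]
  congr 1
  symm
  rw [Fin.eq_insertNth_iff]
  refine ⟨by simp, ?_⟩
  funext i
  simp [Fin.removeNth]

end Multilinear

/-! ### Transgression identities for pairs of flat partial connections -/

section Transgression

variable (E Z 𝔸 : Type*) [NormedAddCommGroup Z] [NormedSpace ℝ Z]
  [NormedRing 𝔸] [NormedAlgebra ℂ 𝔸]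

/-- Two families of flat partial connections `∂̄_v + a_v` and `∂_v + c_v`, in the directions
`dbar v` and `del v`, on an open set `U`. -/
structure FlatPair where
  U : Set Z
  isOpen : IsOpen U
  dbar : E → Z × Z
  del : E → Z × Z
  a : E → Z → 𝔸
  c : E → Z → 𝔸
  smooth_a : ∀ v, ∀ y ∈ U, ContDiffAt ℝ ∞ (a v) y
  smooth_c : ∀ v, ∀ y ∈ U, ContDiffAt ℝ ∞ (c v) y
  flat_a : ∀ v w, ∀ y ∈ U, curvDir (dbar v) (dbar w) (a v) (a w) y = 0
  flat_c : ∀ v w, ∀ y ∈ U, curvDir (del v) (del w) (c v) (c w) y = 0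

variable {E Z 𝔸}

namespace FlatPair

variable (P : FlatPair E Z 𝔸)

/-- The covariant derivative `∇''_v`. -/
def nabla'' (v : E) (f : Z → 𝔸) : Z → 𝔸 := covDir (P.dbar v) (P.a v) f

/-- The covariant derivative `∇'_v`. -/
def nabla' (v : E) (f : Z → 𝔸) : Z → 𝔸 := covDir (P.del v) (P.c v) f

/-- The mixed curvature `[∇''_v, ∇'_w]`. -/
def mixed (v w : E) : Z → 𝔸 := curvDir (P.dbar v) (P.del w) (P.a v) (P.c w)

/-- The curvature of the total connection. -/
def curv (y : Z) (v w : E) : 𝔸 := P.mixed v w y - P.mixed w v y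

variable {P} {z : Z}

theorem smooth_mixed (hz : z ∈ P.U) (v w : E) : ContDiffAt ℝ ∞ (P.mixed v w) z :=
  (P.smooth_a v z hz).curvDir (P.smooth_c w z hz)

theorem smooth_curv (hz : z ∈ P.U) (v w : E) : ContDiffAt ℝ ∞ (fun y => P.curv y v w) z :=
  (smooth_mixed hz v w).sub (smooth_mixed hz w v)

theorem smooth_onPairs {r : ℕ} (hz : z ∈ P.U) (w : Fin (2 * r) → E) (i : Fin r) :
    ContDiffAt ℝ ∞ (fun y => onPairs (P.curv y) w i) z :=
  smooth_curv hz _ _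

theorem smooth_nabla' (hz : z ∈ P.U) {f : Z → 𝔸} (hf : ContDiffAt ℝ ∞ f z) (v : E) :
    ContDiffAt ℝ ∞ (P.nabla' v f) z :=
  (P.smooth_c v z hz).covDir hf

theorem smooth_nabla'' (hz : z ∈ P.U) {f : Z → 𝔸} (hf : ContDiffAt ℝ ∞ f z) (v : E) :
    ContDiffAt ℝ ∞ (P.nabla'' v f) z :=
  (P.smooth_a v z hz).covDir hf

theorem eventually_mem (hz : z ∈ P.U) : ∀ᶠ y in 𝓝 z, y ∈ P.U := P.isOpen.mem_nhds hz

theorem covDir_zero (X : Z × Z) (α : Z → 𝔸) (z : Z) : covDir X α (fun _ => 0) z = 0 := by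
  simp [covDir]

theorem covDir_neg (X : Z × Z) (α f : Z → 𝔸) (z : Z) :
    covDir X α (fun y => -f y) z = -covDir X α f z := by
  simp only [covDir, cdir, fderiv_fun_neg, _root_.neg_apply, smul_neg]
  noncomm_ring

theorem covDir_sub {X : Z × Z} {α f g : Z → 𝔸} (hf : DifferentiableAt ℝ f z)
    (hg : DifferentiableAt ℝ g z) :
    covDir X α (fun y => f y - g y) z = covDir X α f z - covDir X α g z := by
  simp only [covDir, cdir_sub hf hg]
  noncomm_ring

/-- Bianchi identity for `∇''_u`, `∇''_v`, `∇'_w`: the curvature of the first two vanishes, so just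
two terms survive. -/
theorem nabla''_mixed (hz : z ∈ P.U) (u v w : E) :
    P.nabla'' u (P.mixed v w) z = P.nabla'' v (P.mixed u w) z := by
  have h := covDir_curvDir_cyclic (X := P.dbar u) (Y := P.dbar v) (W := P.del w)
    (P.smooth_a u z hz) (P.smooth_a v z hz) (P.smooth_c w z hz)
  have h1 : curvDir (P.dbar u) (P.dbar v) (P.a u) (P.a v) =ᶠ[𝓝 z] fun _ => 0 := by
    filter_upwards [eventually_mem hz] with y hy using P.flat_a u v y hy
  have h2 : curvDir (P.del w) (P.dbar u) (P.c w) (P.a u) = fun y => -P.mixed u w y := by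
    funext y; exact curvDir_swap _ _ _ _ _
  rw [h1.covDir_eq, covDir_zero, h2, covDir_neg, add_zero, ← sub_eq_add_neg, sub_eq_zero] at h
  exact h

theorem nabla'_mixed (hz : z ∈ P.U) (u v w : E) :
    P.nabla' u (P.mixed v w) z = P.nabla' w (P.mixed v u) z := by
  have h := covDir_curvDir_cyclic (X := P.del u) (Y := P.dbar v) (W := P.del w)
    (P.smooth_c u z hz) (P.smooth_a v z hz) (P.smooth_c w z hz)
  have h1 : curvDir (P.del w) (P.del u) (P.c w) (P.c u) =ᶠ[𝓝 z] fun _ => 0 := by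
    filter_upwards [eventually_mem hz] with y hy using P.flat_c w u y hy
  have h2 : curvDir (P.del u) (P.dbar v) (P.c u) (P.a v) = fun y => -P.mixed v u y := by
    funext y; exact curvDir_swap _ _ _ _ _
  rw [h1.covDir_eq, covDir_zero, h2, covDir_neg, add_zero, ← sub_eq_add_neg, sub_eq_zero] at h
  exact h

/-- The Bianchi identity holds for `∇''` alone: the six mixed terms cancel in pairs by the symmetry
in `nabla''_mixed`. -/
theorem nabla''_curv_cyclic (hz : z ∈ P.U) (u v w : E) :
    P.nabla'' u (fun y => P.curv y v w) z + P.nabla'' v (fun y => P.curv y w u) z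
      + P.nabla'' w (fun y => P.curv y u v) z = 0 := by
  have e : ∀ u v w, P.nabla'' u (fun y => P.curv y v w) z =
      P.nabla'' u (P.mixed v w) z - P.nabla'' u (P.mixed w v) z := fun u v w =>
    covDir_sub (smooth_mixed hz v w).differentiableAt_infty
      (smooth_mixed hz w v).differentiableAt_infty
  rw [e, e, e, nabla''_mixed hz u v w, nabla''_mixed hz v w u, nabla''_mixed hz w u v]
  abel

theorem nabla'_curv_cyclic (hz : z ∈ P.U) (u v w : E) :
    P.nabla' u (fun y => P.curv y v w) z + P.nabla' v (fun y => P.curv y w u) z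
      + P.nabla' w (fun y => P.curv y u v) z = 0 := by
  have e : ∀ u v w, P.nabla' u (fun y => P.curv y v w) z =
      P.nabla' u (P.mixed v w) z - P.nabla' u (P.mixed w v) z := fun u v w =>
    covDir_sub (smooth_mixed hz v w).differentiableAt_infty
      (smooth_mixed hz w v).differentiableAt_infty
  rw [e, e, e, nabla'_mixed hz u v w, nabla'_mixed hz v w u, nabla'_mixed hz w u v]
  abel

variable (P) in
/-- `L` is the logarithmic derivative in the direction `T` of a family of metrics: the operator
`∂_T + L` commutes with `∇'`, and `∂_T` commutes with `∇''`. -/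
structure IsVariation (T : Z × Z) (L : Z → 𝔸) : Prop where
  smooth : ∀ y ∈ P.U, ContDiffAt ℝ ∞ L y
  comm : ∀ v, ∀ y ∈ P.U, curvDir T (P.del v) L (P.c v) y = 0
  const : ∀ v, ∀ y ∈ P.U, cdir (P.a v) T y = 0

variable {T S : Z × Z} {L N : Z → 𝔸}

/-- Bianchi identity for `∂_T + L`, `∇''_v`, `∇'_w`. The first commutes with the third, and its
curvature with the second is `-∇''_v L`, which gives `∂_T [∇''_v, ∇'_w] + [L, [∇''_v, ∇'_w]] = ∇'_w
∇''_v L`. Exchanging `∇'_w` and `∇''_v` on the right absorbs the commutator with `L`. -/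
theorem IsVariation.cdir_mixed (h : P.IsVariation T L) (hz : z ∈ P.U) (v w : E) :
    cdir (P.mixed v w) T z = P.nabla'' v (P.nabla' w L) z := by
  have sL := h.smooth z hz
  have j := covDir_curvDir_cyclic (X := T) (Y := P.dbar v) (W := P.del w)
    sL (P.smooth_a v z hz) (P.smooth_c w z hz)
  have h1 : curvDir (P.del w) T (P.c w) L =ᶠ[𝓝 z] fun _ => 0 := by
    filter_upwards [eventually_mem hz] with y hy
    rw [curvDir_swap, h.comm w y hy, neg_zero]
  have h2 : curvDir T (P.dbar v) L (P.a v) =ᶠ[𝓝 z] fun y => -P.nabla'' v L y := by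
    filter_upwards [eventually_mem hz] with y hy
    rw [curvDir, h.const v y hy, nabla'', covDir]
    abel
  rw [h1.covDir_eq, covDir_zero, h2.covDir_eq, covDir_neg, add_zero] at j
  have r := covDir_covDir_sub (X := P.dbar v) (Y := P.del w) (P.smooth_a v z hz)
    (P.smooth_c w z hz) sL
  change _ = P.mixed v w z * L z - L z * P.mixed v w z at r
  change covDir T L (P.mixed v w) z + _ = 0 at j
  rw [covDir] at j
  change covDir (P.dbar v) (P.a v) (P.nabla' w L) z
    - covDir (P.del w) (P.c w) (P.nabla'' v L) z = _ at r
  rw [nabla'', eq_add_of_sub_eq r, eq_neg_of_add_eq_zero_left (by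
    rw [← j]; abel : cdir (P.mixed v w) T z + (L z * P.mixed v w z - P.mixed v w z * L z
      + -covDir (P.del w) (P.c w) (P.nabla'' v L) z) = 0)]
  abel

theorem IsVariation.cdir_curv (h : P.IsVariation T L) (hz : z ∈ P.U) (v w : E) :
    cdir (fun y => P.curv y v w) T z =
      P.nabla'' v (P.nabla' w L) z - P.nabla'' w (P.nabla' v L) z := by
  rw [← h.cdir_mixed hz, ← h.cdir_mixed hz]
  exact cdir_sub (smooth_mixed hz v w).differentiableAt_infty
    (smooth_mixed hz w v).differentiableAt_infty _

theorem nabla'_nabla'' (hz : z ∈ P.U) (hL : ContDiffAt ℝ ∞ L z) (v w : E) :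
    P.nabla' w (P.nabla'' v L) z = P.nabla'' v (P.nabla' w L) z
      - (P.mixed v w z * L z - L z * P.mixed v w z) := by
  have r := covDir_covDir_sub (X := P.dbar v) (Y := P.del w) (P.smooth_a v z hz)
    (P.smooth_c w z hz) hL
  change P.nabla'' v (P.nabla' w L) z - P.nabla' w (P.nabla'' v L) z =
    P.mixed v w z * L z - L z * P.mixed v w z at r
  rw [← r]
  abel

variable [FiniteDimensional ℂ 𝔸] {m : ℕ}

/-- In form notation, `∂ φ'(F, L) = φ'(F, ∇'L)`: the Leibniz rule with covariant derivatives, where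
the terms with `∇'F` vanish by the Bianchi identity. -/
theorem altSum_del_slotSum {φ : MultilinearMap ℂ (fun _ : Fin (m + 1) => 𝔸) ℂ}
    (hφ : IsAdInvariant φ) (hz : z ∈ P.U) (hL : ContDiffAt ℝ ∞ L z) (v : Fin (2 * m + 1) → E) :
    altSum (fun w => cdir (fun y => slotSum φ (L y) (onPairs (P.curv y) (Fin.tail w)))
      (P.del (w 0)) z) v =
    altSum (fun w => slotSum φ (P.nabla' (w 0) L z) (onPairs (P.curv z) (Fin.tail w))) v := by
  have e : ∀ w : Fin (2 * m + 1) → E,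
      cdir (fun y => slotSum φ (L y) (onPairs (P.curv y) (Fin.tail w))) (P.del (w 0)) z =
      slotSum φ (P.nabla' (w 0) L z) (onPairs (P.curv z) (Fin.tail w)) +
        (slotSum φ (L z)).linearDeriv (onPairs (P.curv z) (Fin.tail w))
          (onPairs (fun v' w' => P.nabla' (w 0) (fun y => P.curv y v' w') z) (Fin.tail w)) :=
    fun w => hφ.cdir_slotSum hL.differentiableAt_infty
      (fun i => (smooth_onPairs hz _ i).differentiableAt_infty) _ (P.c (w 0))
  simp only [e]
  rw [altSum_add, altSum_linearDeriv_onPairs_tail _ _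
    (fun u v' w' => P.nabla' u (fun y => P.curv y v' w') z) (nabla'_curv_cyclic hz), add_zero]

/-- In form notation, `∂̄ φ'(F, ∇'L) = φ'(F, ∇''∇'L)`, for the same reason with `∇''`. -/
theorem altSum_dbar_slotSum_nabla' {φ : MultilinearMap ℂ (fun _ : Fin (m + 1) => 𝔸) ℂ}
    (hφ : IsAdInvariant φ) (hz : z ∈ P.U) (hL : ContDiffAt ℝ ∞ L z)
    (v : Fin (2 * m + 1 + 1) → E) :
    altSum (fun w => cdir (fun y => slotSum φ (P.nabla' (w 1) L y)
      (onPairs (P.curv y) (Fin.tail (Fin.tail w)))) (P.dbar (w 0)) z) v =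
    altSum (fun w => slotSum φ (P.nabla'' (w 0) (P.nabla' (w 1) L) z)
      (onPairs (P.curv z) (Fin.tail (Fin.tail w)))) v := by
  have e : ∀ w : Fin (2 * m + 1 + 1) → E,
      cdir (fun y => slotSum φ (P.nabla' (w 1) L y)
        (onPairs (P.curv y) (Fin.tail (Fin.tail w)))) (P.dbar (w 0)) z =
      slotSum φ (P.nabla'' (w 0) (P.nabla' (w 1) L) z)
        (onPairs (P.curv z) (Fin.tail (Fin.tail w))) +
        (slotSum φ (P.nabla' (w 1) L z)).linearDeriv (onPairs (P.curv z) (Fin.tail (Fin.tail w)))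
          (onPairs (fun v' w' => P.nabla'' (w 0) (fun y => P.curv y v' w') z)
            (Fin.tail (Fin.tail w))) :=
    fun w => hφ.cdir_slotSum (smooth_nabla' hz hL _).differentiableAt_infty
      (fun i => (smooth_onPairs hz _ i).differentiableAt_infty) _ (P.a (w 0))
  simp only [e]
  rw [altSum_add, altSum_linearDeriv_onPairs_tail_tail (fun u => slotSum φ (P.nabla' u L z)) _
    (fun u v' w' => P.nabla'' u (fun y => P.curv y v' w') z) (nabla''_curv_cyclic hz), add_zero]

theorem altSum_sub_swap_front {p : ℕ} (h : E → E → (Fin p → E) → ℂ) (v : Fin (p + 1 + 1) → E) :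
    altSum (fun w => h (w 0) (w 1) (Fin.tail (Fin.tail w))
      - h (w 1) (w 0) (Fin.tail (Fin.tail w))) v =
    2 * altSum (fun w => h (w 0) (w 1) (Fin.tail (Fin.tail w))) v := by
  rw [altSum_sub, altSum_swap_front h]
  ring

/-- The variation of `F(v, w)` antisymmetrises `∇''_v ∇'_w L`; inside an alternating sum this is a
factor `2`. Invariance plays no role, so the statement also applies to `ψ = slotSum φ L` in the
two-parameter computation. -/
theorem IsVariation.altSum_linearDeriv (h : P.IsVariation T L) (hz : z ∈ P.U)
    (ψ : MultilinearMap ℂ (fun _ : Fin (m + 1) => 𝔸) ℂ) (v : Fin (2 * (m + 1)) → E) :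
    altSum (fun w => ψ.linearDeriv (onPairs (P.curv z) w)
      (fun i => cdir (fun y => onPairs (P.curv y) w i) T z)) v =
    2 * altSum (p := 2 * m + 1 + 1) (fun w => slotSum ψ (P.nabla'' (w 0) (P.nabla' (w 1) L) z)
      (onPairs (P.curv z) (Fin.tail (Fin.tail w)))) v := by
  have e : ∀ w : Fin (2 * (m + 1)) → E, (fun i => cdir (fun y => onPairs (P.curv y) w i) T z) =
      onPairs (fun v' w' => P.nabla'' v' (P.nabla' w' L) z - P.nabla'' w' (P.nabla' v' L) z) w :=
    fun w => funext fun i => h.cdir_curv hz _ _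
  simp only [e]
  rw [altSum_linearDeriv_onPairs]
  simp only [map_sub, _root_.sub_apply]
  exact altSum_sub_swap_front (fun u u' x => slotSum ψ (P.nabla'' u (P.nabla' u' L) z)
    (onPairs (P.curv z) x)) v

/-- The variation of `φ(F, …, F)`. -/
theorem IsVariation.altSum_cdir (h : P.IsVariation T L) (hz : z ∈ P.U)
    (φ : MultilinearMap ℂ (fun _ : Fin (m + 1) => 𝔸) ℂ) (v : Fin (2 * (m + 1)) → E) :
    altSum (fun w => cdir (fun y => φ (onPairs (P.curv y) w)) T z) v =
    2 * altSum (p := 2 * m + 1 + 1) (fun w => slotSum φ (P.nabla'' (w 0) (P.nabla' (w 1) L) z)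
      (onPairs (P.curv z) (Fin.tail (Fin.tail w)))) v := by
  rw [← h.altSum_linearDeriv hz φ v]
  congr 1
  funext w
  exact cdir_multilinear φ (fun i => (smooth_onPairs hz _ i).differentiableAt_infty) T

end FlatPair

end Transgression

/-! ### Two-parameter families: the curl of the Bott–Chern form on the space of metrics -/

section TwoParameter

variable {E Z 𝔸 : Type*} [NormedAddCommGroup Z] [NormedSpace ℝ Z]
  [NormedRing 𝔸] [NormedAlgebra ℂ 𝔸] [FiniteDimensional ℂ 𝔸] {m : ℕ}

namespace FlatPair

variable {P : FlatPair E Z 𝔸} {z : Z} {S T : Z × Z} {N L : Z → 𝔸}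

theorem covDir_zero_left (X : Z × Z) (f : Z → 𝔸) (z : Z) :
    covDir X (fun _ => 0) f z = cdir f X z := by
  simp [covDir]

/-- In form notation, `∂̄ φ''(F, ∇'N, L) = φ''(F, ∇'N, ∇''L) + φ''(F, ∇''∇'N, L)`, up to the order
and sign of the two `1`-forms, which here is fixed by the positions of the vectors. -/
theorem altSum_dbar_slotSum_slotSum {φ : MultilinearMap ℂ (fun _ : Fin (m + 2) => 𝔸) ℂ}
    (hφ : IsAdInvariant φ) (hz : z ∈ P.U) (hN : ContDiffAt ℝ ∞ N z) (hL : ContDiffAt ℝ ∞ L z)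
    (v : Fin (2 * m + 1 + 1) → E) :
    altSum (fun w => cdir (fun y => slotSum (slotSum φ (L y)) (P.nabla' (w 1) N y)
      (onPairs (P.curv y) (Fin.tail (Fin.tail w)))) (P.dbar (w 0)) z) v =
    altSum (fun w => slotSum (slotSum φ (P.nabla'' (w 0) L z)) (P.nabla' (w 1) N z)
      (onPairs (P.curv z) (Fin.tail (Fin.tail w)))) v +
    altSum (fun w => slotSum (slotSum φ (L z)) (P.nabla'' (w 0) (P.nabla' (w 1) N) z)
      (onPairs (P.curv z) (Fin.tail (Fin.tail w)))) v := by
  have e : ∀ w : Fin (2 * m + 1 + 1) → E,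
      cdir (fun y => slotSum (slotSum φ (L y)) (P.nabla' (w 1) N y)
        (onPairs (P.curv y) (Fin.tail (Fin.tail w)))) (P.dbar (w 0)) z =
      slotSum (slotSum φ (P.nabla'' (w 0) L z)) (P.nabla' (w 1) N z)
        (onPairs (P.curv z) (Fin.tail (Fin.tail w))) +
      slotSum (slotSum φ (L z)) (P.nabla'' (w 0) (P.nabla' (w 1) N) z)
        (onPairs (P.curv z) (Fin.tail (Fin.tail w))) +
        (slotSum (slotSum φ (L z)) (P.nabla' (w 1) N z)).linearDeriv
          (onPairs (P.curv z) (Fin.tail (Fin.tail w)))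
          (onPairs (fun v' w' => P.nabla'' (w 0) (fun y => P.curv y v' w') z)
            (Fin.tail (Fin.tail w))) :=
    fun w => hφ.cdir_slotSum_slotSum hL.differentiableAt_infty
      (smooth_nabla' hz hN _).differentiableAt_infty
      (fun i => (smooth_onPairs hz _ i).differentiableAt_infty) _ (P.a (w 0))
  simp only [e]
  rw [altSum_add, altSum_add, altSum_linearDeriv_onPairs_tail_tail
    (fun u => slotSum (slotSum φ (L z)) (P.nabla' u N z)) _
    (fun u v' w' => P.nabla'' u (fun y => P.curv y v' w') z) (nabla''_curv_cyclic hz), add_zero]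

theorem altSum_del_slotSum_slotSum {φ : MultilinearMap ℂ (fun _ : Fin (m + 2) => 𝔸) ℂ}
    (hφ : IsAdInvariant φ) (hz : z ∈ P.U) (hN : ContDiffAt ℝ ∞ N z) (hL : ContDiffAt ℝ ∞ L z)
    (v : Fin (2 * m + 1 + 1) → E) :
    altSum (fun w => cdir (fun y => slotSum (slotSum φ (N y)) (P.nabla'' (w 1) L y)
      (onPairs (P.curv y) (Fin.tail (Fin.tail w)))) (P.del (w 0)) z) v =
    altSum (fun w => slotSum (slotSum φ (P.nabla' (w 0) N z)) (P.nabla'' (w 1) L z)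
      (onPairs (P.curv z) (Fin.tail (Fin.tail w)))) v +
    altSum (fun w => slotSum (slotSum φ (N z)) (P.nabla' (w 0) (P.nabla'' (w 1) L) z)
      (onPairs (P.curv z) (Fin.tail (Fin.tail w)))) v := by
  have e : ∀ w : Fin (2 * m + 1 + 1) → E,
      cdir (fun y => slotSum (slotSum φ (N y)) (P.nabla'' (w 1) L y)
        (onPairs (P.curv y) (Fin.tail (Fin.tail w)))) (P.del (w 0)) z =
      slotSum (slotSum φ (P.nabla' (w 0) N z)) (P.nabla'' (w 1) L z)
        (onPairs (P.curv z) (Fin.tail (Fin.tail w))) +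
      slotSum (slotSum φ (N z)) (P.nabla' (w 0) (P.nabla'' (w 1) L) z)
        (onPairs (P.curv z) (Fin.tail (Fin.tail w))) +
        (slotSum (slotSum φ (N z)) (P.nabla'' (w 1) L z)).linearDeriv
          (onPairs (P.curv z) (Fin.tail (Fin.tail w)))
          (onPairs (fun v' w' => P.nabla' (w 0) (fun y => P.curv y v' w') z)
            (Fin.tail (Fin.tail w))) :=
    fun w => hφ.cdir_slotSum_slotSum hN.differentiableAt_infty
      (smooth_nabla'' hz hL _).differentiableAt_infty
      (fun i => (smooth_onPairs hz _ i).differentiableAt_infty) _ (P.c (w 0))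
  simp only [e]
  rw [altSum_add, altSum_add, altSum_linearDeriv_onPairs_tail_tail
    (fun u => slotSum (slotSum φ (N z)) (P.nabla'' u L z)) _
    (fun u v' w' => P.nabla' u (fun y => P.curv y v' w') z) (nabla'_curv_cyclic hz), add_zero]

/-- A derivative in a parameter direction needs no connection, so the Leibniz rule is used with
coefficient zero; the variation of the curvature comes from `altSum_linearDeriv`. -/
theorem IsVariation.altSum_cdir_slotSum (hN : P.IsVariation S N) (hL : P.IsVariation T L)
    (hz : z ∈ P.U) {φ : MultilinearMap ℂ (fun _ : Fin (m + 2) => 𝔸) ℂ}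
    (hφ : IsAdInvariant φ) (v : Fin (2 * (m + 1)) → E) :
    altSum (fun w => cdir (fun y => slotSum φ (L y) (onPairs (P.curv y) w)) S z) v =
      altSum (fun w => slotSum φ (cdir L S z) (onPairs (P.curv z) w)) v +
      2 * altSum (p := 2 * m + 1 + 1) (fun w => slotSum (slotSum φ (L z))
        (P.nabla'' (w 0) (P.nabla' (w 1) N) z) (onPairs (P.curv z) (Fin.tail (Fin.tail w)))) v := by
  have e : ∀ w : Fin (2 * (m + 1)) → E,
      cdir (fun y => slotSum φ (L y) (onPairs (P.curv y) w)) S z =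
      slotSum φ (cdir L S z) (onPairs (P.curv z) w) +
        (slotSum φ (L z)).linearDeriv (onPairs (P.curv z) w)
          (fun i => cdir (fun y => onPairs (P.curv y) w i) S z) := by
    intro w
    have := hφ.cdir_slotSum (hL.smooth z hz).differentiableAt_infty
      (fun i => (smooth_onPairs hz w i).differentiableAt_infty) S (fun _ => 0)
    simp only [covDir_zero_left] at this
    exact this
  simp only [e]
  rw [altSum_add, hN.altSum_linearDeriv hz]

/-- The form whose exterior derivative measures the dependence on the path: the closedness, up to
the images of `∂̄` and `∂`, of the Bott–Chern form on the space of metrics. -/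
theorem IsVariation.altSum_cdir_slotSum_sub (hN : P.IsVariation S N) (hL : P.IsVariation T L)
    (hNL : curvDir S T N L z = 0) (hz : z ∈ P.U)
    {φ : MultilinearMap ℂ (fun _ : Fin (m + 2) => 𝔸) ℂ}
    (hφ : IsAdInvariant φ) (v : Fin (2 * (m + 1)) → E) :
    altSum (fun w => cdir (fun y => slotSum φ (L y) (onPairs (P.curv y) w)) S z) v -
      altSum (fun w => cdir (fun y => slotSum φ (N y) (onPairs (P.curv y) w)) T z) v =
    2 * (altSum (p := 2 * m + 1 + 1) (fun w => cdir (fun y =>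
        slotSum (slotSum φ (L y)) (P.nabla' (w 1) N y)
        (onPairs (P.curv y) (Fin.tail (Fin.tail w)))) (P.dbar (w 0)) z) v +
      altSum (p := 2 * m + 1 + 1) (fun w => cdir (fun y =>
        slotSum (slotSum φ (N y)) (P.nabla'' (w 1) L y)
        (onPairs (P.curv y) (Fin.tail (Fin.tail w)))) (P.del (w 0)) z) v) := by
  have sN := hN.smooth z hz
  have sL := hL.smooth z hz
  rw [hN.altSum_cdir_slotSum hL hz hφ, hL.altSum_cdir_slotSum hN hz hφ,
    altSum_dbar_slotSum_slotSum hφ hz sN sL, altSum_del_slotSum_slotSum hφ hz sN sL]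
  -- The cross terms with `∇''L` and `∇'N` from `∂̄` and `∂` cancel, because `1`-forms anticommute
  -- and the two insertions commute.
  have h1 : altSum (p := 2 * m + 1 + 1) (fun w =>
      slotSum (slotSum φ (P.nabla'' (w 0) L z)) (P.nabla' (w 1) N z)
        (onPairs (P.curv z) (Fin.tail (Fin.tail w)))) v =
      -altSum (p := 2 * m + 1 + 1) (fun w =>
        slotSum (slotSum φ (P.nabla' (w 0) N z)) (P.nabla'' (w 1) L z)
        (onPairs (P.curv z) (Fin.tail (Fin.tail w)))) v := by
    rw [← altSum_swap_front (fun u u' x =>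
      slotSum (slotSum φ (P.nabla' u N z)) (P.nabla'' u' L z) (onPairs (P.curv z) x))]
    simp only [slotSum_comm φ]
  -- Bringing `∇'∇''L` to the order `∇''∇'L` costs a sign for the exchange of the vectors and a
  -- commutator of `L` with the mixed curvature.
  have h2 : altSum (p := 2 * m + 1 + 1) (fun w =>
      slotSum (slotSum φ (N z)) (P.nabla' (w 0) (P.nabla'' (w 1) L) z)
        (onPairs (P.curv z) (Fin.tail (Fin.tail w)))) v =
      altSum (p := 2 * m + 1 + 1) (fun w =>
        slotSum (slotSum φ (N z)) (P.mixed (w 0) (w 1) z * L z - L z * P.mixed (w 0) (w 1) z)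
        (onPairs (P.curv z) (Fin.tail (Fin.tail w)))) v -
      altSum (p := 2 * m + 1 + 1) (fun w =>
        slotSum (slotSum φ (N z)) (P.nabla'' (w 0) (P.nabla' (w 1) L) z)
        (onPairs (P.curv z) (Fin.tail (Fin.tail w)))) v := by
    rw [← altSum_sub, eq_comm, ← neg_eq_iff_eq_neg.2 (altSum_swap_front (fun u u' x =>
      slotSum (slotSum φ (N z)) (P.nabla' u (P.nabla'' u' L) z) (onPairs (P.curv z) x)) v),
      ← altSum_neg]
    congr 1
    funext w
    rw [nabla'_nabla'' hz sL]
    simp only [map_sub, _root_.sub_apply]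
    ring
  -- By invariance the commutator of `L` and `N` is moved onto the curvatures; it then matches the
  -- commutator produced in `h2`.
  have h3 : altSum (fun w => slotSum φ (L z * N z - N z * L z) (onPairs (P.curv z) w)) v =
      2 * altSum (p := 2 * m + 1 + 1) (fun w =>
        slotSum (slotSum φ (N z)) (P.mixed (w 0) (w 1) z * L z - L z * P.mixed (w 0) (w 1) z)
        (onPairs (P.curv z) (Fin.tail (Fin.tail w)))) v := by
    have e : ∀ w : Fin (2 * (m + 1)) → E,
        slotSum φ (L z * N z - N z * L z) (onPairs (P.curv z) w) =
        (slotSum φ (N z)).linearDeriv (onPairs (P.curv z) w) (onPairs (fun v' w' =>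
          (P.mixed v' w' z * L z - L z * P.mixed v' w' z)
            - (P.mixed w' v' z * L z - L z * P.mixed w' v' z)) w) := by
      intro w
      rw [← neg_eq_iff_eq_neg.2 (hφ.slotSum_bracket (L z) (N z) (onPairs (P.curv z) w)),
        ← map_neg]
      congr 1
      funext i
      simp only [Pi.neg_apply, onPairs, curv]
      noncomm_ring
    simp only [e]
    rw [altSum_linearDeriv_onPairs]
    simp only [map_sub (slotSum (slotSum φ (N z)))
      (P.mixed _ _ z * L z - L z * P.mixed _ _ z) _, _root_.sub_apply]
    exact altSum_sub_swap_front (fun u u' x => slotSum (slotSum φ (N z))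
      (P.mixed u u' z * L z - L z * P.mixed u u' z) (onPairs (P.curv z) x)) v
  -- The vanishing of the curvature of `∂_S + N`, `∂_T + L`.
  have h4 : cdir L S z = cdir N T z + (L z * N z - N z * L z) := by
    rw [curvDir] at hNL
    rw [← sub_eq_zero, ← hNL]
    abel
  rw [h1, h2, h4]
  simp only [map_add, _root_.add_apply, altSum_add]
  rw [h3]
  ring

/-- For `k = 1` no curvature occurs in `φ'(F, L) = φ(L)`, and the derivatives differ by `φ` of a
commutator, which is zero. -/
theorem IsVariation.cdir_slotSum_eq {φ : MultilinearMap ℂ (fun _ : Fin 1 => 𝔸) ℂ}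
    (hφ : IsAdInvariant φ) (hN : P.IsVariation S N) (hL : P.IsVariation T L)
    (hNL : curvDir S T N L z = 0) (hz : z ∈ P.U) (B : Fin 0 → Z → 𝔸) :
    cdir (fun y => slotSum φ (L y) fun i => B i y) S z =
      cdir (fun y => slotSum φ (N y) fun i => B i y) T z := by
  rw [hφ.cdir_slotSum (hL.smooth z hz).differentiableAt_infty (fun i => i.elim0) S fun _ => 0,
    hφ.cdir_slotSum (hN.smooth z hz).differentiableAt_infty (fun i => i.elim0) T fun _ => 0]
  simp only [covDir_zero_left, MultilinearMap.linearDeriv_apply, Finset.univ_eq_empty,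
    Finset.sum_empty, add_zero]
  have h4 : cdir L S z = cdir N T z + (L z * N z - N z * L z) := by
    rw [curvDir] at hNL
    rw [← sub_eq_zero, ← hNL]
    abel
  have h5 := hφ.slotSum_bracket (L z) (N z) fun i => B i z
  rw [MultilinearMap.linearDeriv_apply, Finset.univ_eq_empty, Finset.sum_empty, eq_comm,
    neg_eq_zero] at h5
  rw [h4, map_add, _root_.add_apply, h5, add_zero]

end FlatPair

end TwoParameter

/-! ### Matrix valued functions in flat coordinates -/

section FlatMatrices

/-- The `ℓ^∞` operator norm makes complex matrices a normed algebra. -/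
abbrev matNormedAlgebra (n : ℕ) :
    @NormedAlgebra ℂ (Mat n) _ Matrix.linftyOpNormedRing.toSeminormedRing :=
  Matrix.linftyOpNormedAlgebra

attribute [local instance] Matrix.linftyOpNormedRing matNormedAlgebra

/-- The topology of the operator norm on matrices. -/
abbrev matTopology (n : ℕ) : TopologicalSpace (Mat n) :=
  PseudoMetricSpace.toUniformSpace.toTopologicalSpace

/-- The real vector space of complex matrices. -/
abbrev matRealModule (n : ℕ) : Module ℝ (Mat n) :=
  NormedSpace.complexToReal.toModule

attribute [local instance] matTopology matRealModule

variable {d n : ℕ} {Z W : Type*} [NormedAddCommGroup Z] [NormedSpace ℝ Z]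
  [NormedAddCommGroup W] [NormedSpace ℝ W]

/-- Arrays as matrices, as a continuous linear map. -/
def toMat (n : ℕ) : Arr n →L[ℝ] Mat n :=
  LinearMap.toContinuousLinearMap
    { toFun := fun x => Matrix.of x
      map_add' := fun _ _ => rfl
      map_smul' := fun _ _ => rfl }

/-- Matrices as arrays, as a continuous linear map. -/
def toArr (n : ℕ) : Mat n →L[ℝ] Arr n :=
  LinearMap.toContinuousLinearMap
    { toFun := fun x => Matrix.of.symm x
      map_add' := fun _ _ => rfl
      map_smul' := fun _ _ => rfl }

/-- The conjugate transpose as a real continuous linear map. -/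
def starMat (n : ℕ) : Mat n →L[ℝ] Mat n :=
  LinearMap.toContinuousLinearMap
    { toFun := fun x => xᴴ
      map_add' := fun _ _ => Matrix.conjTranspose_add _ _
      map_smul' := fun c x => by
        rw [← Complex.coe_smul, Matrix.conjTranspose_smul]
        simp }

theorem starMat_apply (x : Mat n) : starMat n x = xᴴ := rfl

theorem cdir_of {f : Z → Arr n} {z : Z} (hf : DifferentiableAt ℝ f z) (X : Z × Z) :
    cdir (fun y => Matrix.of (f y)) X z = Matrix.of (cdir f X z) :=
  cdir_continuousLinearMap_comp hf (toMat n) (fun _ => rfl) X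

theorem ContDiffAt.of {f : Z → Arr n} {z : Z} (hf : ContDiffAt ℝ ∞ f z) :
    ContDiffAt ℝ ∞ (fun y => Matrix.of (f y)) z :=
  (toMat n).contDiff.contDiffAt.comp z hf

theorem ContDiffAt.of_symm {f : Z → Mat n} {z : Z} (hf : ContDiffAt ℝ ∞ f z) :
    ContDiffAt ℝ ∞ (fun y => Matrix.of.symm (f y)) z :=
  (toArr n).contDiff.contDiffAt.comp z hf

theorem cdir_conjTranspose {f : Z → Mat n} {z : Z} (hf : DifferentiableAt ℝ f z) (X : Z × Z) :
    cdir (fun y => (f y)ᴴ) X z = (cdir f (X.1, -X.2) z)ᴴ := by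
  refine cdir_continuousLinearMap_comp_conj hf (starMat n) (fun x => ?_) X
  rw [starMat_apply, starMat_apply, Matrix.conjTranspose_smul]
  simp

theorem ContDiffAt.conjTranspose {f : Z → Mat n} {z : Z} (hf : ContDiffAt ℝ ∞ f z) :
    ContDiffAt ℝ ∞ (fun y => (f y)ᴴ) z :=
  (starMat n).contDiff.contDiffAt.comp z hf

theorem ContDiffAt.matrix_inv {f : Z → Mat n} {z : Z} (hf : ContDiffAt ℝ ∞ f z)
    (h : IsUnit (f z)) : ContDiffAt ℝ ∞ (fun y => (f y)⁻¹) z := by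
  obtain ⟨u, hu⟩ := h
  have h1 : ContDiffAt ℝ ∞ Ring.inverse (f z) := hu ▸ contDiffAt_ringInverse ℝ u
  have h2 := h1.comp z hf
  simpa only [Function.comp_def, ← Matrix.nonsing_inv_eq_ringInverse] using h2

/-- The complexified vector of type `(1,0)` of a real vector. -/
def vecDel (v : Cd d) : Cd d × Cd d := ((1 / 2 : ℝ) • v, -((1 / 2 : ℝ) • mulI d v))

/-- The complexified vector of type `(0,1)` of a real vector. -/
def vecDelBar (v : Cd d) : Cd d × Cd d := ((1 / 2 : ℝ) • v, (1 / 2 : ℝ) • mulI d v)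

theorem mulI_mulI (v : Cd d) : mulI d (mulI d v) = -v := by
  change Complex.I • Complex.I • v = -v
  rw [smul_smul, Complex.I_mul_I, neg_one_smul]

section

variable {M : Type*} [NormedAddCommGroup M] [NormedSpace ℝ M] [NormedSpace ℂ M]
  [SMulCommClass ℝ ℂ M] [IsScalarTower ℝ ℂ M]

theorem half_smul (x : M) : (1 / 2 : ℂ) • x = (1 / 2 : ℝ) • x := by
  rw [← algebraMap_smul ℂ (1 / 2 : ℝ) x]
  simp

theorem part10_fderiv (f : Cd d → M) (y v : Cd d) :
    part10 (fderiv ℝ f y) v = cdir f (vecDel v) y := by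
  simp only [part10, cdir, vecDel, _root_.smul_apply, _root_.sub_apply,
    ContinuousLinearMap.comp_apply, map_neg, map_smul, half_smul, smul_sub, smul_neg]
  rw [smul_comm, sub_eq_add_neg]

theorem part01_fderiv (f : Cd d → M) (y v : Cd d) :
    part01 (fderiv ℝ f y) v = cdir f (vecDelBar v) y := by
  simp only [part01, cdir, vecDelBar, _root_.smul_apply, _root_.add_apply,
    ContinuousLinearMap.comp_apply, map_smul, half_smul, smul_add]
  rw [smul_comm]

theorem cdir_vecDel_add (f : Cd d → M) (y v : Cd d) :
    cdir f (vecDel v) y + cdir f (vecDelBar v) y = fderiv ℝ f y v := by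
  rw [← part10_fderiv, ← part01_fderiv, ← _root_.add_apply, part10_add_part01]

/-- The `(0,1)`-part depends antilinearly on the real vector: that of `iv` is `-i` times that of
`v`. -/
theorem cdir_vecDelBar_mulI (f : Cd d → M) (y v : Cd d) :
    Complex.I • cdir f (vecDelBar (mulI d v)) y = cdir f (vecDelBar v) y := by
  simp only [cdir, vecDelBar, mulI_mulI, map_smul, map_neg, smul_add, smul_neg,
    smul_comm Complex.I (1 / 2 : ℝ), smul_smul Complex.I Complex.I, Complex.I_mul_I, neg_smul,
    one_smul, neg_neg]
  abel

end

/-- The lift to `W × ℂ^d` of a complexified vector of `ℂ^d`. -/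
def liftVec (W : Type*) [Zero W] (X : Cd d × Cd d) : (W × Cd d) × (W × Cd d) :=
  ((0, X.1), (0, X.2))

section

variable {M : Type*} [NormedAddCommGroup M] [NormedSpace ℝ M] [NormedSpace ℂ M]
  [SMulCommClass ℝ ℂ M]

theorem cdir_slice {f : W × Cd d → M} {w : W} {y : Cd d} (hf : DifferentiableAt ℝ f (w, y))
    (X : Cd d × Cd d) : cdir (fun x => f (w, x)) X y = cdir f (liftVec W X) (w, y) := by
  have h : fderiv ℝ (fun x : Cd d => (w, x)) y = ContinuousLinearMap.inr ℝ W (Cd d) :=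
    (hasFDerivAt_prodMk_right w y).fderiv
  have := cdir_comp (τ := fun x : Cd d => (w, x)) (z := y) hf (by fun_prop) X
  rw [this, h]
  rfl

theorem cdir_snd {f : Cd d → M} {z : W × Cd d} (hf : DifferentiableAt ℝ f z.2)
    (X : (W × Cd d) × (W × Cd d)) :
    cdir (fun x : W × Cd d => f x.2) X z = cdir f (X.1.2, X.2.2) z.2 := by
  rw [cdir_comp (τ := Prod.snd) hf (by fun_prop) X, fderiv_snd]
  rfl

end

theorem curvDir_snd {α β : Cd d → Mat n} {z : W × Cd d} (hα : DifferentiableAt ℝ α z.2)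
    (hβ : DifferentiableAt ℝ β z.2) (X Y : Cd d × Cd d) :
    curvDir (liftVec W X) (liftVec W Y) (fun x : W × Cd d => α x.2) (fun x => β x.2) z =
      curvDir X Y α β z.2 := by
  simp only [curvDir]
  rw [cdir_snd hα, cdir_snd hβ]
  rfl

/-- The coefficients `i A(iv)ᴴ = -(a(v) - Θ(v))ᴴ` of the conjugate of the Higgs operator. -/
def conjCoeff (A : Cd d → Cd d →L[ℝ] Arr n) (v y : Cd d) : Mat n :=
  Complex.I • (Matrix.of (A y (mulI d v)))ᴴ

/-- Take the conjugate transpose of the flatness equation at `iv`, `iw`. It turns `∂̄` into `∂` and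
reverses the products; the sign of the reversed commutator is corrected by the factor `i` in each
coefficient, as `i² = -1`. -/
theorem curvDir_conjCoeff {A : Cd d → Cd d →L[ℝ] Arr n} {y : Cd d}
    (hA : ∀ v, DifferentiableAt ℝ (fun x => Matrix.of (A x v)) y)
    (hflat : ∀ v w, curvDir (vecDelBar v) (vecDelBar w) (fun x => Matrix.of (A x v))
      (fun x => Matrix.of (A x w)) y = 0) (v w : Cd d) :
    curvDir (vecDel v) (vecDel w) (conjCoeff A v) (conjCoeff A w) y = 0 := by
  have e : ∀ v w, cdir (conjCoeff A w) (vecDel v) y =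
      (cdir (fun x => Matrix.of (A x (mulI d w))) (vecDelBar (mulI d v)) y)ᴴ := by
    intro v w
    have hd : DifferentiableAt ℝ (fun x => (Matrix.of (A x (mulI d w)))ᴴ) y :=
      (starMat n).differentiableAt.comp y (hA _)
    have h1 : cdir (conjCoeff A w) (vecDel v) y =
        Complex.I • cdir (fun x => (Matrix.of (A x (mulI d w)))ᴴ) (vecDel v) y :=
      cdir_const_smul hd _ _
    have h2 : ((vecDel v).1, -(vecDel v).2) = vecDelBar v := by simp [vecDel, vecDelBar]
    rw [h1, cdir_conjTranspose (hA _), h2, ← cdir_vecDelBar_mulI, Matrix.conjTranspose_smul,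
      smul_smul]
    simp
  have h := congrArg Matrix.conjTranspose (hflat (mulI d v) (mulI d w))
  rw [Matrix.conjTranspose_zero] at h
  rw [curvDir, e, e, ← h]
  simp only [curvDir, conjCoeff, Matrix.conjTranspose_add, Matrix.conjTranspose_sub,
    Matrix.conjTranspose_mul, smul_mul_smul_comm, Complex.I_mul_I, neg_smul, one_smul]
  abel

end FlatMatrices

/-! ### The flat pair of a Higgs operator and a family of metrics in flat coordinates -/

section FlatData

attribute [local instance] Matrix.linftyOpNormedRing matNormedAlgebra
attribute [local instance] matTopology matRealModule

/-- The local data of a Higgs operator and of a family of metrics, parametrised by `W`, on an open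
set of `ℂ^d`. -/
structure FlatData (d n : ℕ) (W : Type*) [NormedAddCommGroup W] [NormedSpace ℝ W] where
  U : Set (Cd d)
  isOpen : IsOpen U
  A : Cd d → Cd d →L[ℝ] Arr n
  G : W × Cd d → Arr n
  smooth_A : ∀ y ∈ U, ContDiffAt ℝ ∞ A y
  smooth_G : ∀ w, ∀ y ∈ U, ContDiffAt ℝ ∞ G (w, y)
  isUnit_G : ∀ w, ∀ y ∈ U, IsUnit (Matrix.of (G (w, y)))
  flat : ∀ y ∈ U, ∀ v w, curvDir (vecDelBar v) (vecDelBar w) (fun x => Matrix.of (A x v))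
    (fun x => Matrix.of (A x w)) y = 0

namespace FlatData

variable {d n : ℕ} {W : Type*} [NormedAddCommGroup W] [NormedSpace ℝ W] (D : FlatData d n W)

/-- The metric as a matrix valued function. -/
def metric (z : W × Cd d) : Mat n := Matrix.of (D.G z)

/-- The coefficient of the Higgs operator. -/
def coeff (v : Cd d) (z : W × Cd d) : Mat n := Matrix.of (D.A z.2 v)

/-- The coefficient of the operator `∇'`. -/
def conn (v : Cd d) (z : W × Cd d) : Mat n :=
  (D.metric z)⁻¹ * (conjCoeff D.A v z.2 * D.metric z
    + cdir D.metric (liftVec W (vecDel v)) z)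

/-- The vector of `W × ℂ^d` of a parameter direction. -/
def paramVec (d : ℕ) (T : W) : (W × Cd d) × (W × Cd d) := ((T, 0), 0)

/-- The logarithmic derivative of the metric in the direction of a parameter. -/
def logDeriv (T : W) (z : W × Cd d) : Mat n :=
  (D.metric z)⁻¹ * cdir D.metric (paramVec d T) z

/-- The preimage of the domain. -/
def dom : Set (W × Cd d) := {z | z.2 ∈ D.U}

theorem isOpen_dom : IsOpen D.dom := D.isOpen.preimage continuous_snd

variable {D} {z : W × Cd d}

theorem smooth_metric (hz : z ∈ D.dom) : ContDiffAt ℝ ∞ D.metric z :=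
  (D.smooth_G z.1 z.2 hz).of

theorem isUnit_metric (hz : z ∈ D.dom) : IsUnit (D.metric z) := D.isUnit_G z.1 z.2 hz

theorem metric_mul_inv_mul (hz : z ∈ D.dom) (x : Mat n) :
    D.metric z * ((D.metric z)⁻¹ * x) = x :=
  Matrix.mul_nonsing_inv_cancel_left _ _ ((Matrix.isUnit_iff_isUnit_det _).1 (isUnit_metric hz))

theorem eq_zero_of_metric_mul (hz : z ∈ D.dom) {x : Mat n} (h : D.metric z * x = 0) : x = 0 :=
  (isUnit_metric hz).mul_right_eq_zero.1 h

theorem smooth_A_apply {y : Cd d} (hy : y ∈ D.U) (v : Cd d) :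
    ContDiffAt ℝ ∞ (fun x => Matrix.of (D.A x v)) y :=
  ((D.smooth_A y hy).clm_apply contDiffAt_const).of

theorem smooth_coeff (hz : z ∈ D.dom) (v : Cd d) : ContDiffAt ℝ ∞ (D.coeff v) z :=
  (smooth_A_apply hz v).comp z contDiffAt_snd

theorem smooth_conjCoeff {y : Cd d} (hy : y ∈ D.U) (v : Cd d) :
    ContDiffAt ℝ ∞ (conjCoeff D.A v) y :=
  ((smooth_A_apply hy (mulI d v)).conjTranspose).const_smul Complex.I

theorem smooth_conjCoeff_snd (hz : z ∈ D.dom) (v : Cd d) :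
    ContDiffAt ℝ ∞ (fun x : W × Cd d => conjCoeff D.A v x.2) z :=
  (smooth_conjCoeff hz v).comp z contDiffAt_snd

theorem smooth_conn (hz : z ∈ D.dom) (v : Cd d) : ContDiffAt ℝ ∞ (D.conn v) z :=
  ((smooth_metric hz).matrix_inv (isUnit_metric hz)).mul
    (((smooth_conjCoeff_snd hz v).mul (smooth_metric hz)).add ((smooth_metric hz).cdir _))

theorem smooth_logDeriv (hz : z ∈ D.dom) (T : W) : ContDiffAt ℝ ∞ (D.logDeriv T) z :=
  ((smooth_metric hz).matrix_inv (isUnit_metric hz)).mul ((smooth_metric hz).cdir _)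

/-- The gauge relation with the metric as gauge transformation: `∇'` is the transform of the metric
independent operator `∂ + conjCoeff`. With `metric_mul_logDeriv` it yields flatness of `∇'` and its
commutation with `∂_T + L`. -/
theorem metric_mul_conn (hz : z ∈ D.dom) (v : Cd d) : D.metric z * D.conn v z =
    conjCoeff D.A v z.2 * D.metric z + cdir D.metric (liftVec W (vecDel v)) z :=
  metric_mul_inv_mul hz _

theorem metric_mul_logDeriv (hz : z ∈ D.dom) (T : W) : D.metric z * D.logDeriv T z =
    0 * D.metric z + cdir D.metric (paramVec d T) z := by
  rw [logDeriv, metric_mul_inv_mul hz, zero_mul, zero_add]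

theorem eventually_mem_dom (hz : z ∈ D.dom) : ∀ᶠ y in 𝓝 z, y ∈ D.dom :=
  D.isOpen_dom.mem_nhds hz

variable (D) in
/-- The pair of the Higgs operator `∇''` and of the operator `∇'`. -/
def pair : FlatPair (Cd d) (W × Cd d) (Mat n) where
  U := D.dom
  isOpen := D.isOpen_dom
  dbar v := liftVec W (vecDelBar v)
  del v := liftVec W (vecDel v)
  a := D.coeff
  c := D.conn
  smooth_a v _ hy := smooth_coeff hy v
  smooth_c v _ hy := smooth_conn hy v
  flat_a v w z hz := by
    rw [← D.flat z.2 hz v w]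
    exact curvDir_snd (smooth_A_apply hz v).differentiableAt_infty
      (smooth_A_apply hz w).differentiableAt_infty _ _
  flat_c v w z hz := by
    -- The metric conjugates the curvature of `∇'` into that of `∂ + conjCoeff`, which is zero.
    refine eq_zero_of_metric_mul hz ?_
    rw [curvDir_gauge (smooth_conn hz v) (smooth_conn hz w) (smooth_conjCoeff_snd hz v)
      (smooth_conjCoeff_snd hz w) (smooth_metric hz)
      (by filter_upwards [eventually_mem_dom hz] with y hy using metric_mul_conn hy v)
      (by filter_upwards [eventually_mem_dom hz] with y hy using metric_mul_conn hy w)]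
    have h := curvDir_conjCoeff (A := D.A) (y := z.2)
      (fun v => (smooth_A_apply hz v).differentiableAt_infty) (D.flat z.2 hz) v w
    rw [← curvDir_snd (W := W) (z := z) (smooth_conjCoeff hz v).differentiableAt_infty
      (smooth_conjCoeff hz w).differentiableAt_infty] at h
    rw [h, zero_mul]

theorem cdir_snd_paramVec {M : Type*} [NormedAddCommGroup M] [NormedSpace ℝ M] [NormedSpace ℂ M]
    [SMulCommClass ℝ ℂ M] {f : Cd d → M} (hf : DifferentiableAt ℝ f z.2) (T : W) :
    cdir (fun x : W × Cd d => f x.2) (paramVec d T) z = 0 := by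
  rw [cdir_snd hf]
  simp [paramVec, cdir]

/-- After the gauge transformation by the metric, `∂_T + L` and `∇'_v` become `∂_T` and `∂_v +
conjCoeff`. These commute because `conjCoeff` does not depend on the parameter. -/
theorem isVariation (T : W) : D.pair.IsVariation (paramVec d T) (D.logDeriv T) where
  smooth y hy := smooth_logDeriv hy T
  const v y hy := cdir_snd_paramVec (smooth_A_apply hy v).differentiableAt_infty T
  comm v z hz := by
    refine eq_zero_of_metric_mul hz ?_
    have h0 : ContDiffAt ℝ ∞ (fun _ : W × Cd d => (0 : Mat n)) z := contDiffAt_const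
    refine (curvDir_gauge (β := D.conn v) (smooth_logDeriv hz T) (smooth_conn hz v) h0
      (smooth_conjCoeff_snd hz v) (smooth_metric hz)
      (by filter_upwards [eventually_mem_dom hz] with y hy using metric_mul_logDeriv hy T)
      (by filter_upwards [eventually_mem_dom hz] with y hy using metric_mul_conn hy v)).trans ?_
    rw [curvDir, cdir_snd_paramVec (smooth_conjCoeff hz v).differentiableAt_infty, cdir_const]
    noncomm_ring

theorem curvDir_logDeriv (hz : z ∈ D.dom) (S T : W) :
    curvDir (paramVec d S) (paramVec d T) (D.logDeriv S) (D.logDeriv T) z = 0 := by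
  refine eq_zero_of_metric_mul hz ?_
  have h0 : ContDiffAt ℝ ∞ (fun _ : W × Cd d => (0 : Mat n)) z := contDiffAt_const
  rw [curvDir_gauge (smooth_logDeriv hz S) (smooth_logDeriv hz T) h0 h0 (smooth_metric hz)
    (by filter_upwards [eventually_mem_dom hz] with y hy using metric_mul_logDeriv hy S)
    (by filter_upwards [eventually_mem_dom hz] with y hy using metric_mul_logDeriv hy T)]
  simp [curvDir]

/-! ### Comparison with the connection form and the curvature -/

theorem sandwich_apply (P Q : Mat n) (B : Cd d →L[ℝ] Arr n) (v : Cd d) :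
    Matrix.of (sandwich P B Q v) = P * Matrix.of (B v) * Q := rfl

theorem starForm_apply (B : Cd d →L[ℝ] Arr n) (v : Cd d) :
    Matrix.of (starForm B v) = (Matrix.of (B v))ᴴ := rfl

theorem conjCoeff_eq (A : Cd d → Cd d →L[ℝ] Arr n) (v y : Cd d) :
    conjCoeff A v y = (Matrix.of (part10 (A y) v))ᴴ - (Matrix.of (part01 (A y) v))ᴴ := by
  have h : Matrix.of (part10 (A y) v) - Matrix.of (part01 (A y) v) =
      -(Complex.I • Matrix.of (A y (mulI d v))) := by
    ext i j
    simp only [part10, part01, _root_.smul_apply, _root_.sub_apply, _root_.add_apply,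
      ContinuousLinearMap.comp_apply, Matrix.sub_apply, Matrix.neg_apply, Matrix.smul_apply,
      Matrix.of_apply, Pi.smul_apply, Pi.sub_apply, Pi.add_apply, smul_eq_mul]
    ring
  rw [← Matrix.conjTranspose_sub, h, Matrix.conjTranspose_neg, Matrix.conjTranspose_smul,
    conjCoeff]
  simp

theorem of_higgsConnForm {w : W} {y : Cd d} (hy : y ∈ D.U) (v : Cd d) :
    Matrix.of (higgsConnForm D.A (fun x => D.G (w, x)) y v) =
      D.coeff v (w, y) + D.conn v (w, y) := by
  have hG : DifferentiableAt ℝ D.G (w, y) := (D.smooth_G w y hy).differentiableAt_infty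
  have e : Matrix.of (part10 (fderiv ℝ (fun x => D.G (w, x)) y) v) =
      cdir D.metric (liftVec W (vecDel v)) (w, y) := by
    rw [part10_fderiv, cdir_slice hG]
    exact (cdir_of hG _).symm
  simp only [higgsConnForm, chernForm, adjointForm, _root_.add_apply, _root_.sub_apply,
    ← Matrix.of_add_of, ← Matrix.of_sub_of, sandwich_apply, starForm_apply, e, conn, coeff,
    conjCoeff_eq, metric, mul_one]
  noncomm_ring

theorem contDiffOn_higgsConnForm (w : W) :
    ContDiffOn ℝ ∞ (higgsConnForm D.A fun x => D.G (w, x)) D.U := by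
  rw [contDiffOn_clm_apply]
  intro v y hy
  have h : ContDiffAt ℝ ∞ (fun x => Matrix.of.symm (D.coeff v (w, x) + D.conn v (w, x))) y := by
    have h1 : ContDiffAt ℝ ∞ (fun x : Cd d => (w, x)) y := by fun_prop
    exact (ContDiffAt.add ((smooth_coeff (z := (w, y)) hy v).comp y h1)
      ((smooth_conn (z := (w, y)) hy v).comp y h1)).of_symm
  refine (h.congr_of_eventuallyEq ?_).contDiffWithinAt
  filter_upwards [D.isOpen.mem_nhds hy] with x hx
  rw [← of_higgsConnForm hx]
  rfl

/-- Split each real derivative into its `(1,0)` and `(0,1)` parts. The curvature of `d + A + C'`,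
with `C'` the coefficient of `∇'`, is then the mixed curvature plus `(∇'')²` and `(∇')²`, and both
squares vanish. -/
theorem of_curvature {w : W} {y : Cd d} (hy : y ∈ D.U) (v u : Cd d) :
    Matrix.of (curvature (higgsConnForm D.A fun x => D.G (w, x)) y v u) =
      D.pair.curv (w, y) v u := by
  have hz : (w, y) ∈ D.dom := hy
  have hC : DifferentiableAt ℝ (higgsConnForm D.A fun x => D.G (w, x)) y :=
    ((contDiffOn_higgsConnForm w).contDiffAt (D.isOpen.mem_nhds hy)).differentiableAt_infty
  have hCa : ∀ u, DifferentiableAt ℝ (fun x => higgsConnForm D.A (fun x => D.G (w, x)) x u) y :=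
    fun u => hC.clm_apply (differentiableAt_const u)
  have e : ∀ v u, Matrix.of (fderiv ℝ (higgsConnForm D.A fun x => D.G (w, x)) y v u) =
      (cdir (D.coeff u) (liftVec W (vecDel v)) (w, y)
        + cdir (D.coeff u) (liftVec W (vecDelBar v)) (w, y)) +
      (cdir (D.conn u) (liftVec W (vecDel v)) (w, y)
        + cdir (D.conn u) (liftVec W (vecDelBar v)) (w, y)) := by
    intro v u
    have h1 : fderiv ℝ (higgsConnForm D.A fun x => D.G (w, x)) y v u =
        fderiv ℝ (fun x => higgsConnForm D.A (fun x => D.G (w, x)) x u) y v := by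
      rw [fderiv_clm_apply hC (differentiableAt_const u)]
      simp
    have h2 : (fun x => Matrix.of (higgsConnForm D.A (fun x => D.G (w, x)) x u)) =ᶠ[𝓝 y]
        fun x => D.coeff u (w, x) + D.conn u (w, x) := by
      filter_upwards [D.isOpen.mem_nhds hy] with x hx using of_higgsConnForm hx u
    have sa := (smooth_coeff hz u).differentiableAt_infty
    have sc := (smooth_conn hz u).differentiableAt_infty
    have hs : ∀ X : Cd d × Cd d, Matrix.of (cdir (fun x =>
        higgsConnForm D.A (fun x => D.G (w, x)) x u) X y) =
        cdir (D.coeff u) (liftVec W X) (w, y) + cdir (D.conn u) (liftVec W X) (w, y) := by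
      intro X
      rw [← cdir_of (hCa u), h2.cdir_eq]
      have := cdir_slice (f := fun z => D.coeff u z + D.conn u z) (w := w) (y := y)
        (sa.fun_add sc) X
      rw [this, cdir_add sa sc]
    rw [h1, ← cdir_vecDel_add, ← Matrix.of_add_of, hs, hs]
    abel
  have fa := D.pair.flat_a v u (w, y) hz
  have fc := D.pair.flat_c v u (w, y) hz
  have key : Matrix.of (curvature (higgsConnForm D.A fun x => D.G (w, x)) y v u) =
      Matrix.of (fderiv ℝ (higgsConnForm D.A fun x => D.G (w, x)) y v u)
      - Matrix.of (fderiv ℝ (higgsConnForm D.A fun x => D.G (w, x)) y u v)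
      + (Matrix.of (higgsConnForm D.A (fun x => D.G (w, x)) y v) *
          Matrix.of (higgsConnForm D.A (fun x => D.G (w, x)) y u)
        - Matrix.of (higgsConnForm D.A (fun x => D.G (w, x)) y u) *
          Matrix.of (higgsConnForm D.A (fun x => D.G (w, x)) y v)) := rfl
  rw [key, e, e, of_higgsConnForm hy, of_higgsConnForm hy]
  simp only [FlatPair.curv, FlatPair.mixed]
  rw [← sub_eq_zero]
  refine Eq.trans ?_ ((congrArg₂ (· + ·) fa fc).trans (add_zero 0))
  simp only [curvDir, pair]
  noncomm_ring

end FlatData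

end FlatData

/-! ### Alternating forms and alternating sums -/

section FormCalculus

variable {d p : ℕ} {Z W : Type*} [NormedAddCommGroup Z] [NormedSpace ℝ Z]
  [NormedAddCommGroup W] [NormedSpace ℝ W]

/-- Evaluation of forms at a tuple of vectors. -/
def formApply (v : Fin p → Cd d) : (Cd d [⋀^Fin p]→L[ℝ] ℂ) →L[ℝ] ℂ :=
  ContinuousAlternatingMap.apply ℝ (Cd d) ℂ v

/-- Evaluation on tuples of basis vectors embeds the finite dimensional space of forms linearly into
a coordinate space, and a linear left inverse recovers the form from its values. -/
theorem contDiffAt_form {η : Z → Cd d [⋀^Fin p]→L[ℝ] ℂ} {z : Z}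
    (h : ∀ v, ContDiffAt ℝ ∞ (fun y => η y v) z) : ContDiffAt ℝ ∞ η z := by
  let b := Module.finBasis ℝ (Cd d)
  let ev : (Cd d [⋀^Fin p]→L[ℝ] ℂ) →ₗ[ℝ] ((Fin p → Fin (Module.finrank ℝ (Cd d))) → ℂ) :=
    LinearMap.pi fun r => (formApply fun i => b (r i)).toLinearMap
  have hev : LinearMap.ker ev = ⊥ := by
    rw [LinearMap.ker_eq_bot]
    intro η₁ η₂ h12
    apply ContinuousAlternatingMap.toAlternatingMap_injective
    exact Module.Basis.ext_alternating b fun r _ => congrFun h12 r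
  obtain ⟨g, hg⟩ := LinearMap.exists_leftInverse_of_injective ev hev
  have e : η = fun y => LinearMap.toContinuousLinearMap g (ev (η y)) := by
    funext y
    exact (LinearMap.congr_fun hg (η y)).symm
  rw [e]
  exact (LinearMap.toContinuousLinearMap g).contDiff.contDiffAt.comp z
    (contDiffAt_pi.2 fun r => h _)

theorem ContDiffAt.form_apply {η : Z → Cd d [⋀^Fin p]→L[ℝ] ℂ} {z : Z}
    (h : ContDiffAt ℝ ∞ η z) (v : Fin p → Cd d) : ContDiffAt ℝ ∞ (fun y => η y v) z :=
  (formApply v).contDiff.contDiffAt.comp z h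

theorem cdir_form_apply {η : Z → Cd d [⋀^Fin p]→L[ℝ] ℂ} {z : Z}
    (h : DifferentiableAt ℝ η z) (X : Z × Z) (v : Fin p → Cd d) :
    cdir η X z v = cdir (fun y => η y v) X z :=
  (cdir_continuousLinearMap_comp h (formApply v) (fun _ => rfl) X).symm

theorem flatDel_apply {η : Cd d → Cd d [⋀^Fin p]→L[ℝ] ℂ} {y : Cd d}
    (h : DifferentiableAt ℝ η y) (v : Fin (p + 1) → Cd d) :
    flatDel η y v = ∑ i : Fin (p + 1), (-1 : ℤ) ^ (i : ℕ) •
      cdir (fun x => η x (i.removeNth v)) (vecDel (v i)) y := by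
  rw [flatDel, ContinuousAlternatingMap.alternatizeUncurryFin_apply]
  refine Finset.sum_congr rfl fun i _ => ?_
  rw [part10_fderiv, cdir_form_apply h]

theorem flatDelBar_apply {η : Cd d → Cd d [⋀^Fin p]→L[ℝ] ℂ} {y : Cd d}
    (h : DifferentiableAt ℝ η y) (v : Fin (p + 1) → Cd d) :
    flatDelBar η y v = ∑ i : Fin (p + 1), (-1 : ℤ) ^ (i : ℕ) •
      cdir (fun x => η x (i.removeNth v)) (vecDelBar (v i)) y := by
  rw [flatDelBar, ContinuousAlternatingMap.alternatizeUncurryFin_apply]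
  refine Finset.sum_congr rfl fun i _ => ?_
  rw [part01_fderiv, cdir_form_apply h]

theorem altSum_const_mul (c : ℂ) (f : (Fin p → Cd d) → ℂ) (v : Fin p → Cd d) :
    altSum (fun w => c * f w) v = c * altSum f v := by
  simp only [altSum, Finset.mul_sum, mul_smul_comm]

theorem cdir_altSum {f : Z → (Fin p → Cd d) → ℂ} {z : Z}
    (hf : ∀ v, ContDiffAt ℝ ∞ (fun y => f y v) z) (X : Z × Z) (v : Fin p → Cd d) :
    cdir (fun y => altSum (f y) v) X z = altSum (fun w => cdir (fun y => f y w) X z) v := by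
  have e : ∀ (σ : Equiv.Perm (Fin p)) (x : ℂ), Equiv.Perm.sign σ • x =
      ((Equiv.Perm.sign σ : ℤ) : ℂ) • x := fun σ x => by
    rw [Units.smul_def, zsmul_eq_mul, smul_eq_mul]
  simp only [altSum, e]
  rw [cdir_sum fun σ _ => ((hf _).differentiableAt_infty.fun_const_smul _)]
  exact Finset.sum_congr rfl fun σ _ => cdir_const_smul (hf _).differentiableAt_infty _ _

theorem contDiffAt_altSum {f : Z → (Fin p → Cd d) → ℂ} {z : Z}
    (hf : ∀ v, ContDiffAt ℝ ∞ (fun y => f y v) z) (v : Fin p → Cd d) :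
    ContDiffAt ℝ ∞ (fun y => altSum (f y) v) z := by
  have e : ∀ (σ : Equiv.Perm (Fin p)) (x : ℂ), Equiv.Perm.sign σ • x =
      ((Equiv.Perm.sign σ : ℤ) : ℂ) • x := fun σ x => by
    rw [Units.smul_def, zsmul_eq_mul, smul_eq_mul]
  simp only [altSum, e]
  exact ContDiffAt.sum fun σ _ => (hf _).const_smul _

section

variable {η : Z → Cd d [⋀^Fin p]→L[ℝ] ℂ} {c : ℂ} {f : Z → (Fin p → Cd d) → ℂ} {z : Z}

theorem contDiffAt_form_of_altSum (hη : ∀ᶠ x in 𝓝 z, ∀ v, η x v = c * altSum (f x) v)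
    (hf : ∀ v, ContDiffAt ℝ ∞ (fun x => f x v) z) : ContDiffAt ℝ ∞ η z :=
  contDiffAt_form fun v =>
    ((contDiffAt_altSum hf v).const_smul c).congr_of_eventuallyEq
      (by filter_upwards [hη] with x hx using hx v)

theorem cdir_form_altSum (hη : ∀ᶠ x in 𝓝 z, ∀ v, η x v = c * altSum (f x) v)
    (hf : ∀ v, ContDiffAt ℝ ∞ (fun x => f x v) z) (X : Z × Z) (v : Fin p → Cd d) :
    cdir η X z v = c * altSum (fun w => cdir (fun x => f x w) X z) v := by
  have h1 : (fun x => η x v) =ᶠ[𝓝 z] fun x => c • altSum (f x) v := by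
    filter_upwards [hη] with x hx using hx v
  rw [cdir_form_apply (contDiffAt_form_of_altSum hη hf).differentiableAt_infty, h1.cdir_eq,
    cdir_const_smul (contDiffAt_altSum hf v).differentiableAt_infty, cdir_altSum hf, smul_eq_mul]

end

section

variable {η : W × Cd d → Cd d [⋀^Fin p]→L[ℝ] ℂ} {c : ℂ} {f : W × Cd d → (Fin p → Cd d) → ℂ}
  {w : W} {y : Cd d}

/-- The common computation for `∂` and `∂̄`, with `V` the choice of type: differentiation passes
inside the alternating sum, and the two alternations merge. -/
theorem sum_cdir_removeNth (hη : ∀ᶠ x in 𝓝 (w, y), ∀ v, η x v = c * altSum (f x) v)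
    (hf : ∀ v, ContDiffAt ℝ ∞ (fun x => f x v) (w, y)) (V : Cd d → Cd d × Cd d)
    (v : Fin (p + 1) → Cd d) :
    ∑ i : Fin (p + 1), (-1 : ℤ) ^ (i : ℕ) •
      cdir (fun x => η (w, x) (i.removeNth v)) (V (v i)) y =
    c * altSum (fun u => cdir (fun x => f x (Fin.tail u)) (liftVec W (V (u 0))) (w, y)) v := by
  have sη := contDiffAt_form_of_altSum hη hf
  have e : ∀ i : Fin (p + 1), cdir (fun x => η (w, x) (i.removeNth v)) (V (v i)) y =
      c * altSum (fun u => cdir (fun x => f x u) (liftVec W (V (v i))) (w, y))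
        (i.removeNth v) := by
    intro i
    rw [← cdir_form_altSum hη hf, cdir_form_apply sη.differentiableAt_infty]
    exact cdir_slice (f := fun x => η x (i.removeNth v))
      (sη.form_apply _).differentiableAt_infty _
  simp only [e]
  rw [← sum_altSum_removeNth (fun v0 u => cdir (fun x => f x u) (liftVec W (V v0)) (w, y)) v,
    Finset.mul_sum]
  exact Finset.sum_congr rfl fun i _ => (mul_smul_comm _ _ _).symm

theorem differentiableAt_slice (h : ContDiffAt ℝ ∞ η (w, y)) :
    DifferentiableAt ℝ (fun x => η (w, x)) y :=
  h.differentiableAt_infty.comp y (by fun_prop)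

theorem flatDel_altSum (hη : ∀ᶠ x in 𝓝 (w, y), ∀ v, η x v = c * altSum (f x) v)
    (hf : ∀ v, ContDiffAt ℝ ∞ (fun x => f x v) (w, y)) (v : Fin (p + 1) → Cd d) :
    flatDel (fun x => η (w, x)) y v =
      c * altSum (fun u => cdir (fun x => f x (Fin.tail u)) (liftVec W (vecDel (u 0))) (w, y)) v := by
  rw [flatDel_apply (differentiableAt_slice (contDiffAt_form_of_altSum hη hf)),
    sum_cdir_removeNth hη hf]

theorem flatDelBar_altSum (hη : ∀ᶠ x in 𝓝 (w, y), ∀ v, η x v = c * altSum (f x) v)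
    (hf : ∀ v, ContDiffAt ℝ ∞ (fun x => f x v) (w, y)) (v : Fin (p + 1) → Cd d) :
    flatDelBar (fun x => η (w, x)) y v =
      c * altSum (fun u => cdir (fun x => f x (Fin.tail u)) (liftVec W (vecDelBar (u 0))) (w, y))
        v := by
  rw [flatDelBar_apply (differentiableAt_slice (contDiffAt_form_of_altSum hη hf)),
    sum_cdir_removeNth hη hf]

end

end FormCalculus

/-! ### Invariant functions of matrix valued forms as alternating sums -/

section EvalForms

variable {d n m : ℕ}

theorem evalTwoForms_apply (ψ : MultilinearMap ℂ (fun _ : Fin m => Mat n) ℂ)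
    (F : Fin m → Cd d →L[ℝ] Cd d →L[ℝ] Arr n) (v : Fin (2 * m) → Cd d) :
    evalTwoForms ψ F v = (1 / 2 : ℂ) ^ m * altSum (fun w => ψ fun i =>
      Matrix.of (F i (w (pairIdx i 0)) (w (pairIdx i 1)))) v := by
  change ((1 / 2 : ℝ) ^ m) • MultilinearMap.alternatization ((blockMap ψ F).domDomCongr
      (finProdFinEquiv.trans (finCongr (Nat.mul_comm m 2)))) v = _
  rw [MultilinearMap.alternatization_apply, Complex.real_smul]
  push_cast
  rfl

/-- Matrix valued two-forms as functions of two vectors. -/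
def ofForm (F : Cd d →L[ℝ] Cd d →L[ℝ] Arr n) (v w : Cd d) : Mat n := Matrix.of (F v w)

theorem evalTwoForms_const_apply (ψ : MultilinearMap ℂ (fun _ : Fin m => Mat n) ℂ)
    (F : Cd d →L[ℝ] Cd d →L[ℝ] Arr n) (v : Fin (2 * m) → Cd d) :
    evalTwoForms ψ (fun _ => F) v =
      (1 / 2 : ℂ) ^ m * altSum (fun w => ψ (onPairs (ofForm F) w)) v :=
  evalTwoForms_apply ψ _ v

theorem phiOf_apply (φ : MultilinearMap ℂ (fun _ : Fin (m + 1) => Mat n) ℂ)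
    (F : Cd d →L[ℝ] Cd d →L[ℝ] Arr n) (v : Fin (2 * (m + 1)) → Cd d) :
    phiOf φ F v = (1 / 2 : ℂ) ^ (m + 1) * altSum (fun w => φ (onPairs (ofForm F) w)) v :=
  evalTwoForms_const_apply φ F v

theorem phiPrime_apply (φ : MultilinearMap ℂ (fun _ : Fin (m + 1) => Mat n) ℂ)
    (F : Cd d →L[ℝ] Cd d →L[ℝ] Arr n) (L : Mat n) (v : Fin (2 * m) → Cd d) :
    phiPrime φ F L v =
      (1 / 2 : ℂ) ^ m * altSum (fun w => slotSum φ L (onPairs (ofForm F) w)) v := by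
  rw [phiPrime, ContinuousAlternatingMap.sum_apply]
  simp only [evalTwoForms_const_apply]
  rw [← Finset.mul_sum, ← altSum_sum]
  simp only [slotSum, LinearMap.sum_apply, _root_.sum_apply]

/-- `φ''(F, B, b)`, for a matrix valued `2`-form `F`, a matrix valued `1`-form `B` and a matrix
`b`. -/
def phiSecond (φ : MultilinearMap ℂ (fun _ : Fin (m + 2) => Mat n) ℂ)
    (F : Cd d →L[ℝ] Cd d →L[ℝ] Arr n) (B : Cd d →L[ℝ] Arr n) (b : Mat n) :
    Cd d [⋀^Fin (2 * m + 1)]→L[ℝ] ℂ :=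
  .alternatizeUncurryFin (LinearMap.toContinuousLinearMap
    { toFun := fun u => evalTwoForms (slotSum (slotSum φ b) (Matrix.of (B u))) fun _ => F
      map_add' := fun u v => by
        ext w
        rw [map_add, ← Matrix.of_add_of, map_add, ContinuousAlternatingMap.add_apply]
        simp only [evalTwoForms_const_apply, _root_.add_apply, altSum_add, mul_add]
      map_smul' := fun c u => by
        ext w
        have h : Matrix.of (B (c • u)) = (c : ℂ) • Matrix.of (B u) := by
          ext i j
          simp
        rw [h, map_smul, RingHom.id_apply, ContinuousAlternatingMap.smul_apply]
        simp only [evalTwoForms_const_apply, _root_.smul_apply, Complex.real_smul, smul_eq_mul,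
          altSum_const_mul]
        ring })

theorem phiSecond_apply (φ : MultilinearMap ℂ (fun _ : Fin (m + 2) => Mat n) ℂ)
    (F : Cd d →L[ℝ] Cd d →L[ℝ] Arr n) (B : Cd d →L[ℝ] Arr n) (b : Mat n)
    (v : Fin (2 * m + 1) → Cd d) :
    phiSecond φ F B b v = (1 / 2 : ℂ) ^ m * altSum (fun w =>
      slotSum (slotSum φ b) (Matrix.of (B (w 0))) (onPairs (ofForm F) (Fin.tail w))) v := by
  rw [phiSecond, ContinuousAlternatingMap.alternatizeUncurryFin_apply,
    ← sum_altSum_removeNth (fun u x => slotSum (slotSum φ b) (Matrix.of (B u))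
      (onPairs (ofForm F) x)), Finset.mul_sum]
  refine Finset.sum_congr rfl fun i _ => ?_
  rw [mul_smul_comm, ← evalTwoForms_const_apply]
  rfl

end EvalForms

/-! ### The forms attached to flat data -/

section FlatForms

attribute [local instance] Matrix.linftyOpNormedRing matNormedAlgebra
attribute [local instance] matTopology matRealModule

theorem IsGLInvariant.isAdInvariant {n k : ℕ} {φ : MultilinearMap ℂ (fun _ : Fin k => Mat n) ℂ}
    (hφ : IsGLInvariant φ) : IsAdInvariant φ :=
  isAdInvariant_of_conj φ hφ

namespace FlatData

variable {d n m : ℕ} {W : Type*} [NormedAddCommGroup W] [NormedSpace ℝ W] (D : FlatData d n W)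

/-- The curvature of the Higgs connection. -/
def curvForm (z : W × Cd d) : Cd d →L[ℝ] Cd d →L[ℝ] Arr n :=
  curvature (higgsConnForm D.A fun x => D.G (z.1, x)) z.2

/-- The part `∇'` of the Higgs connection, as a form. -/
def connPrime (z : W × Cd d) : Cd d →L[ℝ] Arr n :=
  higgsConnForm D.A (fun x => D.G (z.1, x)) z.2 - D.A z.2

/-- The form `∇' L` for the logarithmic derivative `L`. -/
def delLog (T : W) (z : W × Cd d) : Cd d →L[ℝ] Arr n :=
  part10 (fderiv ℝ (fun x => Matrix.of.symm (D.logDeriv T (z.1, x))) z.2)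
    + (sandwich 1 (D.connPrime z) (D.logDeriv T z) - sandwich (D.logDeriv T z) (D.connPrime z) 1)

/-- The form `∇'' L` for the logarithmic derivative `L`. -/
def delBarLog (T : W) (z : W × Cd d) : Cd d →L[ℝ] Arr n :=
  part01 (fderiv ℝ (fun x => Matrix.of.symm (D.logDeriv T (z.1, x))) z.2)
    + (sandwich 1 (D.A z.2) (D.logDeriv T z) - sandwich (D.logDeriv T z) (D.A z.2) 1)

variable {D} {z : W × Cd d}

theorem ofForm_curvForm (hz : z ∈ D.dom) : ofForm (D.curvForm z) = D.pair.curv z := by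
  funext v u
  exact of_curvature (w := z.1) (y := z.2) hz v u

theorem differentiableAt_logDeriv_slice (hz : z ∈ D.dom) (T : W) :
    DifferentiableAt ℝ (fun x => D.logDeriv T (z.1, x)) z.2 :=
  ((smooth_logDeriv (z := (z.1, z.2)) hz T).differentiableAt_infty).comp z.2
    (f := fun x => (z.1, x)) (by fun_prop)

theorem differentiableAt_logDeriv_arr (hz : z ∈ D.dom) (T : W) :
    DifferentiableAt ℝ (fun x => Matrix.of.symm (D.logDeriv T (z.1, x))) z.2 :=
  (toArr n).differentiableAt.comp z.2 (differentiableAt_logDeriv_slice hz T)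

theorem of_cdir_logDeriv (hz : z ∈ D.dom) (T : W) (X : Cd d × Cd d) :
    Matrix.of (cdir (fun x => Matrix.of.symm (D.logDeriv T (z.1, x))) X z.2) =
      cdir (D.logDeriv T) (liftVec W X) z := by
  rw [← cdir_of (differentiableAt_logDeriv_arr hz T)]
  exact cdir_slice (w := z.1) (y := z.2) (smooth_logDeriv hz T).differentiableAt_infty X

theorem of_delLog (hz : z ∈ D.dom) (T : W) (v : Cd d) :
    Matrix.of (D.delLog T z v) = D.pair.nabla' v (D.logDeriv T) z := by
  have h : Matrix.of (D.connPrime z v) = D.conn v z := by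
    rw [connPrime, _root_.sub_apply, ← Matrix.of_sub_of, of_higgsConnForm (w := z.1) hz]
    exact add_sub_cancel_left _ _
  rw [delLog, _root_.add_apply, _root_.sub_apply, ← Matrix.of_add_of, ← Matrix.of_sub_of,
    sandwich_apply, sandwich_apply, part10_fderiv, of_cdir_logDeriv hz, h, one_mul, mul_one]
  rfl

theorem of_delBarLog (hz : z ∈ D.dom) (T : W) (v : Cd d) :
    Matrix.of (D.delBarLog T z v) = D.pair.nabla'' v (D.logDeriv T) z := by
  rw [delBarLog, _root_.add_apply, _root_.sub_apply, ← Matrix.of_add_of, ← Matrix.of_sub_of,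
    sandwich_apply, sandwich_apply, part01_fderiv, of_cdir_logDeriv hz, one_mul, mul_one]
  rfl

variable (D)

/-- The form `φ(F, …, F)`. -/
def chern (φ : MultilinearMap ℂ (fun _ : Fin (m + 1) => Mat n) ℂ) (z : W × Cd d) :
    Cd d [⋀^Fin (2 * (m + 1))]→L[ℝ] ℂ :=
  phiOf φ (D.curvForm z)

/-- The form `φ'(F, L)`. -/
def bott (φ : MultilinearMap ℂ (fun _ : Fin (m + 1) => Mat n) ℂ) (T : W) (z : W × Cd d) :
    Cd d [⋀^Fin (2 * m)]→L[ℝ] ℂ :=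
  phiPrime φ (D.curvForm z) (D.logDeriv T z)

/-- The form `φ''(F, ∇'N, L)`. -/
def alphaForm (φ : MultilinearMap ℂ (fun _ : Fin (m + 2) => Mat n) ℂ) (S T : W)
    (z : W × Cd d) : Cd d [⋀^Fin (2 * m + 1)]→L[ℝ] ℂ :=
  phiSecond φ (D.curvForm z) (D.delLog S z) (D.logDeriv T z)

/-- The form `φ''(F, ∇''L, N)`. -/
def betaForm (φ : MultilinearMap ℂ (fun _ : Fin (m + 2) => Mat n) ℂ) (S T : W)
    (z : W × Cd d) : Cd d [⋀^Fin (2 * m + 1)]→L[ℝ] ℂ :=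
  phiSecond φ (D.curvForm z) (D.delBarLog T z) (D.logDeriv S z)

variable {D}

theorem chern_apply (φ : MultilinearMap ℂ (fun _ : Fin (m + 1) => Mat n) ℂ) (hz : z ∈ D.dom)
    (v : Fin (2 * (m + 1)) → Cd d) : D.chern φ z v =
      (1 / 2 : ℂ) ^ (m + 1) * altSum (fun w => φ (onPairs (D.pair.curv z) w)) v := by
  rw [chern, phiOf_apply, ofForm_curvForm hz]

theorem bott_apply (φ : MultilinearMap ℂ (fun _ : Fin (m + 1) => Mat n) ℂ) (T : W)
    (hz : z ∈ D.dom) (v : Fin (2 * m) → Cd d) : D.bott φ T z v = (1 / 2 : ℂ) ^ m *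
      altSum (fun w => slotSum φ (D.logDeriv T z) (onPairs (D.pair.curv z) w)) v := by
  rw [bott, phiPrime_apply, ofForm_curvForm hz]

theorem alphaForm_apply (φ : MultilinearMap ℂ (fun _ : Fin (m + 2) => Mat n) ℂ) (S T : W)
    (hz : z ∈ D.dom) (v : Fin (2 * m + 1) → Cd d) : D.alphaForm φ S T z v = (1 / 2 : ℂ) ^ m *
      altSum (fun w => slotSum (slotSum φ (D.logDeriv T z))
        (D.pair.nabla' (w 0) (D.logDeriv S) z) (onPairs (D.pair.curv z) (Fin.tail w))) v := by
  rw [alphaForm, phiSecond_apply, ofForm_curvForm hz]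
  simp only [of_delLog hz]

theorem betaForm_apply (φ : MultilinearMap ℂ (fun _ : Fin (m + 2) => Mat n) ℂ) (S T : W)
    (hz : z ∈ D.dom) (v : Fin (2 * m + 1) → Cd d) : D.betaForm φ S T z v = (1 / 2 : ℂ) ^ m *
      altSum (fun w => slotSum (slotSum φ (D.logDeriv S z))
        (D.pair.nabla'' (w 0) (D.logDeriv T) z) (onPairs (D.pair.curv z) (Fin.tail w))) v := by
  rw [betaForm, phiSecond_apply, ofForm_curvForm hz]
  simp only [of_delBarLog hz]

theorem smooth_pair_onPairs (hz : z ∈ D.dom) {r : ℕ} (w : Fin (2 * r) → Cd d) (i : Fin r) :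
    ContDiffAt ℝ ∞ (fun y => onPairs (D.pair.curv y) w i) z :=
  FlatPair.smooth_onPairs (P := D.pair) hz w i

section

variable (φ : MultilinearMap ℂ (fun _ : Fin (m + 1) => Mat n) ℂ) (T : W)

theorem smooth_bott_summand (hz : z ∈ D.dom) (w : Fin (2 * m) → Cd d) : ContDiffAt ℝ ∞
    (fun y => slotSum φ (D.logDeriv T y) (onPairs (D.pair.curv y) w)) z :=
  ContDiffAt.slotSum φ (smooth_logDeriv hz T) fun i => smooth_pair_onPairs hz w i

theorem smooth_bott (hz : z ∈ D.dom) : ContDiffAt ℝ ∞ (D.bott φ T) z :=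
  contDiffAt_form_of_altSum
    (by filter_upwards [eventually_mem_dom hz] with x hx using bott_apply φ T hx)
    (smooth_bott_summand φ T hz)

theorem smooth_chern_summand (hz : z ∈ D.dom) (w : Fin (2 * (m + 1)) → Cd d) : ContDiffAt ℝ ∞
    (fun y => φ (onPairs (D.pair.curv y) w)) z :=
  ContDiffAt.multilinear φ fun i => smooth_pair_onPairs hz w i

theorem smooth_chern (hz : z ∈ D.dom) : ContDiffAt ℝ ∞ (D.chern φ) z :=
  contDiffAt_form_of_altSum
    (by filter_upwards [eventually_mem_dom hz] with x hx using chern_apply φ hx)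
    (smooth_chern_summand φ hz)

end

section

variable (φ : MultilinearMap ℂ (fun _ : Fin (m + 2) => Mat n) ℂ) (S T : W)

theorem smooth_alphaForm_summand (hz : z ∈ D.dom) (w : Fin (2 * m + 1) → Cd d) : ContDiffAt ℝ ∞
    (fun y => slotSum (slotSum φ (D.logDeriv T y)) (D.pair.nabla' (w 0) (D.logDeriv S) y)
      (onPairs (D.pair.curv y) (Fin.tail w))) z :=
  ContDiffAt.slotSum_slotSum φ (smooth_logDeriv hz T)
    (FlatPair.smooth_nabla' (P := D.pair) hz (smooth_logDeriv hz S) _)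
    fun i => smooth_pair_onPairs hz _ i

theorem smooth_betaForm_summand (hz : z ∈ D.dom) (w : Fin (2 * m + 1) → Cd d) : ContDiffAt ℝ ∞
    (fun y => slotSum (slotSum φ (D.logDeriv S y)) (D.pair.nabla'' (w 0) (D.logDeriv T) y)
      (onPairs (D.pair.curv y) (Fin.tail w))) z :=
  ContDiffAt.slotSum_slotSum φ (smooth_logDeriv hz S)
    (FlatPair.smooth_nabla'' (P := D.pair) hz (smooth_logDeriv hz T) _)
    fun i => smooth_pair_onPairs hz _ i

theorem smooth_alphaForm (hz : z ∈ D.dom) : ContDiffAt ℝ ∞ (D.alphaForm φ S T) z :=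
  contDiffAt_form_of_altSum
    (by filter_upwards [eventually_mem_dom hz] with x hx using alphaForm_apply φ S T hx)
    (smooth_alphaForm_summand φ S T hz)

theorem smooth_betaForm (hz : z ∈ D.dom) : ContDiffAt ℝ ∞ (D.betaForm φ S T) z :=
  contDiffAt_form_of_altSum
    (by filter_upwards [eventually_mem_dom hz] with x hx using betaForm_apply φ S T hx)
    (smooth_betaForm_summand φ S T hz)

end

/-- A formula valid on the whole domain, not just at one point, so that `∂̄` can be applied to it
next. -/
theorem flatDel_bott {φ : MultilinearMap ℂ (fun _ : Fin (m + 1) => Mat n) ℂ}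
    (hφ : IsAdInvariant φ) (T : W) (hz : z ∈ D.dom) (v : Fin (2 * m + 1) → Cd d) :
    flatDel (fun x => D.bott φ T (z.1, x)) z.2 v = (1 / 2 : ℂ) ^ m *
      altSum (fun w => slotSum φ (D.pair.nabla' (w 0) (D.logDeriv T) z)
        (onPairs (D.pair.curv z) (Fin.tail w))) v := by
  rw [flatDel_altSum (η := D.bott φ T) (w := z.1) (y := z.2)
    (by filter_upwards [eventually_mem_dom hz] with x hx using bott_apply φ T hx)
    (smooth_bott_summand φ T hz)]
  congr 1
  exact FlatPair.altSum_del_slotSum (P := D.pair) hφ hz (smooth_logDeriv hz T) v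

/-- The variation of the form `φ(F, …, F)`. -/
theorem cdir_chern {φ : MultilinearMap ℂ (fun _ : Fin (m + 1) => Mat n) ℂ}
    (hφ : IsAdInvariant φ) (T : W) (hz : z ∈ D.dom) :
    cdir (D.chern φ) (paramVec d T) z =
      flatDelBar (fun y => flatDel (fun x => D.bott φ T (z.1, x)) y) z.2 := by
  ext v
  rw [cdir_form_altSum
    (by filter_upwards [eventually_mem_dom hz] with x hx using chern_apply φ hx)
    (smooth_chern_summand φ hz)]
  have h1 := flatDelBar_altSum (η := fun z => flatDel (fun x => D.bott φ T (z.1, x)) z.2)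
    (w := z.1) (y := z.2)
    (by filter_upwards [eventually_mem_dom hz] with x hx using flatDel_bott hφ T hx)
    (fun w => ContDiffAt.slotSum φ
      (FlatPair.smooth_nabla' (P := D.pair) hz (smooth_logDeriv hz T) _)
      fun i => smooth_pair_onPairs hz _ i) v
  refine Eq.trans ?_ h1.symm
  rw [(isVariation T).altSum_cdir hz φ v]
  have h2 := FlatPair.altSum_dbar_slotSum_nabla' (P := D.pair) hφ hz (smooth_logDeriv hz T) v
  refine Eq.trans ?_ (congrArg ((1 / 2 : ℂ) ^ m * ·) h2.symm)
  -- The factor `2` from the variation of `F` cancels one of the `m + 1` factors `1 / 2`: the form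
  -- on the left contains one more `2`-form `F`.
  rw [pow_succ]
  ring

/-- The form `φ'(F, L)` is closed on the space of metrics, up to the images of `∂̄` and `∂`. -/
theorem cdir_bott_sub {φ : MultilinearMap ℂ (fun _ : Fin (m + 2) => Mat n) ℂ}
    (hφ : IsAdInvariant φ) (S T : W) (hz : z ∈ D.dom) :
    cdir (D.bott φ T) (paramVec d S) z - cdir (D.bott φ S) (paramVec d T) z =
      flatDelBar (fun x => D.alphaForm φ S T (z.1, x)) z.2 +
      flatDel (fun x => D.betaForm φ S T (z.1, x)) z.2 := by
  ext v
  rw [ContinuousAlternatingMap.sub_apply, ContinuousAlternatingMap.add_apply]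
  have ev := eventually_mem_dom hz
  rw [cdir_form_altSum (by filter_upwards [ev] with x hx using bott_apply φ T hx)
      (smooth_bott_summand φ T hz),
    cdir_form_altSum (by filter_upwards [ev] with x hx using bott_apply φ S hx)
      (smooth_bott_summand φ S hz)]
  have h1 := flatDelBar_altSum (η := D.alphaForm φ S T) (w := z.1) (y := z.2)
    (by filter_upwards [ev] with x hx using alphaForm_apply φ S T hx)
    (smooth_alphaForm_summand φ S T hz) v
  have h2 := flatDel_altSum (η := D.betaForm φ S T) (w := z.1) (y := z.2)
    (by filter_upwards [ev] with x hx using betaForm_apply φ S T hx)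
    (smooth_betaForm_summand φ S T hz) v
  refine Eq.trans ?_ (congrArg₂ (· + ·) h1 h2).symm
  rw [← mul_sub, (isVariation S).altSum_cdir_slotSum_sub (isVariation T)
    (curvDir_logDeriv hz S T) hz hφ v, pow_succ, mul_assoc, ← mul_assoc (1 / 2 : ℂ) 2, ← mul_add]
  norm_num
  rfl

theorem cdir_bott_eq {φ : MultilinearMap ℂ (fun _ : Fin 1 => Mat n) ℂ}
    (hφ : IsAdInvariant φ) (S T : W) (hz : z ∈ D.dom) :
    cdir (D.bott φ T) (paramVec d S) z = cdir (D.bott φ S) (paramVec d T) z := by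
  ext v
  have ev := eventually_mem_dom hz
  rw [cdir_form_altSum (by filter_upwards [ev] with x hx using bott_apply φ T hx)
      (smooth_bott_summand φ T hz),
    cdir_form_altSum (by filter_upwards [ev] with x hx using bott_apply φ S hx)
      (smooth_bott_summand φ S hz)]
  congr 2
  funext w
  exact (isVariation S).cdir_slotSum_eq hφ (isVariation T) (curvDir_logDeriv hz S T) hz
    fun i y => onPairs (D.pair.curv y) w i

end FlatData

end FlatForms

/-! ### Integrals depending on parameters -/

section ParametricIntegral

open MeasureTheory

variable {Z : Type} [NormedAddCommGroup Z] [NormedSpace ℝ Z] [ProperSpace Z] {U : Set Z}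

section

variable {M : Type} [NormedAddCommGroup M] [NormedSpace ℝ M] {g : ℝ × Z → M} {y : Z}

theorem continuousOn_slab (hg : ∀ t, ∀ y ∈ U, ContDiffAt ℝ ∞ g (t, y)) :
    ContinuousOn g (univ ×ˢ U) :=
  fun z hz => (hg z.1 z.2 hz.2).continuousAt.continuousWithinAt

theorem continuous_slab_left (hg : ∀ t, ∀ y ∈ U, ContDiffAt ℝ ∞ g (t, y)) (hy : y ∈ U) :
    Continuous fun t => g (t, y) :=
  continuous_iff_continuousAt.2 fun t =>
    (hg t y hy).continuousAt.comp (f := fun t => (t, y)) (by fun_prop)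

/-- The partial derivative in the second variable. -/
def fderivSnd (g : ℝ × Z → M) (z : ℝ × Z) : Z →L[ℝ] M :=
  (fderiv ℝ g z).comp (ContinuousLinearMap.inr ℝ ℝ Z)

theorem contDiffAt_fderivSnd {z : ℝ × Z} (hg : ContDiffAt ℝ ∞ g z) :
    ContDiffAt ℝ ∞ (fderivSnd g) z :=
  (hg.fderiv_right (m := ∞) (by simp)).clm_comp contDiffAt_const

theorem hasFDerivAt_fderivSnd {t : ℝ} (hg : DifferentiableAt ℝ g (t, y)) :
    HasFDerivAt (fun y => g (t, y)) (fderivSnd g (t, y)) y :=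
  hg.hasFDerivAt.comp y (hasFDerivAt_prodMk_right t y)

variable (hU : IsOpen U) (hg : ∀ t, ∀ y ∈ U, ContDiffAt ℝ ∞ g (t, y))
include hU hg

/-- Differentiation under the integral sign; the partial derivative is continuous, hence bounded, on
the product of `[0,1]` and a closed ball, which is compact. -/
theorem hasFDerivAt_integral_slab (hy : y ∈ U) :
    HasFDerivAt (fun y => ∫ t in (0 : ℝ)..1, g (t, y)) (∫ t in (0 : ℝ)..1, fderivSnd g (t, y)) y := by
  have hg' : ∀ t, ∀ y ∈ U, ContDiffAt ℝ ∞ (fderivSnd g) (t, y) :=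
    fun t y hy => contDiffAt_fderivSnd (hg t y hy)
  obtain ⟨r, hr, hrU⟩ := Metric.nhds_basis_closedBall.mem_iff.1 (hU.mem_nhds hy)
  have hK : IsCompact (uIcc (0 : ℝ) 1 ×ˢ Metric.closedBall y r) :=
    isCompact_uIcc.prod (isCompact_closedBall y r)
  obtain ⟨C, hC⟩ := hK.exists_bound_of_continuousOn
    ((continuousOn_slab hg').mono (prod_mono (subset_univ _) hrU))
  refine intervalIntegral.hasFDerivAt_integral_of_dominated_of_fderiv_le
    (F := fun y t => g (t, y)) (F' := fun y t => fderivSnd g (t, y)) (bound := fun _ => C)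
    (Metric.closedBall_mem_nhds y hr) ?_ ?_ ?_ ?_ ?_ ?_
  · filter_upwards [hU.mem_nhds hy] with x hx
    exact (continuous_slab_left hg hx).aestronglyMeasurable
  · exact (continuous_slab_left hg hy).intervalIntegrable _ _
  · exact (continuous_slab_left hg' hy).aestronglyMeasurable
  · exact Filter.Eventually.of_forall fun t ht x hx => hC (t, x) ⟨uIoc_subset_uIcc ht, hx⟩
  · exact intervalIntegrable_const
  · exact Filter.Eventually.of_forall fun t _ x hx =>
      hasFDerivAt_fderivSnd ((hg t x (hrU hx)).differentiableAt (by simp))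

theorem contDiffOn_integral_slab : ContDiffOn ℝ ∞ (fun y => ∫ t in (0 : ℝ)..1, g (t, y)) U := by
  rw [contDiffOn_infty]
  intro k
  -- The derivative of the integral is again such an integral, but with values in linear maps, so
  -- the target space must vary in the induction.
  induction k generalizing M with
  | zero =>
    exact contDiffOn_zero.2 fun y hy =>
      (hasFDerivAt_integral_slab hU hg hy).continuousAt.continuousWithinAt
  | succ k ih =>
    rw [Nat.cast_add, Nat.cast_one, contDiffOn_succ_iff_fderiv_of_isOpen hU]
    refine ⟨fun y hy =>
      (hasFDerivAt_integral_slab hU hg hy).differentiableAt.differentiableWithinAt,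
      fun h => by simp at h, ?_⟩
    exact (ih (g := fderivSnd g) fun t y hy => contDiffAt_fderivSnd (hg t y hy)).congr
      fun y hy => (hasFDerivAt_integral_slab hU hg hy).fderiv

theorem contDiffAt_integral_slab (hy : y ∈ U) :
    ContDiffAt ℝ ∞ (fun y => ∫ t in (0 : ℝ)..1, g (t, y)) y :=
  (contDiffOn_integral_slab hU hg).contDiffAt (hU.mem_nhds hy)

theorem fderiv_integral_slab (hy : y ∈ U) :
    fderiv ℝ (fun y => ∫ t in (0 : ℝ)..1, g (t, y)) y =
      ∫ t in (0 : ℝ)..1, fderiv ℝ (fun y => g (t, y)) y := by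
  rw [(hasFDerivAt_integral_slab hU hg hy).fderiv]
  congr 1
  funext t
  exact (hasFDerivAt_fderivSnd ((hg t y hy).differentiableAt (by simp))).fderiv.symm

theorem continuous_fderiv_slab (hy : y ∈ U) :
    Continuous fun t => fderiv ℝ (fun y => g (t, y)) y := by
  have h := continuous_slab_left (g := fderivSnd g)
    (fun t y hy => contDiffAt_fderivSnd (hg t y hy)) hy
  refine h.congr fun t => ?_
  exact (hasFDerivAt_fderivSnd ((hg t y hy).differentiableAt (by simp))).fderiv.symm

theorem map_fderiv_integral_slab [CompleteSpace M] {N : Type} [NormedAddCommGroup N]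
    [NormedSpace ℝ N] [CompleteSpace N] (hy : y ∈ U) (T : (Z →L[ℝ] M) →L[ℝ] N) :
    T (fderiv ℝ (fun y => ∫ t in (0 : ℝ)..1, g (t, y)) y) =
      ∫ t in (0 : ℝ)..1, T (fderiv ℝ (fun y => g (t, y)) y) := by
  have h : IntervalIntegrable (fun t => fderiv ℝ (fun y => g (t, y)) y) volume 0 1 :=
    (continuous_fderiv_slab hU hg hy).intervalIntegrable _ _
  rw [fderiv_integral_slab hU hg hy]
  exact (T.intervalIntegral_comp_comm h).symm

end

/-! ### `∂` and `∂̄` under the integral sign -/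

section

variable {d p : ℕ} {U : Set (Cd d)} {g : ℝ × Cd d → Cd d [⋀^Fin p]→L[ℝ] ℂ} {y : Cd d}

section

variable (d) (M : Type) [NormedAddCommGroup M] [NormedSpace ℝ M] [NormedSpace ℂ M]
  [SMulCommClass ℝ ℂ M]

/-- The part of type `(1,0)` as a continuous linear map. -/
def part10CLM : (Cd d →L[ℝ] M) →L[ℝ] (Cd d →L[ℝ] M) :=
  (1 / 2 : ℂ) • (ContinuousLinearMap.id ℝ (Cd d →L[ℝ] M)
    - Complex.I • (ContinuousLinearMap.precomp M (mulI d) : (Cd d →L[ℝ] M) →L[ℝ] (Cd d →L[ℝ] M)))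

/-- The part of type `(0,1)` as a continuous linear map. -/
def part01CLM : (Cd d →L[ℝ] M) →L[ℝ] (Cd d →L[ℝ] M) :=
  ContinuousLinearMap.id ℝ (Cd d →L[ℝ] M) - part10CLM d M

variable {d M}

theorem part01CLM_apply (L : Cd d →L[ℝ] M) : part01CLM d M L = part01 L :=
  sub_eq_of_eq_add' (part10_add_part01 L).symm

end

/-- The operator `∂` as a linear function of the differential of the coefficients. -/
def delCLM (d p : ℕ) :
    (Cd d →L[ℝ] Cd d [⋀^Fin p]→L[ℝ] ℂ) →L[ℝ] Cd d [⋀^Fin (p + 1)]→L[ℝ] ℂ :=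
  (ContinuousAlternatingMap.alternatizeUncurryFinCLM ℝ (Cd d) ℂ).comp (part10CLM d (Cd d [⋀^Fin p]→L[ℝ] ℂ))

/-- The operator `∂̄` as a linear function of the differential of the coefficients. -/
def delBarCLM (d p : ℕ) :
    (Cd d →L[ℝ] Cd d [⋀^Fin p]→L[ℝ] ℂ) →L[ℝ] Cd d [⋀^Fin (p + 1)]→L[ℝ] ℂ :=
  (ContinuousAlternatingMap.alternatizeUncurryFinCLM ℝ (Cd d) ℂ).comp (part01CLM d (Cd d [⋀^Fin p]→L[ℝ] ℂ))

theorem delCLM_fderiv (η : Cd d → Cd d [⋀^Fin p]→L[ℝ] ℂ) (y : Cd d) :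
    delCLM d p (fderiv ℝ η y) = flatDel η y := rfl

theorem delBarCLM_fderiv (η : Cd d → Cd d [⋀^Fin p]→L[ℝ] ℂ) (y : Cd d) :
    delBarCLM d p (fderiv ℝ η y) = flatDelBar η y := by
  rw [delBarCLM, ContinuousLinearMap.comp_apply, part01CLM_apply]
  rfl

theorem Filter.EventuallyEq.flatDel_eq {η θ : Cd d → Cd d [⋀^Fin p]→L[ℝ] ℂ} (h : η =ᶠ[𝓝 y] θ) :
    flatDel η y = flatDel θ y := by
  rw [flatDel, flatDel, h.fderiv_eq]

theorem Filter.EventuallyEq.flatDelBar_eq {η θ : Cd d → Cd d [⋀^Fin p]→L[ℝ] ℂ}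
    (h : η =ᶠ[𝓝 y] θ) : flatDelBar η y = flatDelBar θ y := by
  rw [flatDelBar, flatDelBar, h.fderiv_eq]

theorem ContDiffAt.flatDel {η : Cd d → Cd d [⋀^Fin p]→L[ℝ] ℂ} (h : ContDiffAt ℝ ∞ η y) :
    ContDiffAt ℝ ∞ (flatDel η) y := by
  have h1 : ContDiffAt ℝ ∞ (fun x => fderiv ℝ η x) y := h.fderiv_right (m := ∞) (by simp)
  exact h1.continuousLinearMap_comp (delCLM d p)

variable (hU : IsOpen U) (hg : ∀ t, ∀ y ∈ U, ContDiffAt ℝ ∞ g (t, y))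

include hU hg

theorem flatDel_integral (hy : y ∈ U) :
    flatDel (fun y => ∫ t in (0 : ℝ)..1, g (t, y)) y =
      ∫ t in (0 : ℝ)..1, flatDel (fun y => g (t, y)) y := by
  simp only [← delCLM_fderiv]
  exact map_fderiv_integral_slab hU hg hy (delCLM d p)

theorem flatDelBar_integral (hy : y ∈ U) :
    flatDelBar (fun y => ∫ t in (0 : ℝ)..1, g (t, y)) y =
      ∫ t in (0 : ℝ)..1, flatDelBar (fun y => g (t, y)) y := by
  simp only [← delBarCLM_fderiv]
  exact map_fderiv_integral_slab hU hg hy (delBarCLM d p)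

end

end ParametricIntegral

/-! ### Pullback along holomorphic maps -/

section Pullback

variable {d n p : ℕ} {y : Cd d}

theorem minSmoothness_two_le : minSmoothness ℝ 2 ≤ ∞ := by
  rw [minSmoothness_of_isRCLikeNormedField]
  exact WithTop.coe_le_coe.2 (le_top : (2 : ℕ∞) ≤ ⊤)

/-- Expanding the vectors in a basis leaves a polynomial in their coordinates with coefficients the
values of the form on basis vectors. -/
theorem ContDiffAt.form_apply_fun {Z : Type*} [NormedAddCommGroup Z] [NormedSpace ℝ Z]
    {η : Z → Cd d [⋀^Fin p]→L[ℝ] ℂ} {v : Z → Fin p → Cd d} {z : Z} (hη : ContDiffAt ℝ ∞ η z)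
    (hv : ∀ i, ContDiffAt ℝ ∞ (fun x => v x i) z) : ContDiffAt ℝ ∞ (fun x => η x (v x)) z := by
  let b := Module.finBasis ℝ (Cd d)
  have e : ∀ x, η x (v x) = ∑ r : Fin p → Fin (Module.finrank ℝ (Cd d)),
      (∏ i, b.repr (v x i) (r i)) • η x (fun i => b (r i)) := by
    intro x
    conv_lhs => rw [show v x = fun i => ∑ j, b.repr (v x i) j • b j from
      funext fun i => (b.sum_repr (v x i)).symm]
    refine ((η x).toMultilinearMap.map_sum _).trans ?_
    exact Finset.sum_congr rfl fun r _ => (η x).toMultilinearMap.map_smul_univ _ _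
  simp only [e]
  refine ContDiffAt.sum fun r _ => ContDiffAt.fun_smul (contDiffAt_prod fun i _ => ?_)
    (hη.form_apply _)
  exact (LinearMap.toContinuousLinearMap (b.coord (r i))).contDiff.contDiffAt.comp z (hv i)

/-- A smooth map of flat spaces with complex linear differential near a point. -/
structure IsHolomorphicNear (τ : Cd d → Cd d) (y : Cd d) : Prop where
  smooth : ContDiffAt ℝ ∞ τ y
  comm : ∀ᶠ x in 𝓝 y, ∀ v, fderiv ℝ τ x (mulI d v) = mulI d (fderiv ℝ τ x v)

variable {τ : Cd d → Cd d}

namespace IsHolomorphicNear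

variable (h : IsHolomorphicNear τ y)
include h

theorem comm_self (v : Cd d) : fderiv ℝ τ y (mulI d v) = mulI d (fderiv ℝ τ y v) :=
  h.comm.self_of_nhds v

theorem differentiableAt : DifferentiableAt ℝ τ y := h.smooth.differentiableAt (by simp)

theorem smooth_fderiv : ContDiffAt ℝ ∞ (fderiv ℝ τ) y := h.smooth.fderiv_right (m := ∞) (by simp)

theorem differentiableAt_fderiv : DifferentiableAt ℝ (fderiv ℝ τ) y :=
  h.smooth_fderiv.differentiableAt (by simp)

theorem snd_symm (v w : Cd d) :
    fderiv ℝ (fderiv ℝ τ) y v w = fderiv ℝ (fderiv ℝ τ) y w v :=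
  h.smooth.isSymmSndFDerivAt minSmoothness_two_le v w

/-- Differentiate the commutation of `fderiv τ` with multiplication by `i`, which holds in a
neighbourhood. -/
theorem snd_mulI (v w : Cd d) :
    fderiv ℝ (fderiv ℝ τ) y v (mulI d w) = mulI d (fderiv ℝ (fderiv ℝ τ) y v w) := by
  have e : ∀ u, fderiv ℝ (fun x => fderiv ℝ τ x u) y v = fderiv ℝ (fderiv ℝ τ) y v u := fun u => by
    rw [fderiv_clm_apply h.differentiableAt_fderiv (differentiableAt_const u)]
    simp
  have h1 : (fun x => fderiv ℝ τ x (mulI d w)) =ᶠ[𝓝 y] fun x => mulI d (fderiv ℝ τ x w) := by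
    filter_upwards [h.comm] with x hx using hx w
  rw [← e, ← e, h1.fderiv_eq]
  exact congrArg (fun L : Cd d →L[ℝ] Cd d => L v) ((mulI d).hasFDerivAt.comp y
    (h.differentiableAt_fderiv.clm_apply (differentiableAt_const w)).hasFDerivAt).fderiv

theorem snd_mulI_left (v w : Cd d) :
    fderiv ℝ (fderiv ℝ τ) y (mulI d v) w = mulI d (fderiv ℝ (fderiv ℝ τ) y v w) := by
  rw [h.snd_symm, h.snd_mulI, h.snd_symm]

end IsHolomorphicNear

/-- The pullback of a form in flat coordinates. -/
def flatPullback (τ : Cd d → Cd d) (η : Cd d → Cd d [⋀^Fin p]→L[ℝ] ℂ) (x : Cd d) :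
    Cd d [⋀^Fin p]→L[ℝ] ℂ :=
  (η (τ x)).compContinuousLinearMap (fderiv ℝ τ x)

theorem flatPullback_apply (η : Cd d → Cd d [⋀^Fin p]→L[ℝ] ℂ) (x : Cd d) (v : Fin p → Cd d) :
    flatPullback τ η x v = η (τ x) fun i => fderiv ℝ τ x (v i) := rfl

theorem ContDiffAt.flatPullback {η : Cd d → Cd d [⋀^Fin p]→L[ℝ] ℂ} (hη : ContDiffAt ℝ ∞ η (τ y))
    (hτ : ContDiffAt ℝ ∞ τ y) : ContDiffAt ℝ ∞ (flatPullback τ η) y := by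
  refine contDiffAt_form fun v => ?_
  have h1 : ContDiffAt ℝ ∞ (fun x => η (τ x)) y := hη.comp y hτ
  have h2 : ContDiffAt ℝ ∞ (fderiv ℝ τ) y := hτ.fderiv_right (m := ∞) (by simp)
  have h3 : ∀ i, ContDiffAt ℝ ∞ (fun x => fderiv ℝ τ x (v i)) y :=
    fun i => h2.clm_apply contDiffAt_const
  exact h1.form_apply_fun h3

/-- The first derivative of `τ` commutes with `i`, so taking `(1,0)`-parts commutes with it. The
terms with the second derivative of `τ`, also after one argument is multiplied by `i`, are symmetric
in two vectors and disappear under alternation. -/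
theorem flatDel_pullback {η : Cd d → Cd d [⋀^Fin p]→L[ℝ] ℂ} (hη : DifferentiableAt ℝ η (τ y))
    (h : IsHolomorphicNear τ y) : flatDel (flatPullback τ η) y =
      (flatDel η (τ y)).compContinuousLinearMap (fderiv ℝ τ y) := by
  have e : fderiv ℝ (flatPullback τ η) y =
      (ContinuousAlternatingMap.compContinuousLinearMapCLM (fderiv ℝ τ y)).comp
        ((fderiv ℝ η (τ y)).comp (fderiv ℝ τ y)) +
      ((η (τ y)).fderivCompContinuousLinearMap (fderiv ℝ τ y)).comp
        (fderiv ℝ (fderiv ℝ τ) y) := by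
    have h1 : HasFDerivAt (fun x => η (τ x)) ((fderiv ℝ η (τ y)).comp (fderiv ℝ τ y)) y :=
      hη.hasFDerivAt.comp y h.differentiableAt.hasFDerivAt
    exact (h1.continuousAlternatingMapCompContinuousLinearMap
      h.differentiableAt_fderiv.hasFDerivAt).fderiv
  have e2 : part10 (fderiv ℝ (flatPullback τ η) y) =
      (ContinuousAlternatingMap.compContinuousLinearMapCLM (fderiv ℝ τ y)).comp
        ((part10 (fderiv ℝ η (τ y))).comp (fderiv ℝ τ y)) +
      ((1 / 2 : ℂ) • ((η (τ y)).fderivCompContinuousLinearMap (fderiv ℝ τ y)).comp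
        (fderiv ℝ (fderiv ℝ τ) y) + -(Complex.I / 2) •
        ((η (τ y)).fderivCompContinuousLinearMap (fderiv ℝ τ y)).comp
          ((fderiv ℝ (fderiv ℝ τ) y).comp (mulI d))) := by
    rw [e]
    ext v w
    simp only [part10, _root_.smul_apply, _root_.sub_apply, _root_.add_apply,
      ContinuousLinearMap.comp_apply, h.comm_self,
      ContinuousAlternatingMap.compContinuousLinearMapCLM_apply,
      ContinuousAlternatingMap.compContinuousLinearMap_apply,
      ContinuousAlternatingMap.smul_apply, ContinuousAlternatingMap.sub_apply,
      ContinuousAlternatingMap.add_apply, smul_eq_mul]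
    ring
  rw [flatDel, e2, ContinuousAlternatingMap.alternatizeUncurryFin_add,
    ContinuousAlternatingMap.alternatizeUncurryFin_add,
    ContinuousAlternatingMap.alternatizeUncurryFin_smul,
    ContinuousAlternatingMap.alternatizeUncurryFin_smul,
    ContinuousAlternatingMap.alternatizeUncurryFin_fderivCompContinuousLinearMap_eq_zero _ _
      h.snd_symm,
    ContinuousAlternatingMap.alternatizeUncurryFin_fderivCompContinuousLinearMap_eq_zero _ _
      (fun v w => by
        rw [ContinuousLinearMap.comp_apply, ContinuousLinearMap.comp_apply, h.snd_mulI_left,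
          h.snd_mulI_left, h.snd_symm])]
  ext v
  simp +unfoldPartialApp [flatDel, ContinuousAlternatingMap.alternatizeUncurryFin_apply,
    Fin.removeNth, Function.comp_def]

-- Curvature of connections pulled back along a holomorphic map

attribute [local instance] Matrix.linftyOpNormedRing matNormedAlgebra
attribute [local instance] matTopology matRealModule

/-- Complexified vectors depending complex linearly or antilinearly on a real vector. -/
def mixVec (a b : ℝ) (v : Cd d) : Cd d × Cd d := (a • v, b • mulI d v)

theorem mixVec_half (v : Cd d) : mixVec (1 / 2) (1 / 2) v = vecDelBar v := rfl

theorem mixVec_neg_half (v : Cd d) : mixVec (1 / 2) (-(1 / 2)) v = vecDel v := by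
  simp [mixVec, vecDel]

theorem contDiffAt_pullback_coeff {B : Cd d → Cd d →L[ℝ] Arr n} (hB : ContDiffAt ℝ ∞ B (τ y))
    (hτ : ContDiffAt ℝ ∞ τ y) (v : Cd d) :
    ContDiffAt ℝ ∞ (fun x => B (τ x) (fderiv ℝ τ x v)) y :=
  (hB.comp y hτ).clm_apply ((hτ.fderiv_right (m := ∞) (by simp)).clm_apply contDiffAt_const)

/-- The curvature of a pulled back connection. -/
theorem curvDir_pullback {B : Cd d → Cd d →L[ℝ] Arr n} (hB : ContDiffAt ℝ ∞ B (τ y))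
    (h : IsHolomorphicNear τ y) (a b : ℝ) (v w : Cd d) :
    curvDir (mixVec a b v) (mixVec a b w)
      (fun x => Matrix.of (B (τ x) (fderiv ℝ τ x v)))
      (fun x => Matrix.of (B (τ x) (fderiv ℝ τ x w))) y =
    curvDir (mixVec a b (fderiv ℝ τ y v)) (mixVec a b (fderiv ℝ τ y w))
      (fun x => Matrix.of (B x (fderiv ℝ τ y v)))
      (fun x => Matrix.of (B x (fderiv ℝ τ y w))) (τ y) := by
  have dB : DifferentiableAt ℝ B (τ y) := hB.differentiableAt (by simp)
  have e1 : ∀ v e, fderiv ℝ (fun x => B (τ x) (fderiv ℝ τ x v)) y e =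
      fderiv ℝ B (τ y) (fderiv ℝ τ y e) (fderiv ℝ τ y v) +
        B (τ y) (fderiv ℝ (fderiv ℝ τ) y e v) := by
    intro v e
    have h1 : HasFDerivAt (fun x => B (τ x)) ((fderiv ℝ B (τ y)).comp (fderiv ℝ τ y)) y :=
      dB.hasFDerivAt.comp y h.differentiableAt.hasFDerivAt
    have h2 := h.differentiableAt_fderiv.hasFDerivAt.clm_apply (hasFDerivAt_const v y)
    rw [(h1.clm_apply h2).fderiv]
    simp [add_comm]
  have e2 : ∀ v e, fderiv ℝ (fun x => B x v) (τ y) e = fderiv ℝ B (τ y) e v := by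
    intro v e
    rw [(dB.hasFDerivAt.clm_apply (hasFDerivAt_const v (τ y))).fderiv]
    simp
  -- The correction by the second derivative of `τ` is symmetric in `v` and `w`, hence cancels in
  -- the curvature. The coefficients `a`, `b` are left free so that the types `(1,0)`, `(0,1)` and
  -- real directions are covered at once.
  have e3 : ∀ v w, cdir (fun x => B (τ x) (fderiv ℝ τ x v)) (mixVec a b w) y =
      cdir (fun x => B x (fderiv ℝ τ y v)) (mixVec a b (fderiv ℝ τ y w)) (τ y) +
      (a • B (τ y) (fderiv ℝ (fderiv ℝ τ) y v w) +
        Complex.I • b • B (τ y) (mulI d (fderiv ℝ (fderiv ℝ τ) y v w))) := by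
    intro v w
    simp only [cdir, e1, e2, mixVec, map_smul, h.comm_self, _root_.smul_apply, h.snd_mulI_left,
      h.snd_symm w v, smul_add]
    abel
  have dB1 : ∀ v, DifferentiableAt ℝ (fun x => B x v) (τ y) :=
    fun v => dB.clm_apply (differentiableAt_const v)
  have dB2 : ∀ v, DifferentiableAt ℝ (fun x => B (τ x) (fderiv ℝ τ x v)) y :=
    fun v => (contDiffAt_pullback_coeff hB h.smooth v).differentiableAt (by simp)
  simp only [curvDir]
  rw [cdir_of (dB2 w), cdir_of (dB2 v), cdir_of (dB1 _), cdir_of (dB1 _), e3, e3, h.snd_symm w v,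
    Matrix.of_sub_of, add_sub_add_right_eq_sub, ← Matrix.of_sub_of]

end Pullback

/-! ### Changes of charts and frames -/

section Invariance

variable {n k : ℕ}

theorem IsGLInvariant.eq_of_conj {φ : MultilinearMap ℂ (fun _ : Fin k => Mat n) ℂ}
    (hφ : IsGLInvariant φ) {g : Mat n} (hg : IsUnit g) {B C : Fin k → Mat n}
    (h : ∀ i, g * B i = C i * g) : φ B = φ C := by
  obtain ⟨u, rfl⟩ := hg
  rw [← hφ u B]
  congr 1
  funext i
  rw [h, mul_assoc, Units.mul_inv, mul_one]

theorem IsGLInvariant.slotSum_eq_of_conj {φ : MultilinearMap ℂ (fun _ : Fin (k + 1) => Mat n) ℂ}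
    (hφ : IsGLInvariant φ) {g : Mat n} (hg : IsUnit g) {L N : Mat n} {B C : Fin k → Mat n}
    (hL : g * L = N * g) (h : ∀ i, g * B i = C i * g) : slotSum φ L B = slotSum φ N C := by
  simp only [slotSum_apply]
  refine Finset.sum_congr rfl fun j _ => hφ.eq_of_conj hg fun i => ?_
  cases i using Fin.succAboveCases j <;> simp [hL, h]

theorem IsGLInvariant.slotSum_slotSum_eq_of_conj
    {φ : MultilinearMap ℂ (fun _ : Fin (k + 2) => Mat n) ℂ}
    (hφ : IsGLInvariant φ) {g : Mat n} (hg : IsUnit g) {L N L' N' : Mat n} {B C : Fin k → Mat n}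
    (hL : g * L = N * g) (hL' : g * L' = N' * g) (h : ∀ i, g * B i = C i * g) :
    slotSum (slotSum φ L) L' B = slotSum (slotSum φ N) N' C := by
  simp only [slotSum_apply (slotSum φ _)]
  refine Finset.sum_congr rfl fun j _ => hφ.slotSum_eq_of_conj hg hL fun i => ?_
  cases i using Fin.succAboveCases j <;> simp [hL', h]

end Invariance

/-! ### Behaviour of the local forms under changes of chart and frame -/

section Transition

attribute [local instance] Matrix.linftyOpNormedRing matNormedAlgebra
attribute [local instance] matTopology matRealModule

namespace FlatData

variable {d n m : ℕ} {W : Type*} [NormedAddCommGroup W] [NormedSpace ℝ W]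

/-- A holomorphic change of coordinates and a change of frames between two flat data. -/
structure Transition (D D₀ : FlatData d n W) where
  N : Set (Cd d)
  isOpen : IsOpen N
  τ : Cd d → Cd d
  g : Cd d → Mat n
  subset : ∀ x ∈ N, x ∈ D.U
  mapsTo : ∀ x ∈ N, τ x ∈ D₀.U
  holo : ∀ x ∈ N, IsHolomorphicNear τ x
  smooth_g : ∀ x ∈ N, ContDiffAt ℝ ∞ g x
  isUnit_g : ∀ x ∈ N, IsUnit (g x)
  coeff_eq : ∀ x ∈ N, ∀ v, g x * Matrix.of (D.A x v) =
    Matrix.of (D₀.A (τ x) (fderiv ℝ τ x v)) * g x + cdir g (vecDelBar v) x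
  metric_eq : ∀ x ∈ N, ∀ w, D.metric (w, x) = (g x)ᴴ * D₀.metric (w, τ x) * g x

namespace Transition

variable {D D₀ : FlatData d n W} (t : D.Transition D₀)

/-- The change of coordinates with parameters. -/
def map (z : W × Cd d) : W × Cd d := (z.1, t.τ z.2)

/-- The change of frames with parameters. -/
def gauge (z : W × Cd d) : Mat n := t.g z.2

variable {t} {z : W × Cd d}

theorem mem_dom (hz : z.2 ∈ t.N) : z ∈ D.dom := t.subset _ hz

theorem map_mem_dom (hz : z.2 ∈ t.N) : t.map z ∈ D₀.dom := t.mapsTo _ hz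

theorem eventually_mem (hz : z.2 ∈ t.N) : ∀ᶠ x in 𝓝 z, x.2 ∈ t.N :=
  (t.isOpen.preimage continuous_snd).mem_nhds hz

theorem smooth_map (hz : z.2 ∈ t.N) : ContDiffAt ℝ ∞ t.map z :=
  contDiffAt_fst.prodMk ((t.holo _ hz).smooth.comp z contDiffAt_snd)

theorem smooth_gauge (hz : z.2 ∈ t.N) : ContDiffAt ℝ ∞ t.gauge z :=
  (t.smooth_g _ hz).comp z contDiffAt_snd

theorem isUnit_gauge (hz : z.2 ∈ t.N) : IsUnit (t.gauge z) := t.isUnit_g _ hz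

theorem fderiv_map (hz : z.2 ∈ t.N) (e : W × Cd d) :
    fderiv ℝ t.map z e = (e.1, fderiv ℝ t.τ z.2 e.2) := by
  have h : HasFDerivAt t.map _ z := hasFDerivAt_fst.prodMk
    ((t.holo _ hz).differentiableAt.hasFDerivAt.comp z hasFDerivAt_snd)
  rw [h.fderiv]
  rfl

section

variable {M : Type*} [NormedAddCommGroup M] [NormedSpace ℝ M] [NormedSpace ℂ M]
  [SMulCommClass ℝ ℂ M] {f : W × Cd d → M}

theorem cdir_comp_map (hz : z.2 ∈ t.N) (hf : DifferentiableAt ℝ f (t.map z)) (a b : ℝ)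
    (v : Cd d) : cdir (fun x => f (t.map x)) (liftVec W (mixVec a b v)) z =
      cdir f (liftVec W (mixVec a b (fderiv ℝ t.τ z.2 v))) (t.map z) := by
  rw [cdir_comp hf ((smooth_map hz).differentiableAt (by simp)), fderiv_map hz, fderiv_map hz]
  simp [liftVec, mixVec, (t.holo _ hz).comm_self]

theorem cdir_comp_map_vecDel (hz : z.2 ∈ t.N) (hf : DifferentiableAt ℝ f (t.map z))
    (v : Cd d) : cdir (fun x => f (t.map x)) (liftVec W (vecDel v)) z =
      cdir f (liftVec W (vecDel (fderiv ℝ t.τ z.2 v))) (t.map z) := by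
  rw [← mixVec_neg_half, ← mixVec_neg_half, cdir_comp_map hz hf]

theorem cdir_comp_map_vecDelBar (hz : z.2 ∈ t.N) (hf : DifferentiableAt ℝ f (t.map z))
    (v : Cd d) : cdir (fun x => f (t.map x)) (liftVec W (vecDelBar v)) z =
      cdir f (liftVec W (vecDelBar (fderiv ℝ t.τ z.2 v))) (t.map z) := by
  rw [← mixVec_half, ← mixVec_half, cdir_comp_map hz hf]

theorem cdir_comp_map_paramVec (hz : z.2 ∈ t.N) (hf : DifferentiableAt ℝ f (t.map z)) (T : W) :
    cdir (fun x => f (t.map x)) (paramVec d T) z = cdir f (paramVec d T) (t.map z) := by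
  rw [cdir_comp hf ((smooth_map hz).differentiableAt (by simp)), fderiv_map hz, fderiv_map hz]
  simp only [paramVec, Prod.fst_zero, Prod.snd_zero, map_zero, Prod.mk_zero_zero]

end

theorem cdir_gauge (hz : z.2 ∈ t.N) (X : Cd d × Cd d) :
    cdir t.gauge (liftVec W X) z = cdir t.g X z.2 :=
  cdir_snd ((t.smooth_g _ hz).differentiableAt (by simp)) _

theorem metric_eq_map (hz : z.2 ∈ t.N) :
    D.metric z = (t.gauge z)ᴴ * D₀.metric (t.map z) * t.gauge z :=
  t.metric_eq z.2 hz z.1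

theorem gauge_mul_coeff (hz : z.2 ∈ t.N) (v : Cd d) : t.gauge z * D.coeff v z =
    D₀.coeff (fderiv ℝ t.τ z.2 v) (t.map z) * t.gauge z
      + cdir t.gauge (liftVec W (vecDelBar v)) z := by
  rw [cdir_gauge hz]
  exact t.coeff_eq z.2 hz v

/-- The conjugate transpose of the transformation law of `A` at the vector `iv`, multiplied by `i`.
-/
theorem conjCoeff_mul_gauge (hz : z.2 ∈ t.N) (v : Cd d) :
    conjCoeff D.A v z.2 * (t.gauge z)ᴴ + cdir (fun x => (t.gauge x)ᴴ) (liftVec W (vecDel v)) z =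
      (t.gauge z)ᴴ * conjCoeff D₀.A (fderiv ℝ t.τ z.2 v) (t.map z).2 := by
  have h := congrArg Matrix.conjTranspose (t.coeff_eq z.2 hz (mulI d v))
  rw [(t.holo _ hz).comm_self, Matrix.conjTranspose_mul, Matrix.conjTranspose_add,
    Matrix.conjTranspose_mul] at h
  have h2 : ((liftVec W (vecDel v)).1, -(liftVec W (vecDel v)).2) =
      liftVec W (vecDelBar v) := by simp [liftVec, vecDel, vecDelBar]
  rw [cdir_conjTranspose ((smooth_gauge hz).differentiableAt (by simp)), h2, cdir_gauge hz,
    ← cdir_vecDelBar_mulI, Matrix.conjTranspose_smul, conjCoeff, conjCoeff, smul_mul_assoc,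
    show (t.gauge z)ᴴ = (t.g z.2)ᴴ from rfl, h, smul_add, mul_smul_comm]
  simp [map]

theorem metric_mul_gauge_cancel (hz : z.2 ∈ t.N) {x y : Mat n}
    (h : (t.gauge z)ᴴ * (D₀.metric (t.map z) * x) = (t.gauge z)ᴴ * (D₀.metric (t.map z) * y)) :
    x = y := by
  have h1 : IsUnit (t.gauge z)ᴴ := (isUnit_gauge hz).star
  exact (isUnit_metric (map_mem_dom hz)).mul_left_cancel (h1.mul_left_cancel h)

theorem cdir_metric (hz : z.2 ∈ t.N) (X : (W × Cd d) × (W × Cd d)) : cdir D.metric X z =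
    cdir (fun x => (t.gauge x)ᴴ) X z * D₀.metric (t.map z) * t.gauge z
      + (t.gauge z)ᴴ * cdir (fun x => D₀.metric (t.map x)) X z * t.gauge z
      + (t.gauge z)ᴴ * D₀.metric (t.map z) * cdir t.gauge X z := by
  have h : D.metric =ᶠ[𝓝 z] fun x => (t.gauge x)ᴴ * D₀.metric (t.map x) * t.gauge x := by
    filter_upwards [eventually_mem hz] with x hx using metric_eq_map hx
  have s1 : ContDiffAt ℝ ∞ (fun x => (t.gauge x)ᴴ) z := (smooth_gauge hz).conjTranspose
  have s2 : ContDiffAt ℝ ∞ (fun x => D₀.metric (t.map x)) z :=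
    (smooth_metric (map_mem_dom hz)).comp z (smooth_map hz)
  have s3 := smooth_gauge (t := t) hz
  rw [h.cdir_eq, cdir_mul ((s1.mul s2).differentiableAt (by simp)) (s3.differentiableAt (by simp)),
    cdir_mul (s1.differentiableAt (by simp)) (s2.differentiableAt (by simp)), add_mul]

/-- Multiply by the metric and insert `G = gᴴ G₀ g`. The derivative of `gᴴ` is absorbed by the
transformation law of `conjCoeff`, and the derivative of `g` is the term claimed. -/
theorem gauge_mul_conn (hz : z.2 ∈ t.N) (v : Cd d) : t.gauge z * D.conn v z =
    D₀.conn (fderiv ℝ t.τ z.2 v) (t.map z) * t.gauge z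
      + cdir t.gauge (liftVec W (vecDel v)) z := by
  refine metric_mul_gauge_cancel hz ?_
  have h := metric_mul_conn (mem_dom hz) v
  rw [cdir_metric hz, metric_eq_map hz, cdir_comp_map_vecDel hz
    ((smooth_metric (map_mem_dom hz)).differentiableAt (by simp))] at h
  have h1 := conjCoeff_mul_gauge hz v
  have h2 := metric_mul_conn (map_mem_dom hz) (fderiv ℝ t.τ z.2 v)
  have h3 := congrArg (· * (D₀.metric (t.map z) * t.gauge z)) h1
  have h4 := congrArg (fun x => (t.gauge z)ᴴ * (x * t.gauge z)) h2
  simp only [mul_add, add_mul, mul_assoc] at h h3 h4 ⊢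
  rw [h, h4, ← h3]
  abel

/-- The change of frame does not depend on the parameter, so only `G₀` is differentiated and `L`
transforms by conjugation, without an inhomogeneous term. -/
theorem gauge_mul_logDeriv (hz : z.2 ∈ t.N) (T : W) :
    t.gauge z * D.logDeriv T z = D₀.logDeriv T (t.map z) * t.gauge z := by
  refine metric_mul_gauge_cancel hz ?_
  have h := metric_mul_logDeriv (mem_dom hz) T
  have h0 := cdir_snd_paramVec (z := z) ((t.smooth_g _ hz).differentiableAt (by simp)) T
  have h0' := cdir_snd_paramVec (z := z) (f := fun x => (t.g x)ᴴ)
    ((t.smooth_g _ hz).conjTranspose.differentiableAt (by simp)) T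
  have h2 := metric_mul_logDeriv (map_mem_dom hz) T
  rw [cdir_metric hz, metric_eq_map hz, cdir_comp_map_paramVec hz
    ((smooth_metric (map_mem_dom hz)).differentiableAt (by simp)),
    show cdir t.gauge (paramVec d T) z = 0 from h0,
    show cdir (fun x => (t.gauge x)ᴴ) (paramVec d T) z = 0 from h0'] at h
  have h4 := congrArg (fun x => (t.gauge z)ᴴ * (x * t.gauge z)) h2
  simp only [mul_assoc, zero_mul, mul_zero, zero_add, add_zero] at h h4 ⊢
  rw [h, h4]

theorem gauge_mul_nabla' (hz : z.2 ∈ t.N) (T : W) (v : Cd d) :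
    t.gauge z * D.pair.nabla' v (D.logDeriv T) z =
      D₀.pair.nabla' (fderiv ℝ t.τ z.2 v) (D₀.logDeriv T) (t.map z) * t.gauge z := by
  have s0 := smooth_logDeriv (map_mem_dom (t := t) hz) T
  refine (covDir_gauge (f₀ := fun x => D₀.logDeriv T (t.map x))
    (α₀ := fun _ => D₀.conn (fderiv ℝ t.τ z.2 v) (t.map z))
    ((smooth_logDeriv (mem_dom hz) T).differentiableAt (by simp))
    ((s0.comp z (smooth_map hz)).differentiableAt (by simp))
    ((smooth_gauge hz).differentiableAt (by simp)) (gauge_mul_conn hz v)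
    (by filter_upwards [eventually_mem hz] with x hx using gauge_mul_logDeriv hx T)).trans ?_
  simp only [covDir, FlatPair.nabla', pair]
  rw [cdir_comp_map_vecDel hz (s0.differentiableAt (by simp))]

theorem gauge_mul_nabla'' (hz : z.2 ∈ t.N) (T : W) (v : Cd d) :
    t.gauge z * D.pair.nabla'' v (D.logDeriv T) z =
      D₀.pair.nabla'' (fderiv ℝ t.τ z.2 v) (D₀.logDeriv T) (t.map z) * t.gauge z := by
  have s0 := smooth_logDeriv (map_mem_dom (t := t) hz) T
  refine (covDir_gauge (f₀ := fun x => D₀.logDeriv T (t.map x))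
    (α₀ := fun _ => D₀.coeff (fderiv ℝ t.τ z.2 v) (t.map z))
    ((smooth_logDeriv (mem_dom hz) T).differentiableAt (by simp))
    ((s0.comp z (smooth_map hz)).differentiableAt (by simp))
    ((smooth_gauge hz).differentiableAt (by simp)) (gauge_mul_coeff hz v)
    (by filter_upwards [eventually_mem hz] with x hx using gauge_mul_logDeriv hx T)).trans ?_
  simp only [covDir, FlatPair.nabla'', pair]
  rw [cdir_comp_map_vecDelBar hz (s0.differentiableAt (by simp))]

theorem of_curvature_eq_curvDir {C : Cd d → Cd d →L[ℝ] Arr n} {y : Cd d}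
    (hC : DifferentiableAt ℝ C y) (v u : Cd d) : Matrix.of (curvature C y v u) =
      curvDir (mixVec 1 0 v) (mixVec 1 0 u) (fun x => Matrix.of (C x v))
        (fun x => Matrix.of (C x u)) y := by
  have e : ∀ v u, cdir (fun x => Matrix.of (C x u)) (mixVec 1 0 v) y =
      Matrix.of (fderiv ℝ C y v u) := by
    intro v u
    rw [cdir_of (hC.clm_apply (differentiableAt_const u)), cdir, mixVec,
      fderiv_clm_apply hC (differentiableAt_const u)]
    simp
  rw [curvDir, e, e]
  rfl

theorem gauge_mul_higgsConnForm {w : W} {x : Cd d} (hx : x ∈ t.N) (v : Cd d) :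
    t.g x * Matrix.of (higgsConnForm D.A (fun x => D.G (w, x)) x v) =
      Matrix.of (higgsConnForm D₀.A (fun x => D₀.G (w, x)) (t.τ x) (fderiv ℝ t.τ x v)) * t.g x
        + cdir t.g (mixVec 1 0 v) x := by
  have h1 := gauge_mul_coeff (t := t) (z := (w, x)) hx v
  have h2 := gauge_mul_conn (t := t) (z := (w, x)) hx v
  rw [cdir_gauge hx] at h1 h2
  have h3 : cdir t.g (mixVec 1 0 v) x = cdir t.g (vecDel v) x + cdir t.g (vecDelBar v) x := by
    rw [cdir_vecDel_add, cdir, mixVec]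
    simp
  rw [of_higgsConnForm (t.subset x hx), of_higgsConnForm (t.mapsTo x hx), h3, mul_add, add_mul,
    show t.g x = t.gauge (w, x) from rfl, h1, h2]
  simp only [map]
  abel

/-- Gauge covariance together with naturality under pullback, applied to the full connection in real
directions `mixVec 1 0 v`. -/
theorem gauge_mul_curvForm (hz : z.2 ∈ t.N) (v u : Cd d) :
    t.gauge z * ofForm (D.curvForm z) v u =
      ofForm (D₀.curvForm (t.map z)) (fderiv ℝ t.τ z.2 v) (fderiv ℝ t.τ z.2 u) * t.gauge z := by
  have sC : ContDiffAt ℝ ∞ (higgsConnForm D.A fun x => D.G (z.1, x)) z.2 :=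
    (contDiffOn_higgsConnForm z.1).contDiffAt (D.isOpen.mem_nhds (t.subset _ hz))
  have sC₀ : ContDiffAt ℝ ∞ (higgsConnForm D₀.A fun x => D₀.G (z.1, x)) (t.τ z.2) :=
    (contDiffOn_higgsConnForm z.1).contDiffAt (D₀.isOpen.mem_nhds (t.mapsTo _ hz))
  have hN : ∀ᶠ x in 𝓝 z.2, x ∈ t.N := t.isOpen.mem_nhds hz
  have h := curvDir_gauge (g := t.g) (z := z.2) (X := mixVec 1 0 v) (Y := mixVec 1 0 u)
    (sC.clm_apply contDiffAt_const).of (sC.clm_apply contDiffAt_const).of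
    (contDiffAt_pullback_coeff sC₀ (t.holo _ hz).smooth v).of
    (contDiffAt_pullback_coeff sC₀ (t.holo _ hz).smooth u).of (t.smooth_g _ hz)
    (by filter_upwards [hN] with x hx using gauge_mul_higgsConnForm hx v)
    (by filter_upwards [hN] with x hx using gauge_mul_higgsConnForm hx u)
  rw [curvDir_pullback sC₀ (t.holo _ hz), ← of_curvature_eq_curvDir (sC.differentiableAt (by simp)),
    ← of_curvature_eq_curvDir (sC₀.differentiableAt (by simp))] at h
  exact h

theorem gauge_mul_onPairs (hz : z.2 ∈ t.N) {r : ℕ} (w : Fin (2 * r) → Cd d) (i : Fin r) :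
    t.gauge z * onPairs (ofForm (D.curvForm z)) w i =
      onPairs (ofForm (D₀.curvForm (t.map z))) (fun j => fderiv ℝ t.τ z.2 (w j)) i *
        t.gauge z :=
  gauge_mul_curvForm hz _ _

theorem altSum_map {p : ℕ} {f f₀ : (Fin p → Cd d) → ℂ} {T : Cd d → Cd d}
    (h : ∀ v, f v = f₀ fun i => T (v i)) (v : Fin p → Cd d) :
    altSum f v = altSum f₀ fun i => T (v i) := by
  simp only [altSum, h]
  rfl

variable {w : W} {y : Cd d}

theorem bott_eq {φ : MultilinearMap ℂ (fun _ : Fin (m + 1) => Mat n) ℂ} (hφ : IsGLInvariant φ)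
    (T : W) (hy : y ∈ t.N) :
    D.bott φ T (w, y) = flatPullback t.τ (fun x => D₀.bott φ T (w, x)) y := by
  ext v
  rw [flatPullback_apply, bott, bott, phiPrime_apply, phiPrime_apply]
  congr 1
  exact altSum_map (fun u => hφ.slotSum_eq_of_conj (isUnit_gauge (t := t) (z := (w, y)) hy)
    (gauge_mul_logDeriv hy T) (gauge_mul_onPairs hy u)) v

section

variable {φ : MultilinearMap ℂ (fun _ : Fin (m + 2) => Mat n) ℂ} (hφ : IsGLInvariant φ) (S T : W)
include hφ

theorem alphaForm_eq (hy : y ∈ t.N) :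
    D.alphaForm φ S T (w, y) = flatPullback t.τ (fun x => D₀.alphaForm φ S T (w, x)) y := by
  ext v
  rw [flatPullback_apply, alphaForm, alphaForm, phiSecond_apply, phiSecond_apply]
  congr 1
  refine altSum_map (fun u => hφ.slotSum_slotSum_eq_of_conj
    (isUnit_gauge (t := t) (z := (w, y)) hy) (gauge_mul_logDeriv hy T) ?_
    (gauge_mul_onPairs hy _)) v
  rw [of_delLog (t.subset y hy), of_delLog (t.mapsTo y hy)]
  exact gauge_mul_nabla' hy S (u 0)

theorem betaForm_eq (hy : y ∈ t.N) :
    D.betaForm φ S T (w, y) = flatPullback t.τ (fun x => D₀.betaForm φ S T (w, x)) y := by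
  ext v
  rw [flatPullback_apply, betaForm, betaForm, phiSecond_apply, phiSecond_apply]
  congr 1
  refine altSum_map (fun u => hφ.slotSum_slotSum_eq_of_conj
    (isUnit_gauge (t := t) (z := (w, y)) hy) (gauge_mul_logDeriv hy S) ?_
    (gauge_mul_onPairs hy _)) v
  rw [of_delBarLog (t.subset y hy), of_delBarLog (t.mapsTo y hy)]
  exact gauge_mul_nabla'' hy T (u 0)

end

end Transition

end FlatData

end Transition

/-! ### Forms on a complex manifold in charts -/

section ManifoldForms

variable {d p : ℕ} {X : Type*} [TopologicalSpace X] [ChartedSpace (Cd d) X]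

/-- The change of charts. -/
def chartMap (x x' : X) (y : Cd d) : Cd d := chartAt (Cd d) x' ((chartAt (Cd d) x).symm y)

/-- The part of the target of the chart at `x` that lies in an open set. -/
def chartDom (O : X → Set X) (x : X) : Set (Cd d) :=
  (chartAt (Cd d) x).target ∩ (chartAt (Cd d) x).symm ⁻¹' O x

section

variable {x x' x'' : X} {y : Cd d}

theorem isOpen_chartDom {O : X → Set X} (hO : ∀ x, IsOpen (O x)) (x : X) :
    IsOpen (chartDom (d := d) O x) :=
  (chartAt (Cd d) x).isOpen_inter_preimage_symm (hO x)

theorem center_mem_chartDom {O : X → Set X} (hO : ∀ x, x ∈ O x) (x : X) :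
    chartAt (Cd d) x x ∈ chartDom O x :=
  ⟨mem_chart_target _ x, by simpa [(chartAt (Cd d) x).left_inv (mem_chart_source _ x)] using hO x⟩

theorem eventually_chart (hy : y ∈ (chartAt (Cd d) x).target)
    (hy' : (chartAt (Cd d) x).symm y ∈ (chartAt (Cd d) x').source) :
    ∀ᶠ z in 𝓝 y, z ∈ (chartAt (Cd d) x).target ∧
      (chartAt (Cd d) x).symm z ∈ (chartAt (Cd d) x').source :=
  ((chartAt (Cd d) x).isOpen_inter_preimage_symm (chartAt (Cd d) x').open_source).mem_nhds
    ⟨hy, hy'⟩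

theorem chartMap_mem_target (hy' : (chartAt (Cd d) x).symm y ∈ (chartAt (Cd d) x').source) :
    chartMap x x' y ∈ (chartAt (Cd d) x').target :=
  (chartAt (Cd d) x').map_source hy'

theorem symm_chartMap (hy' : (chartAt (Cd d) x).symm y ∈ (chartAt (Cd d) x').source) :
    (chartAt (Cd d) x').symm (chartMap x x' y) = (chartAt (Cd d) x).symm y :=
  (chartAt (Cd d) x').left_inv hy'

theorem chartMap_chartMap (hy' : (chartAt (Cd d) x).symm y ∈ (chartAt (Cd d) x').source) :
    chartMap x' x'' (chartMap x x' y) = chartMap x x'' y := by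
  rw [chartMap, symm_chartMap hy', chartMap]

variable [IsManifold 𝓘(ℂ, Cd d) ω X]

theorem holomorphicNear_chartMap (hy : y ∈ (chartAt (Cd d) x).target)
    (hy' : (chartAt (Cd d) x).symm y ∈ (chartAt (Cd d) x').source) :
    IsHolomorphicNear (chartMap x x') y := by
  have h := (contDiffGroupoid ω 𝓘(ℂ, Cd d)).compatible (chart_mem_atlas (Cd d) x)
    (chart_mem_atlas (Cd d) x')
  rw [contDiffGroupoid, mem_groupoid_of_pregroupoid] at h
  have h1 : ContDiffOn ℂ ω (chartMap x x')
      ((chartAt (Cd d) x).target ∩ (chartAt (Cd d) x).symm ⁻¹' (chartAt (Cd d) x').source) := by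
    have := h.1
    simp only [contDiffPregroupoid, OpenPartialHomeomorph.trans_source,
      OpenPartialHomeomorph.symm_source, modelWithCornersSelf_coe, modelWithCornersSelf_coe_symm,
      Function.comp_def, id_eq, preimage_id_eq, range_id, inter_univ] at this
    exact this
  have hopen := (chartAt (Cd d) x).isOpen_inter_preimage_symm (chartAt (Cd d) x').open_source
  have h2 : ∀ z, z ∈ (chartAt (Cd d) x).target ∧
      (chartAt (Cd d) x).symm z ∈ (chartAt (Cd d) x').source →
      ContDiffAt ℂ ω (chartMap x x') z := fun z hz => h1.contDiffAt (hopen.mem_nhds hz)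
  refine ⟨((h2 y ⟨hy, hy'⟩).restrict_scalars ℝ).of_le le_top, ?_⟩
  filter_upwards [eventually_chart hy hy'] with z hz v
  have hd : DifferentiableAt ℂ (chartMap x x') z := (h2 z hz).differentiableAt (by simp)
  rw [hd.fderiv_restrictScalars ℝ]
  exact (fderiv ℂ (chartMap x x') z).map_smul Complex.I v

/-- The tangent space at a point is identified with `ℂ^d` by the preferred chart of that point, so
the differential of an inverse chart is that of a change to this chart. -/
theorem mfderiv_chart_symm (hy : y ∈ (chartAt (Cd d) x).target) :
    mfderiv 𝓘(ℝ, Cd d) 𝓘(ℝ, Cd d) (chartAt (Cd d) x).symm y =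
      fderiv ℝ (chartMap x ((chartAt (Cd d) x).symm y)) y := by
  have h : MDifferentiableAt 𝓘(ℝ, Cd d) 𝓘(ℝ, Cd d) (chartAt (Cd d) x).symm y :=
    mdifferentiableAt_atlas_symm (chart_mem_atlas (Cd d) x) hy
  rw [h.mfderiv]
  simp only [writtenInExtChartAt, extChartAt, mfld_simps, fderivWithin_univ]
  rfl

theorem mfderiv_chart_symm_comp (hy : y ∈ (chartAt (Cd d) x).target)
    (hy' : (chartAt (Cd d) x).symm y ∈ (chartAt (Cd d) x').source) (v : Cd d) :
    fderiv ℝ (chartMap x' ((chartAt (Cd d) x').symm (chartMap x x' y))) (chartMap x x' y)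
      (fderiv ℝ (chartMap x x') y v) =
    fderiv ℝ (chartMap x ((chartAt (Cd d) x).symm y)) y v := by
  rw [symm_chartMap hy']
  have h1 := (holomorphicNear_chartMap hy hy').differentiableAt
  have h2 : DifferentiableAt ℝ (chartMap x' ((chartAt (Cd d) x).symm y)) (chartMap x x' y) :=
    (holomorphicNear_chartMap (chartMap_mem_target hy') (by
      rw [symm_chartMap hy']; exact mem_chart_source _ _)).differentiableAt
  have h3 : chartMap x ((chartAt (Cd d) x).symm y) =ᶠ[𝓝 y]
      chartMap x' ((chartAt (Cd d) x).symm y) ∘ chartMap x x' := by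
    filter_upwards [eventually_chart hy hy'] with z hz
    exact (chartMap_chartMap hz.2).symm
  rw [h3.fderiv_eq, fderiv_comp _ h2 h1]
  rfl

theorem inChart_eq (η : PForm d p X) (hy : y ∈ (chartAt (Cd d) x).target) :
    inChart η x y = (η ((chartAt (Cd d) x).symm y)).compContinuousLinearMap
      (fderiv ℝ (chartMap x ((chartAt (Cd d) x).symm y)) y) := by
  rw [inChart, mfderiv_chart_symm hy]
  rfl

theorem inChart_eq_pullback (η : PForm d p X) (hy : y ∈ (chartAt (Cd d) x).target)
    (hy' : (chartAt (Cd d) x).symm y ∈ (chartAt (Cd d) x').source) :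
    inChart η x y = flatPullback (chartMap x x') (inChart η x') y := by
  rw [inChart_eq η hy, flatPullback, inChart_eq η (chartMap_mem_target hy'), symm_chartMap hy']
  ext v
  simp only [ContinuousAlternatingMap.compContinuousLinearMap_apply]
  congr 1
  funext i
  have := mfderiv_chart_symm_comp hy hy' (v i)
  rw [symm_chartMap hy'] at this
  exact this.symm

end

variable [IsManifold 𝓘(ℂ, Cd d) ω X] {O : X → Set X}

/-- Local expressions of a form which are compatible with changes of charts. -/
structure IsFormFamily (O : X → Set X) (θ : X → Cd d → Cd d [⋀^Fin p]→L[ℝ] ℂ) : Prop where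
  smooth : ∀ x, ∀ y ∈ chartDom O x, ContDiffAt ℝ ∞ (θ x) y
  natural : ∀ x x' : X, ∀ y ∈ chartDom O x,
    (chartAt (Cd d) x).symm y ∈ (chartAt (Cd d) x').source → (chartAt (Cd d) x).symm y ∈ O x' →
    θ x y = flatPullback (chartMap x x') (θ x') y

/-- The form on the manifold with given local expressions. -/
def toPForm (θ : X → Cd d → Cd d [⋀^Fin p]→L[ℝ] ℂ) : PForm d p X :=
  fun x => θ x (chartAt (Cd d) x x)

namespace IsFormFamily

variable {θ : X → Cd d → Cd d [⋀^Fin p]→L[ℝ] ℂ} (hO : ∀ x, IsOpen (O x)) (hx : ∀ x, x ∈ O x)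
  (h : IsFormFamily O θ)
include hx h

/-- The value of `toPForm θ` at a point is read off in the chart of that point; compatibility with
the change to that chart returns the local expression. -/
theorem inChart_toPForm {x : X} {y : Cd d} (hy : y ∈ chartDom O x) :
    inChart (toPForm θ) x y = θ x y := by
  rw [inChart_eq _ hy.1, h.natural x _ y hy (mem_chart_source _ _) (hx _)]
  rfl

include hO

theorem inChart_toPForm_eventuallyEq {x : X} {y : Cd d} (hy : y ∈ chartDom O x) :
    inChart (toPForm θ) x =ᶠ[𝓝 y] θ x := by
  filter_upwards [(isOpen_chartDom hO x).mem_nhds hy] with z hz using h.inChart_toPForm hx hz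

/-- Smoothness is required on the whole chart target, whereas `θ x` is controlled only over `O x`.
Near each point one passes to the chart centred there, where `θ` is available. -/
theorem isSmoothForm : IsSmoothForm (toPForm θ) := by
  intro x y hy
  let x' := (chartAt (Cd d) x).symm y
  have hy' : (chartAt (Cd d) x).symm y ∈ (chartAt (Cd d) x').source := mem_chart_source _ x'
  have h1 : inChart (toPForm θ) x =ᶠ[𝓝 y]
      flatPullback (chartMap x x') (inChart (toPForm θ) x') := by
    filter_upwards [eventually_chart hy hy'] with z hz using inChart_eq_pullback _ hz.1 hz.2
  have hc := center_mem_chartDom (d := d) hx x'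
  have h2 : ContDiffAt ℝ ∞ (inChart (toPForm θ) x') (chartMap x x' y) :=
    (h.smooth x' _ hc).congr_of_eventuallyEq (h.inChart_toPForm_eventuallyEq hO hx hc)
  exact ((h2.flatPullback (holomorphicNear_chartMap hy hy').smooth).congr_of_eventuallyEq
    h1).contDiffWithinAt

theorem del_toPForm : del (toPForm θ) = toPForm fun x => flatDel (θ x) := by
  funext x
  exact (h.inChart_toPForm_eventuallyEq hO hx (center_mem_chartDom hx x)).flatDel_eq

theorem delBar_toPForm : delBar (toPForm θ) = toPForm fun x => flatDelBar (θ x) := by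
  funext x
  exact (h.inChart_toPForm_eventuallyEq hO hx (center_mem_chartDom hx x)).flatDelBar_eq

omit hx in
theorem natural_eventuallyEq {x x' : X} {y : Cd d} (hy : y ∈ chartDom O x)
    (hy' : (chartAt (Cd d) x).symm y ∈ (chartAt (Cd d) x').source)
    (hyO : (chartAt (Cd d) x).symm y ∈ O x') :
    θ x =ᶠ[𝓝 y] flatPullback (chartMap x x') (θ x') := by
  have h1 := (chartAt (Cd d) x).isOpen_inter_preimage_symm
    ((chartAt (Cd d) x').open_source.inter (hO x'))
  filter_upwards [(isOpen_chartDom hO x).mem_nhds hy, h1.mem_nhds ⟨hy.1, hy', hyO⟩] with z hz hz'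
  exact h.natural x x' z hz hz'.2.1 hz'.2.2

omit hx hO h [IsManifold 𝓘(ℂ, Cd d) ω X] in
theorem chartMap_mem_chartDom {x x' : X} {y : Cd d}
    (hy' : (chartAt (Cd d) x).symm y ∈ (chartAt (Cd d) x').source)
    (hyO : (chartAt (Cd d) x).symm y ∈ O x') : chartMap x x' y ∈ chartDom O x' :=
  ⟨chartMap_mem_target hy', by simpa only [mem_preimage, symm_chartMap hy'] using hyO⟩

omit hx in
theorem flatDel : IsFormFamily O fun x => flatDel (θ x) where
  smooth x y hy := (h.smooth x y hy).flatDel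
  natural x x' y hy hy' hyO := by
    rw [(h.natural_eventuallyEq hO hy hy' hyO).flatDel_eq]
    exact flatDel_pullback ((h.smooth x' _ (chartMap_mem_chartDom hy' hyO)).differentiableAt
      (by simp)) (holomorphicNear_chartMap hy.1 hy')

omit hx hO in
theorem const_smul (c : ℂ) : IsFormFamily O fun x y => c • θ x y where
  smooth x y hy := (h.smooth x y hy).const_smul c
  natural x x' y hy hy' hyO := by
    rw [h.natural x x' y hy hy' hyO]
    rfl

end IsFormFamily

omit [TopologicalSpace X] [ChartedSpace (Cd d) X] [IsManifold 𝓘(ℂ, Cd d) ω X] in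
theorem integral_clm_comp {M N : Type} [NormedAddCommGroup M] [NormedSpace ℝ M]
    [NormedAddCommGroup N] [NormedSpace ℝ N] [CompleteSpace M] [CompleteSpace N] (T : M →L[ℝ] N)
    {f : ℝ → M} (hf : IntervalIntegrable f MeasureTheory.volume 0 1) :
    ∫ t in (0 : ℝ)..1, T (f t) = T (∫ t in (0 : ℝ)..1, f t) :=
  T.intervalIntegral_comp_comm hf

/-- Pullback of constant forms. -/
def pullbackCLM (p : ℕ) (L : Cd d →L[ℝ] Cd d) :
    (Cd d [⋀^Fin p]→L[ℝ] ℂ) →L[ℝ] (Cd d [⋀^Fin p]→L[ℝ] ℂ) :=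
  ContinuousAlternatingMap.compContinuousLinearMapCLM L

omit [TopologicalSpace X] [ChartedSpace (Cd d) X] [IsManifold 𝓘(ℂ, Cd d) ω X] in
theorem integral_compContinuousLinearMap (L : Cd d →L[ℝ] Cd d) {f : ℝ → Cd d [⋀^Fin p]→L[ℝ] ℂ}
    (hf : IntervalIntegrable f MeasureTheory.volume 0 1) :
    ∫ t in (0 : ℝ)..1, (f t).compContinuousLinearMap L =
      (∫ t in (0 : ℝ)..1, f t).compContinuousLinearMap L :=
  integral_clm_comp (pullbackCLM p L) hf

theorem isFormFamily_integral (hO : ∀ x, IsOpen (O x))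
    {θ : X → ℝ × Cd d → Cd d [⋀^Fin p]→L[ℝ] ℂ}
    (hs : ∀ x, ∀ t, ∀ y ∈ chartDom O x, ContDiffAt ℝ ∞ (θ x) (t, y))
    (h : ∀ t, IsFormFamily O fun x y => θ x (t, y)) :
    IsFormFamily O fun x y => ∫ t in (0 : ℝ)..1, θ x (t, y) where
  smooth x y hy := contDiffAt_integral_slab (isOpen_chartDom hO x) (hs x) hy
  natural x x' y hy hy' hyO := by
    simp only [fun t => (h t).natural x x' y hy hy' hyO]
    have hi : IntervalIntegrable (fun t => θ x' (t, chartMap x x' y)) MeasureTheory.volume 0 1 :=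
      (continuous_slab_left (hs x')
        (IsFormFamily.chartMap_mem_chartDom hy' hyO)).intervalIntegrable _ _
    -- At a fixed point the pullback is a fixed continuous linear map of forms, so it commutes with
    -- the integral.
    exact integral_compContinuousLinearMap _ hi

end ManifoldForms

/-! ### Local frames -/

section Frames

variable {d n : ℕ} {X : Type*} [TopologicalSpace X] [ChartedSpace (Cd d) X]
  {V : X → Type*} [TopologicalSpace (TotalSpace (Fin n → ℂ) V)]
  [∀ x, AddCommGroup (V x)] [∀ x, Module ℂ (V x)] [∀ x, TopologicalSpace (V x)]
  [FiberBundle (Fin n → ℂ) V]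

section

variable [VectorBundle ℂ (Fin n → ℂ) V]
  (e e' : Trivialization (Fin n → ℂ) (TotalSpace.proj : TotalSpace (Fin n → ℂ) V → X))
  [MemTrivializationAtlas e] [MemTrivializationAtlas e']

/-- The components of a vector in the frame of a trivialization. -/
def components (x : X) : V x →ₗ[ℂ] (Fin n → ℂ) := e.linearMapAt ℂ x

variable {e e'} {x : X}

theorem components_apply (hx : x ∈ e.baseSet) (u : V x) : components e x u = (e ⟨x, u⟩).2 := by
  rw [components, e.coe_linearMapAt_of_mem hx]

theorem components_frame (hx : x ∈ e.baseSet) (j : Fin n) :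
    components e x (frame e j x) = Pi.single j 1 := by
  rw [components_apply hx, frame, e.apply_mk_symm hx]

theorem sum_components_smul_frame (hx : x ∈ e.baseSet) (u : V x) :
    ∑ i, components e x u i • frame e i x = u := by
  have h : Function.Injective (components e x) := fun u v huv => by
    rw [components_apply hx, components_apply hx] at huv
    have := congrArg (e.symm x) huv
    rwa [e.symm_apply_apply_mk hx, e.symm_apply_apply_mk hx] at this
  apply h
  rw [map_sum]
  simp only [map_smul, components_frame hx]
  funext i
  simp [Finset.sum_apply, Pi.single_apply]

variable (e e') in
/-- The matrix of the change of frames. -/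
def frameChange (x : X) : Mat n := Matrix.of fun i j => components e' x (frame e j x) i

theorem frame_eq_sum (hx' : x ∈ e'.baseSet) (j : Fin n) :
    frame e j x = ∑ i, frameChange e e' x i j • frame e' i x :=
  (sum_components_smul_frame hx' _).symm

theorem components_eq_mulVec (hx : x ∈ e.baseSet) (u : V x) :
    components e' x u = frameChange e e' x *ᵥ components e x u := by
  conv_lhs => rw [← sum_components_smul_frame hx u]
  rw [map_sum]
  funext i
  simp [frameChange, Matrix.mulVec, dotProduct, mul_comm]

theorem frameChange_mul (hx' : x ∈ e'.baseSet) (hx : x ∈ e.baseSet) :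
    frameChange e' e x * frameChange e e' x = 1 := by
  ext i j
  have h := congrFun (components_eq_mulVec (e := e') (e' := e) hx' (frame e j x)) i
  rw [components_frame hx] at h
  rw [Matrix.one_apply, ← Pi.single_apply]
  simpa [Matrix.mul_apply, Matrix.mulVec, dotProduct, frameChange] using h.symm

theorem isUnit_frameChange (hx : x ∈ e.baseSet) (hx' : x ∈ e'.baseSet) :
    IsUnit (frameChange e e' x) :=
  IsUnit.of_mul_eq_one _ (frameChange_mul hx hx')

end

section

variable [VectorBundle ℂ (Fin n → ℂ) V] [VectorBundle ℝ (Fin n → ℂ) V]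
  [IsManifold 𝓘(ℝ, Cd d) ∞ X] [ContMDiffVectorBundle ∞ (Fin n → ℂ) V 𝓘(ℝ, Cd d)]
  (e e' : Trivialization (Fin n → ℂ) (TotalSpace.proj : TotalSpace (Fin n → ℂ) V → X))
  [MemTrivializationAtlas e] [MemTrivializationAtlas e']

theorem contMDiffOn_frame (j : Fin n) :
    ContMDiffOn 𝓘(ℝ, Cd d) (𝓘(ℝ, Cd d).prod 𝓘(ℝ, Fin n → ℂ)) ∞
      (fun y => TotalSpace.mk' (Fin n → ℂ) y (frame e j y)) e.baseSet := by
  refine (e.contMDiffOn_section_iff e.open_baseSet subset_rfl).2 ?_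
  refine contMDiffOn_const (c := (Pi.single j 1 : Fin n → ℂ)) |>.congr fun y hy => ?_
  rw [frame, e.apply_mk_symm hy]

theorem contMDiffOn_frameChange (i j : Fin n) :
    ContMDiffOn 𝓘(ℝ, Cd d) 𝓘(ℝ, ℂ) ∞ (fun x => frameChange e e' x i j)
      (e.baseSet ∩ e'.baseSet) := by
  have h1 := (contMDiffOn_frame (d := d) e j).mono (inter_subset_left (t := e'.baseSet))
  rw [e'.contMDiffOn_section_iff (e.open_baseSet.inter e'.open_baseSet) inter_subset_right] at h1
  refine ((contMDiffOn_pi_space.1 h1) i).congr fun x hx => ?_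
  rw [frameChange, Matrix.of_apply, components_apply hx.2]

end

/-- Differentiability of a section at a point. -/
abbrev SectionMDiffAt (d n : ℕ) {X : Type*} [TopologicalSpace X] [ChartedSpace (Cd d) X]
    {V : X → Type*} [TopologicalSpace (TotalSpace (Fin n → ℂ) V)]
    [∀ x, TopologicalSpace (V x)] [FiberBundle (Fin n → ℂ) V] (σ : ∀ x, V x) (x : X) : Prop :=
  MDifferentiableAt 𝓘(ℝ, Cd d) (𝓘(ℝ, Cd d).prod 𝓘(ℝ, Fin n → ℂ))
    (fun y => TotalSpace.mk' (Fin n → ℂ) y (σ y)) x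

section

variable [VectorBundle ℂ (Fin n → ℂ) V] [VectorBundle ℝ (Fin n → ℂ) V]
  [IsManifold 𝓘(ℝ, Cd d) ∞ X] [ContMDiffVectorBundle ∞ (Fin n → ℂ) V 𝓘(ℝ, Cd d)]
  {e e' : Trivialization (Fin n → ℂ) (TotalSpace.proj : TotalSpace (Fin n → ℂ) V → X)}
  [MemTrivializationAtlas e] [MemTrivializationAtlas e'] {x : X}

theorem sectionMDiffAt_frame (hx : x ∈ e.baseSet) (j : Fin n) :
    SectionMDiffAt d n (frame e j) x :=
  ((contMDiffOn_frame e j).contMDiffAt (e.open_baseSet.mem_nhds hx)).mdifferentiableAt (by simp)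

theorem sectionMDiffAt_sum_frame (hx : x ∈ e.baseSet) {f : Fin n → X → ℂ}
    (hf : ∀ i, ContMDiffAt 𝓘(ℝ, Cd d) 𝓘(ℝ, ℂ) ∞ (f i) x) (t : Finset (Fin n)) :
    SectionMDiffAt d n (fun y => ∑ i ∈ t, f i y • frame e i y) x := by
  refine ((e.contMDiffAt_section_iff (n := ∞) (IB := 𝓘(ℝ, Cd d)) hx).2 ?_).mdifferentiableAt (by simp)
  have h1 : (fun y => (e ⟨y, ∑ i ∈ t, f i y • frame e i y⟩).2) =ᶠ[𝓝 x]
      fun y k => if k ∈ t then f k y else 0 := by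
    filter_upwards [e.open_baseSet.mem_nhds hx] with y hy
    rw [← components_apply hy, map_sum]
    funext k
    simp [components_frame hy, Pi.single_apply, Finset.sum_apply]
  refine ContMDiffAt.congr_of_eventuallyEq ?_ h1
  rw [contMDiffAt_pi_space]
  intro k
  by_cases hk : k ∈ t
  · simpa [hk] using hf k
  · simpa [hk] using contMDiffAt_const

end

/-! ### Operators satisfying the `∂̄`-Leibniz rule -/

section Operator

variable [VectorBundle ℝ (Fin n → ℂ) V] [∀ x, IsTopologicalAddGroup (V x)]
  [∀ x, ContinuousSMul ℝ (V x)] [IsManifold 𝓘(ℝ, Cd d) ∞ X]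
  (D : HiggsOperator d n V) {x : X}

theorem part01_zero : part01 (0 : Cd d →L[ℝ] ℂ) = 0 := by
  simp [part01]

theorem delBarFun_of_eventually_const {f : X → ℂ} {c : ℂ} (h : ∀ᶠ y in 𝓝 x, f y = c) :
    delBarFun (d := d) f x = 0 := by
  have h1 : f =ᶠ[𝓝 x] fun _ => c := h
  have h2 : mfderiv 𝓘(ℝ, Cd d) 𝓘(ℝ, ℂ) f x = 0 := by
    rw [h1.mfderiv_eq]
    exact mfderiv_const
  rw [delBarFun, h2]
  exact part01_zero

namespace HiggsOperator

variable {D}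

/-- Locality from the Leibniz rule without bump functions: the indicator `f` of the set where `σ =
σ'` is `1` near the point, so multiplication by `f` does not change the value of the operator there,
while `f σ = f σ'` everywhere. -/
theorem congr_of_eventuallyEq {σ σ' : ∀ x, V x} (hσ : SectionMDiffAt d n σ x)
    (hσ' : SectionMDiffAt d n σ' x) (h : ∀ᶠ y in 𝓝 x, σ y = σ' y) :
    D.toFun σ x = D.toFun σ' x := by
  classical
  let f : X → ℂ := fun y => if σ y = σ' y then 1 else 0
  have hf : ∀ᶠ y in 𝓝 x, f y = 1 := by
    filter_upwards [h] with y hy using if_pos hy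
  have hfd : MDifferentiableAt 𝓘(ℝ, Cd d) 𝓘(ℝ, ℂ) f x :=
    (mdifferentiableAt_const (c := (1 : ℂ))).congr_of_eventuallyEq hf
  have hfx : f x = 1 := hf.self_of_nhds
  have key : ∀ τ : ∀ x, V x, SectionMDiffAt d n τ x →
      D.toFun (fun y => f y • τ y) x = D.toFun τ x := by
    intro τ hτ
    ext v
    rw [D.leibniz f τ x hfd hτ v, delBarFun_of_eventually_const hf, hfx, one_smul]
    exact (congrArg (· + _) (zero_smul ℂ (τ x))).trans (zero_add _)
  rw [← key σ hσ, ← key σ' hσ']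
  congr 1
  funext y
  by_cases hy : σ y = σ' y
  · rw [hy]
  · simp [f, hy]

theorem map_zero (h0 : SectionMDiffAt d n (fun y => (0 : V y)) x) :
    D.toFun (fun _ => 0) x = 0 := by
  have h := D.leibniz (fun _ => 0) (fun _ => 0) x mdifferentiableAt_const h0
  ext v
  have := h v
  simpa using this

theorem map_sum {ι : Type*} (s : Finset ι) (f : ι → X → ℂ) (σ : ι → ∀ x, V x)
    (hf : ∀ i, MDifferentiableAt 𝓘(ℝ, Cd d) 𝓘(ℝ, ℂ) (f i) x)
    (hσ : ∀ i, SectionMDiffAt d n (σ i) x)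
    (hfσ : ∀ t : Finset ι, SectionMDiffAt d n (fun y => ∑ i ∈ t, f i y • σ i y) x) (v : Cd d) :
    D.toFun (fun y => ∑ i ∈ s, f i y • σ i y) x v =
      ∑ i ∈ s, (delBarFun (f i) x v • σ i x + f i x • D.toFun (σ i) x v) := by
  classical
  induction s using Finset.induction_on with
  | empty =>
    have h := map_zero (D := D) (hfσ ∅)
    simp only [Finset.sum_empty, h]
    rfl
  | insert i s hi ih =>
    simp only [Finset.sum_insert hi]
    have h1 : SectionMDiffAt d n (fun y => f i y • σ i y) x := by
      simpa using hfσ {i}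
    rw [D.add _ _ x h1 (hfσ s), ← ih, ← D.leibniz (f i) (σ i) x (hf i) (hσ i) v]
    rfl

end HiggsOperator

end Operator

end Frames

/-! ### Higgs operators in charts and frames -/

section HiggsCharts

attribute [local instance] Matrix.linftyOpNormedRing matNormedAlgebra
attribute [local instance] matTopology matRealModule

variable {d n : ℕ} {X : Type*} [TopologicalSpace X] [ChartedSpace (Cd d) X]

theorem cdir_apply {Z : Type*} [NormedAddCommGroup Z] [NormedSpace ℝ Z] {f : Z → Arr n} {z : Z}
    (hf : DifferentiableAt ℝ f z) (Y : Z × Z) (i j : Fin n) :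
    cdir f Y z i j = cdir (fun y => f y i j) Y z :=
  (cdir_continuousLinearMap_comp hf
    ((ContinuousLinearMap.proj (R := ℝ) (φ := fun _ : Fin n => ℂ) j).comp
      (ContinuousLinearMap.proj (R := ℝ) (φ := fun _ : Fin n => Fin n → ℂ) i))
    (fun _ => rfl) Y).symm

section

variable [IsManifold 𝓘(ℂ, Cd d) ω X] {x : X} {y : Cd d}

/-- The differential of the inverse chart is complex linear, so it preserves the type `(0,1)`. -/
theorem delBarFun_chart {f : X → ℂ} (hy : y ∈ (chartAt (Cd d) x).target)
    (hf : MDifferentiableAt 𝓘(ℝ, Cd d) 𝓘(ℝ, ℂ) f ((chartAt (Cd d) x).symm y)) (v : Cd d) :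
    delBarFun (d := d) f ((chartAt (Cd d) x).symm y)
        (fderiv ℝ (chartMap x ((chartAt (Cd d) x).symm y)) y v) =
      cdir (fun z => f ((chartAt (Cd d) x).symm z)) (vecDelBar v) y := by
  have h1 : MDifferentiableAt 𝓘(ℝ, Cd d) 𝓘(ℝ, Cd d) (chartAt (Cd d) x).symm y :=
    mdifferentiableAt_atlas_symm (chart_mem_atlas (Cd d) x) hy
  have h2 : ∀ v, fderiv ℝ (fun z => f ((chartAt (Cd d) x).symm z)) y v =
      mfderiv 𝓘(ℝ, Cd d) 𝓘(ℝ, ℂ) f ((chartAt (Cd d) x).symm y)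
        (fderiv ℝ (chartMap x ((chartAt (Cd d) x).symm y)) y v) := by
    intro v
    rw [← mfderiv_eq_fderiv]
    change mfderiv _ _ (f ∘ (chartAt (Cd d) x).symm) y v = _
    rw [mfderiv_comp y hf h1, mfderiv_chart_symm hy]
    rfl
  rw [← part01_fderiv]
  have h3 := (holomorphicNear_chartMap hy (mem_chart_source (Cd d) _)).comm_self v
  change (1 / 2 : ℂ) • ((_ : ℂ) + Complex.I • (_ : ℂ)) =
    (1 / 2 : ℂ) • ((_ : ℂ) + Complex.I • (_ : ℂ))
  congr 2
  · exact (h2 v).symm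
  · congr 1
    refine Eq.trans ?_ (h2 (mulI d v)).symm
    exact congrArg _ h3.symm

end

variable {V : X → Type*} [TopologicalSpace (TotalSpace (Fin n → ℂ) V)]
  [∀ x, AddCommGroup (V x)] [∀ x, Module ℂ (V x)] [∀ x, TopologicalSpace (V x)]
  [FiberBundle (Fin n → ℂ) V] [VectorBundle ℂ (Fin n → ℂ) V] [VectorBundle ℝ (Fin n → ℂ) V]

variable (n V) in
/-- The domain of the preferred trivialization around a point. -/
def frameDom (x : X) : Set X := (trivializationAt (Fin n → ℂ) V x).baseSet

theorem isOpen_frameDom (x : X) : IsOpen (frameDom n V x) :=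
  (trivializationAt (Fin n → ℂ) V x).open_baseSet

theorem mem_frameDom (x : X) : x ∈ frameDom n V x := mem_baseSet_trivializationAt _ _ _

section

variable [IsManifold 𝓘(ℂ, Cd d) ω X] {x x' p : X} {y : Cd d}
  {N : (∀ x, V x) → ∀ x, TangentSpace 𝓘(ℝ, Cd d) x →L[ℝ] V x}

theorem inFrame_apply {β : ∀ x, TangentSpace 𝓘(ℝ, Cd d) x →L[ℝ] V x}
    (hy : y ∈ chartDom (frameDom n V) x) (hp : (chartAt (Cd d) x).symm y = p) (v : Cd d) :
    inFrame (n := n) β x y v = components (trivializationAt (Fin n → ℂ) V x) p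
      (β p (fderiv ℝ (chartMap x p) y v)) := by
  subst hp
  rw [inFrame, mfderiv_chart_symm hy.1, components_apply hy.2]
  simp only [ContinuousLinearMap.comp_apply]
  rw [Trivialization.continuousLinearMapAt_apply, Trivialization.coe_linearMapAt_of_mem _ hy.2]
  rfl

theorem of_connForm (hy : y ∈ chartDom (frameDom n V) x) (hp : (chartAt (Cd d) x).symm y = p)
    (v : Cd d) (i j : Fin n) : connForm N x y v i j =
      components (trivializationAt (Fin n → ℂ) V x) p
        (N (frame (trivializationAt (Fin n → ℂ) V x) j) p (fderiv ℝ (chartMap x p) y v)) i := by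
  rw [← inFrame_apply hy hp]
  rfl

end


section

variable [IsManifold 𝓘(ℂ, Cd d) ω X] [ContMDiffVectorBundle ∞ (Fin n → ℂ) V 𝓘(ℝ, Cd d)]

/-- The change of the preferred frames, in a chart. -/
def chartGauge (n : ℕ) {X : Type*} [TopologicalSpace X] [ChartedSpace (Cd d) X]
    (V : X → Type*) [TopologicalSpace (TotalSpace (Fin n → ℂ) V)]
    [∀ x, AddCommGroup (V x)] [∀ x, Module ℂ (V x)] [∀ x, TopologicalSpace (V x)]
    [FiberBundle (Fin n → ℂ) V] [VectorBundle ℂ (Fin n → ℂ) V] (x x' : X) (y : Cd d) : Mat n :=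
  frameChange (trivializationAt (Fin n → ℂ) V x) (trivializationAt (Fin n → ℂ) V x')
    ((chartAt (Cd d) x).symm y)

variable {x x' : X} {y : Cd d}

theorem contDiffAt_comp_chart_symm {M : Type*} [NormedAddCommGroup M] [NormedSpace ℝ M]
    {f : X → M} (hy : y ∈ (chartAt (Cd d) x).target)
    (hf : ContMDiffAt 𝓘(ℝ, Cd d) 𝓘(ℝ, M) ∞ f ((chartAt (Cd d) x).symm y)) :
    ContDiffAt ℝ ∞ (fun z => f ((chartAt (Cd d) x).symm z)) y := by
  have h := (contMDiffOn_chart_symm (I := 𝓘(ℝ, Cd d)) (n := ∞) (x := x)).contMDiffAt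
    ((chartAt (Cd d) x).open_target.mem_nhds hy)
  exact contMDiffAt_iff_contDiffAt.1 (hf.comp y h)

theorem contMDiffAt_frameChange (hy : y ∈ chartDom (frameDom n V) x)
    (hy' : (chartAt (Cd d) x).symm y ∈ frameDom n V x') (i j : Fin n) :
    ContMDiffAt 𝓘(ℝ, Cd d) 𝓘(ℝ, ℂ) ∞ (fun p => frameChange (trivializationAt (Fin n → ℂ) V x)
      (trivializationAt (Fin n → ℂ) V x') p i j) ((chartAt (Cd d) x).symm y) :=
  (contMDiffOn_frameChange _ _ i j).contMDiffAt
    (((isOpen_frameDom x).inter (isOpen_frameDom x')).mem_nhds ⟨hy.2, hy'⟩)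

theorem contDiffAt_chartGauge_arr (hy : y ∈ chartDom (frameDom n V) x)
    (hy' : (chartAt (Cd d) x).symm y ∈ frameDom n V x') :
    ContDiffAt ℝ ∞ (fun z => Matrix.of.symm (chartGauge n V x x' z)) y := by
  refine contDiffAt_pi.2 fun i => contDiffAt_pi.2 fun j => ?_
  exact contDiffAt_comp_chart_symm hy.1 (contMDiffAt_frameChange hy hy' i j)

theorem contDiffAt_chartGauge (hy : y ∈ chartDom (frameDom n V) x)
    (hy' : (chartAt (Cd d) x).symm y ∈ frameDom n V x') :
    ContDiffAt ℝ ∞ (chartGauge n V x x') y :=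
  (contDiffAt_chartGauge_arr hy hy').of

theorem isUnit_chartGauge (hy : y ∈ chartDom (frameDom n V) x)
    (hy' : (chartAt (Cd d) x).symm y ∈ frameDom n V x') : IsUnit (chartGauge n V x x' y) :=
  isUnit_frameChange hy.2 hy'

theorem cdir_chartGauge_apply (hy : y ∈ chartDom (frameDom n V) x)
    (hy' : (chartAt (Cd d) x).symm y ∈ frameDom n V x') (v : Cd d) (i j : Fin n) :
    cdir (chartGauge n V x x') (vecDelBar v) y i j =
      delBarFun (d := d) (fun p => frameChange (trivializationAt (Fin n → ℂ) V x)
        (trivializationAt (Fin n → ℂ) V x') p i j) ((chartAt (Cd d) x).symm y)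
        (fderiv ℝ (chartMap x ((chartAt (Cd d) x).symm y)) y v) := by
  have h := (contDiffAt_chartGauge_arr hy hy').differentiableAt (by simp)
  rw [delBarFun_chart hy.1 ((contMDiffAt_frameChange hy hy' i j).mdifferentiableAt (by simp))]
  have h1 := cdir_of h (vecDelBar v)
  rw [show (fun z => Matrix.of (Matrix.of.symm (chartGauge n V x x' z))) = chartGauge n V x x'
    from rfl] at h1
  rw [h1, Matrix.of_apply, cdir_apply h]
  rfl

variable [∀ x, IsTopologicalAddGroup (V x)] [∀ x, ContinuousSMul ℝ (V x)]
  (D : HiggsOperator d n V)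

/-- Write `e_j = ∑_l g_lj e'_l` near the point and apply the Leibniz rule; locality makes the
expansion of the frame legitimate although it holds only on the overlap. -/
theorem chartGauge_mul_connForm (hy : y ∈ chartDom (frameDom n V) x)
    (hs : (chartAt (Cd d) x).symm y ∈ (chartAt (Cd d) x').source)
    (hy' : (chartAt (Cd d) x).symm y ∈ frameDom n V x') (v : Cd d) :
    chartGauge n V x x' y * Matrix.of (connForm (n := n) D.toFun x y v) =
      Matrix.of (connForm (n := n) D.toFun x' (chartMap x x' y) (fderiv ℝ (chartMap x x') y v)) *
        chartGauge n V x x' y + cdir (chartGauge n V x x') (vecDelBar v) y := by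
  ext i j
  set p := (chartAt (Cd d) x).symm y with hp
  set e := trivializationAt (Fin n → ℂ) V x
  set e' := trivializationAt (Fin n → ℂ) V x'
  set w : Cd d := fderiv ℝ (chartMap x p) y v with hw
  have hp' : (chartAt (Cd d) x').symm (chartMap x x' y) = p := symm_chartMap hs
  have hw' : fderiv ℝ (chartMap x' p) (chartMap x x' y) (fderiv ℝ (chartMap x x') y v) = w := by
    have := mfderiv_chart_symm_comp hy.1 hs v
    rwa [hp'] at this
  have hyc : chartMap x x' y ∈ chartDom (frameDom n V) x' :=
    IsFormFamily.chartMap_mem_chartDom hs hy'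
  have hf : ∀ l, ContMDiffAt 𝓘(ℝ, Cd d) 𝓘(ℝ, ℂ) ∞ (fun p => frameChange e e' p l j) p :=
    fun l => contMDiffAt_frameChange hy hy' l j
  have hN : D.toFun (frame e j) p w = ∑ l, (delBarFun (d := d)
      (fun p => frameChange e e' p l j) p w • frame e' l p
        + frameChange e e' p l j • D.toFun (frame e' l) p w) := by
    rw [← HiggsOperator.map_sum Finset.univ (fun l p => frameChange e e' p l j) (frame e')
      (fun l => (hf l).mdifferentiableAt (by simp)) (fun l => sectionMDiffAt_frame hy' l)
      (fun t => sectionMDiffAt_sum_frame hy' hf t),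
      HiggsOperator.congr_of_eventuallyEq (sectionMDiffAt_frame hy.2 j)
        (sectionMDiffAt_sum_frame hy' hf Finset.univ)]
    filter_upwards [(isOpen_frameDom (n := n) (V := V) x').mem_nhds hy'] with q hq
      using frame_eq_sum hq j
  have h1 : (chartGauge n V x x' y * Matrix.of (connForm (n := n) D.toFun x y v) : Mat n) i j =
      components e' p (D.toFun (frame e j) p w) i := by
    rw [components_eq_mulVec (e := e) hy.2]
    simp only [Matrix.mul_apply, Matrix.mulVec, dotProduct, Matrix.of_apply, of_connForm hy rfl]
    rfl
  rw [h1, hN, map_sum, Finset.sum_apply, Matrix.add_apply, Matrix.mul_apply,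
    cdir_chartGauge_apply hy hy']
  simp only [map_add, map_smul, components_frame (e := e') hy', Pi.add_apply, Pi.smul_apply,
    Finset.sum_add_distrib, Matrix.of_apply, of_connForm hyc hp', hw', Pi.single_apply,
    smul_eq_mul, mul_ite, mul_one, mul_zero, Finset.sum_ite_eq, Finset.mem_univ, if_true]
  rw [add_comm]
  congr 1
  exact Finset.sum_congr rfl fun l _ => mul_comm _ _

theorem contDiffAt_inFrame {β : ∀ x, TangentSpace 𝓘(ℝ, Cd d) x →L[ℝ] V x}
    (hβ : ContMDiffOn 𝓘(ℝ, Cd d) (𝓘(ℝ, Cd d).prod 𝓘(ℝ, Cd d →L[ℝ] (Fin n → ℂ))) ∞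
      (fun y => TotalSpace.mk' (Cd d →L[ℝ] (Fin n → ℂ))
        (E := fun y => TangentSpace 𝓘(ℝ, Cd d) y →L[ℝ] V y) y (β y)) (frameDom n V x))
    (hy : y ∈ chartDom (frameDom n V) x) : ContDiffAt ℝ ∞ (inFrame (n := n) β x) y := by
  have : IsManifold 𝓘(ℝ, Cd d) (∞ + 1) X := isManifold_real X
  let e₁ := trivializationAt (Cd d) (TangentSpace 𝓘(ℝ, Cd d) : X → Type _) x
  let e₂ := trivializationAt (Fin n → ℂ) V x
  -- A `V`-valued `1`-form is a section of a bundle of homomorphisms. In the trivialization induced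
  -- by the chart and the frame its components are those of `inFrame`.
  let e := e₁.continuousLinearMap (RingHom.id ℝ) e₂
  have hs : (chartAt (Cd d) x).symm y ∈ (chartAt (Cd d) x).source :=
    (chartAt (Cd d) x).map_target hy.1
  have hb : (chartAt (Cd d) x).symm y ∈ e.baseSet := ⟨hs, hy.2⟩
  have h1 := hβ.contMDiffAt ((isOpen_frameDom x).mem_nhds hy.2)
  have h2 := (e.contMDiffAt_section_iff (n := ∞) (IB := 𝓘(ℝ, Cd d)) hb).1 h1
  refine (contDiffAt_comp_chart_symm hy.1 h2).congr_of_eventuallyEq ?_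
  filter_upwards [(chartAt (Cd d) x).open_target.mem_nhds hy.1] with z hz
  have hz' : (chartAt (Cd d) x).symm z ∈ (chartAt (Cd d) x).source :=
    (chartAt (Cd d) x).map_target hz
  have h3 := TangentBundle.symmL_trivializationAt (I := 𝓘(ℝ, Cd d)) (𝕜 := ℝ) hz'
  simp only [e, Trivialization.continuousLinearMap_apply, e₁, h3]
  simp only [extChartAt, mfld_simps, mfderivWithin_univ]
  let L (z' : Cd d) : Cd d →L[ℝ] Cd d :=
    mfderiv 𝓘(ℝ, Cd d) 𝓘(ℝ, Cd d) (chartAt (Cd d) x).symm z'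
  have h4 : L (chartAt (Cd d) x ((chartAt (Cd d) x).symm z)) = L z := by
    rw [(chartAt (Cd d) x).right_inv hz]
  change inFrame β x z = (e₂.continuousLinearMapAt ℝ ((chartAt (Cd d) x).symm z)).comp
    ((β ((chartAt (Cd d) x).symm z)).comp (L (chartAt (Cd d) x ((chartAt (Cd d) x).symm z))))
  rw [h4]
  rfl

theorem contDiffAt_connForm (hy : y ∈ chartDom (frameDom n V) x) :
    ContDiffAt ℝ ∞ (connForm (n := n) D.toFun x) y := by
  have h : ∀ j, ∀ z ∈ chartDom (frameDom n V) x, ContDiffAt ℝ ∞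
      (inFrame (n := n) (D.toFun (frame (trivializationAt (Fin n → ℂ) V x) j)) x) z :=
    fun j z hz => contDiffAt_inFrame (D.smooth _ _ (isOpen_frameDom x) (contMDiffOn_frame _ j)) hz
  refine ContDiffOn.contDiffAt ?_ ((isOpen_chartDom (isOpen_frameDom (n := n) (V := V)) x).mem_nhds hy)
  refine contDiffOn_clm_apply.2 fun v => contDiffOn_pi.2 fun i => contDiffOn_pi.2 fun j z hz => ?_
  exact (contDiffAt_pi.1 ((h j z hz).clm_apply contDiffAt_const) i).contDiffWithinAt

/-- Apply `(∇'')² = 0` to the frame section `e_j`: its components are the `j`-th column of the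
curvature. This is available only at the centre of the chart. -/
theorem curvDir_connForm_center (x : X) (v w : Cd d) :
    curvDir (vecDelBar v) (vecDelBar w) (fun z => Matrix.of (connForm (n := n) D.toFun x z v))
      (fun z => Matrix.of (connForm (n := n) D.toFun x z w)) (chartAt (Cd d) x x) = 0 := by
  have hy := center_mem_chartDom (d := d) (mem_frameDom (n := n) (V := V)) x
  set y := chartAt (Cd d) x x
  have dA : ∀ v, DifferentiableAt ℝ (fun z => connForm (n := n) D.toFun x z v) y := fun v =>
    ((contDiffAt_connForm D hy).differentiableAt (by simp)).clm_apply (differentiableAt_const v)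
  ext i j
  have h := congrFun (D.sq_zero _ _ (isOpen_frameDom x)
    (contMDiffOn_frame (trivializationAt (Fin n → ℂ) V x) j) x (mem_frameDom x) v w) i
  have dB := (contDiffAt_inFrame (D.smooth _ _ (isOpen_frameDom (n := n) (V := V) x)
    (contMDiffOn_frame _ j)) hy).differentiableAt (by simp)
  have e : ∀ v w, part01 (fderiv ℝ (inFrame (n := n)
      (D.toFun (frame (trivializationAt (Fin n → ℂ) V x) j)) x) y) v w i =
      cdir (fun z => Matrix.of (connForm (n := n) D.toFun x z w)) (vecDelBar v) y i j := by
    intro v w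
    rw [cdir_of (dA w), Matrix.of_apply, cdir_apply (dA w), part01_fderiv]
    exact (cdir_continuousLinearMap_comp dB
      ((ContinuousLinearMap.proj (R := ℝ) (φ := fun _ : Fin n => ℂ) i).comp
        (ContinuousLinearMap.apply ℝ (Fin n → ℂ) w)) (fun _ => rfl) _).symm
  simp only [flatExtend, Pi.add_apply, Pi.sub_apply, Pi.zero_apply] at h
  rw [e, e] at h
  rw [curvDir]
  exact h

/-- Every point is the centre of its own chart, and vanishing of the curvature is carried to the
given chart and frame by gauge covariance and pullback. -/
theorem curvDir_connForm (hy : y ∈ chartDom (frameDom n V) x) (v w : Cd d) :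
    curvDir (vecDelBar v) (vecDelBar w) (fun z => Matrix.of (connForm (n := n) D.toFun x z v))
      (fun z => Matrix.of (connForm (n := n) D.toFun x z w)) y = 0 := by
  set p := (chartAt (Cd d) x).symm y with hp
  have hs : p ∈ (chartAt (Cd d) p).source := mem_chart_source _ _
  have hy' : p ∈ frameDom n V p := mem_frameDom p
  have hol := holomorphicNear_chartMap hy.1 hs
  have hA := contDiffAt_connForm D hy
  have hA' := contDiffAt_connForm D (IsFormFamily.chartMap_mem_chartDom hs hy')
  have ev : ∀ᶠ z in 𝓝 y, z ∈ chartDom (frameDom n V) x ∧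
      (chartAt (Cd d) x).symm z ∈ (chartAt (Cd d) p).source ∩ frameDom n V p := by
    filter_upwards [(isOpen_chartDom (isOpen_frameDom (n := n) (V := V)) x).mem_nhds hy,
      ((chartAt (Cd d) x).isOpen_inter_preimage_symm ((chartAt (Cd d) p).open_source.inter
        (isOpen_frameDom (n := n) (V := V) p))).mem_nhds ⟨hy.1, hs, hy'⟩] with z h1 h2
      using ⟨h1, h2.2⟩
  have h := curvDir_gauge (g := chartGauge n V x p) (z := y) (X := vecDelBar v) (Y := vecDelBar w)
    (hA.clm_apply contDiffAt_const).of (hA.clm_apply contDiffAt_const).of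
    (contDiffAt_pullback_coeff hA' hol.smooth v).of
    (contDiffAt_pullback_coeff hA' hol.smooth w).of (contDiffAt_chartGauge hy hy')
    (by filter_upwards [ev] with z hz using chartGauge_mul_connForm D hz.1 hz.2.1 hz.2.2 v)
    (by filter_upwards [ev] with z hz using chartGauge_mul_connForm D hz.1 hz.2.1 hz.2.2 w)
  rw [← mixVec_half, ← mixVec_half, curvDir_pullback hA' hol] at h
  simp only [mixVec_half, show chartMap x p y = chartAt (Cd d) p p from rfl,
    curvDir_connForm_center D p, zero_mul] at h
  exact (isUnit_chartGauge hy hy').mul_left_cancel (h.trans (mul_zero _).symm)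

end

end HiggsCharts

/-! ### Metrics in charts and frames -/

section Metrics

attribute [local instance] Matrix.linftyOpNormedRing matNormedAlgebra
attribute [local instance] matTopology matRealModule

variable {d n m : ℕ} {X : Type*} [TopologicalSpace X] [ChartedSpace (Cd d) X]
  {V : X → Type*} [TopologicalSpace (TotalSpace (Fin n → ℂ) V)]
  [∀ x, AddCommGroup (V x)] [∀ x, Module ℂ (V x)] [∀ x, TopologicalSpace (V x)]
  [FiberBundle (Fin n → ℂ) V] [VectorBundle ℂ (Fin n → ℂ) V] [VectorBundle ℝ (Fin n → ℂ) V]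
  {x x' : X} {y : Cd d}

theorem HermitianMetric.apply_sum (H : HermitianMetric d n V) (p : X) {ι : Type*} (s : Finset ι)
    (a b : ι → ℂ) (e e' : ι → V p) : H.toFun p (∑ k ∈ s, a k • e k) (∑ l ∈ s, b l • e' l) =
      ∑ k ∈ s, ∑ l ∈ s, a k * (conj (b l) * H.toFun p (e k) (e' l)) := by
  simp only [map_sum, map_smul, LinearMap.map_smulₛₗ, LinearMap.sum_apply, LinearMap.smul_apply,
    smul_eq_mul, Finset.mul_sum]
  rw [Finset.sum_comm]
  exact Finset.sum_congr rfl fun k _ => Finset.sum_congr rfl fun l _ => mul_left_comm _ _ _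

theorem gram_apply (H : HermitianMetric d n V) {p : X} (hp : (chartAt (Cd d) x).symm y = p)
    (i j : Fin n) : gram H x y j i = H.toFun p (frame (trivializationAt (Fin n → ℂ) V x) i p)
      (frame (trivializationAt (Fin n → ℂ) V x) j p) := by
  subst hp
  rfl

theorem of_gram_eq (H : HermitianMetric d n V) (hp : (chartAt (Cd d) x).symm y ∈ frameDom n V x')
    (hq : (chartAt (Cd d) x').symm (chartMap x x' y) = (chartAt (Cd d) x).symm y) :
    Matrix.of (gram H x y) = (chartGauge n V x x' y)ᴴ * Matrix.of (gram H x' (chartMap x x' y)) *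
      chartGauge n V x x' y := by
  ext j i
  simp only [Matrix.mul_apply, Matrix.of_apply, gram_apply H hq, gram_apply H rfl,
    Finset.sum_mul, Matrix.conjTranspose_apply]
  rw [frame_eq_sum (e' := trivializationAt (Fin n → ℂ) V x') hp i,
    frame_eq_sum (e' := trivializationAt (Fin n → ℂ) V x') hp j, H.apply_sum]
  refine Finset.sum_congr rfl fun k _ => Finset.sum_congr rfl fun l _ => ?_
  change frameChange _ _ _ k i * (conj (frameChange _ _ _ l j) * _) =
    conj (frameChange _ _ _ l j) * _ * frameChange _ _ _ k i
  ring

/-- A vector in the kernel gives the coefficients of a vector of norm zero, which vanishes by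
positivity; the frame is linearly independent. -/
theorem isUnit_of_gram (H : HermitianMetric d n V) (hy : y ∈ chartDom (frameDom n V) x) :
    IsUnit (Matrix.of (gram H x y)) := by
  rw [← Matrix.mulVec_injective_iff_isUnit]
  refine (injective_iff_map_eq_zero (Matrix.mulVecLin (Matrix.of (gram H x y)))).2 fun u hu => ?_
  set p := (chartAt (Cd d) x).symm y with hp
  set e := trivializationAt (Fin n → ℂ) V x
  have h0 : H.toFun p (∑ i, u i • frame e i p) (∑ i, u i • frame e i p) = 0 := by
    rw [H.apply_sum, Finset.sum_comm]
    refine Finset.sum_eq_zero fun l _ => ?_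
    have := congrArg (conj (u l) * ·) (congrFun hu l)
    simp only [Matrix.mulVecLin_apply, Matrix.mulVec, dotProduct, Finset.mul_sum, Pi.zero_apply,
      mul_zero] at this
    rw [← this]
    refine Finset.sum_congr rfl fun k _ => ?_
    change u k * (conj (u l) * _) = conj (u l) * (H.toFun p (frame e k p) (frame e l p) * u k)
    ring
  have h1 : ∑ i, u i • frame e i p = 0 := by
    by_contra h
    have := H.pos p _ h
    rw [h0] at this
    simp at this
  have h2 := congrArg (components e p) h1
  simp only [map_sum, map_smul, _root_.map_zero, components_frame (e := e) (x := p) hy.2] at h2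
  funext i
  have h3 := congrFun h2 i
  simpa [Finset.sum_apply, Pi.single_apply] using h3

variable [IsManifold 𝓘(ℂ, Cd d) ω X]

theorem contDiffAt_gram (H : HermitianMetric d n V) (hy : y ∈ chartDom (frameDom n V) x) :
    ContDiffAt ℝ ∞ (gram H x) y :=
  contDiffAt_pi.2 fun j => contDiffAt_pi.2 fun i => contDiffAt_comp_chart_symm hy.1
    ((H.smooth (trivializationAt (Fin n → ℂ) V x) i j).contMDiffAt
      ((isOpen_frameDom x).mem_nhds hy.2))

variable {W : Type*} [NormedAddCommGroup W] [NormedSpace ℝ W]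

/-- Smooth dependence of a family of metrics on a parameter. -/
def IsSmoothFamily (H : W → HermitianMetric d n V) : Prop :=
  ∀ (x : X) (w : W), ∀ y ∈ chartDom (frameDom n V) x,
    ContDiffAt ℝ ∞ (fun z : W × Cd d => gram (H z.1) x z.2) (w, y)

theorem isSmoothFamily_const (H : HermitianMetric d n V) : IsSmoothFamily fun _ : W => H :=
  fun _ w _ hy => (contDiffAt_gram H hy).comp (w, _) contDiffAt_snd

variable {H : W → HermitianMetric d n V}

theorem IsSmoothFamily.comp {W' : Type*} [NormedAddCommGroup W'] [NormedSpace ℝ W']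
    (hH : IsSmoothFamily H) {ι : W' → W} (hι : ContDiff ℝ ∞ ι) :
    IsSmoothFamily fun w => H (ι w) := fun x w y hy =>
  ContDiffAt.comp (g := fun z : W × Cd d => gram (H z.1) x z.2)
    (f := fun z : W' × Cd d => (ι z.1, z.2)) (w, y) (hH x (ι w) y hy)
    ((hι.contDiffAt.comp (w, y) contDiffAt_fst).prodMk contDiffAt_snd)

variable [∀ x, IsTopologicalAddGroup (V x)] [∀ x, ContinuousSMul ℝ (V x)]
  [ContMDiffVectorBundle ∞ (Fin n → ℂ) V 𝓘(ℝ, Cd d)] (D : HiggsOperator d n V)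

/-- The data, in the chart and the frame around a point, of a Higgs operator and a family of
metrics. -/
def flatData (hH : IsSmoothFamily H) (x : X) : FlatData d n W where
  U := chartDom (frameDom n V) x
  isOpen := isOpen_chartDom isOpen_frameDom x
  A := connForm D.toFun x
  G z := gram (H z.1) x z.2
  smooth_A _ hy := contDiffAt_connForm D hy
  smooth_G w y hy := hH x w y hy
  isUnit_G w _ hy := isUnit_of_gram (H w) hy
  flat _ hy v w := curvDir_connForm D hy v w

variable (hH : IsSmoothFamily H)

/-- The change of charts and frames between the data around two points. -/
def flatTransition (x x' : X) : (flatData D hH x).Transition (flatData D hH x') where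
  N := chartDom (fun x => frameDom n V x ∩ ((chartAt (Cd d) x').source ∩ frameDom n V x')) x
  isOpen := isOpen_chartDom (fun x => (isOpen_frameDom x).inter
    ((chartAt (Cd d) x').open_source.inter (isOpen_frameDom x'))) x
  τ := chartMap x x'
  g := chartGauge n V x x'
  subset _ hy := ⟨hy.1, hy.2.1⟩
  mapsTo _ hy := IsFormFamily.chartMap_mem_chartDom hy.2.2.1 hy.2.2.2
  holo _ hy := holomorphicNear_chartMap hy.1 hy.2.2.1
  smooth_g _ hy := contDiffAt_chartGauge ⟨hy.1, hy.2.1⟩ hy.2.2.2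
  isUnit_g _ hy := isUnit_chartGauge ⟨hy.1, hy.2.1⟩ hy.2.2.2
  coeff_eq _ hy v := chartGauge_mul_connForm D ⟨hy.1, hy.2.1⟩ hy.2.2.1 hy.2.2.2 v
  metric_eq _ hy w := of_gram_eq (H w) hy.2.2.2 (symm_chartMap hy.2.2.1)

theorem contDiffAt_slice {M : Type*} [NormedAddCommGroup M] [NormedSpace ℝ M] {f : W × Cd d → M}
    {w : W} (hf : ContDiffAt ℝ ∞ f (w, y)) : ContDiffAt ℝ ∞ (fun y => f (w, y)) y :=
  hf.comp y (contDiffAt_const.prodMk contDiffAt_id)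

theorem isFormFamily_bott {φ : MultilinearMap ℂ (fun _ : Fin (m + 1) => Mat n) ℂ}
    (hφ : IsGLInvariant φ) (T w : W) :
    IsFormFamily (frameDom n V) fun x y => (flatData D hH x).bott φ T (w, y) where
  smooth _ _ hy := contDiffAt_slice (FlatData.smooth_bott φ T hy)
  natural x x' _ hy hy' hyO :=
    FlatData.Transition.bott_eq (t := flatTransition D hH x x') hφ T ⟨hy.1, hy.2, hy', hyO⟩

theorem isFormFamily_alphaForm {φ : MultilinearMap ℂ (fun _ : Fin (m + 2) => Mat n) ℂ}
    (hφ : IsGLInvariant φ) (S T w : W) :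
    IsFormFamily (frameDom n V) fun x y => (flatData D hH x).alphaForm φ S T (w, y) where
  smooth _ _ hy := contDiffAt_slice (FlatData.smooth_alphaForm φ S T hy)
  natural x x' _ hy hy' hyO :=
    FlatData.Transition.alphaForm_eq (t := flatTransition D hH x x') hφ S T ⟨hy.1, hy.2, hy', hyO⟩

theorem isFormFamily_betaForm {φ : MultilinearMap ℂ (fun _ : Fin (m + 2) => Mat n) ℂ}
    (hφ : IsGLInvariant φ) (S T w : W) :
    IsFormFamily (frameDom n V) fun x y => (flatData D hH x).betaForm φ S T (w, y) where
  smooth _ _ hy := contDiffAt_slice (FlatData.smooth_betaForm φ S T hy)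
  natural x x' _ hy hy' hyO :=
    FlatData.Transition.betaForm_eq (t := flatTransition D hH x x') hφ S T ⟨hy.1, hy.2, hy', hyO⟩

/-- Chain rule for the logarithmic derivative, while the curvature depends only on the metric at the
given parameter. It restricts a two-parameter family to the edges of the square. -/
theorem bott_comp {W' : Type*} [NormedAddCommGroup W'] [NormedSpace ℝ W'] {ι : W' → W}
    (hι : ContDiff ℝ ∞ ι) (φ : MultilinearMap ℂ (fun _ : Fin (m + 1) => Mat n) ℂ) (T w : W')
    (hy : y ∈ chartDom (frameDom n V) x) :
    (flatData D (hH.comp hι) x).bott φ T (w, y) =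
      (flatData D hH x).bott φ (fderiv ℝ ι w T) (ι w, y) := by
  have h : (flatData D (hH.comp hι) x).logDeriv T (w, y) =
      (flatData D hH x).logDeriv (fderiv ℝ ι w T) (ι w, y) := by
    have hd : HasFDerivAt (fun z : W' × Cd d => (ι z.1, z.2)) _ (w, y) :=
      ((hι.differentiable (by simp) w).hasFDerivAt.comp (w, y) hasFDerivAt_fst).prodMk
        hasFDerivAt_snd
    have h1 := cdir_comp (f := (flatData D hH x).metric)
      (τ := fun z : W' × Cd d => (ι z.1, z.2)) (z := (w, y))
      ((FlatData.smooth_metric (D := flatData D hH x) (z := (ι w, y)) hy).differentiableAt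
        (by simp)) hd.differentiableAt (FlatData.paramVec d T)
    rw [hd.fderiv] at h1
    rw [FlatData.logDeriv, FlatData.logDeriv]
    refine congrArg₂ (· * ·) rfl (h1.trans ?_)
    simp only [FlatData.paramVec, ContinuousLinearMap.prod_apply, ContinuousLinearMap.comp_apply,
      ContinuousLinearMap.coe_fst', ContinuousLinearMap.coe_snd', _root_.map_zero]
  rw [FlatData.bott, FlatData.bott, h]
  rfl

theorem bott_zero (φ : MultilinearMap ℂ (fun _ : Fin (m + 1) => Mat n) ℂ) (z : W × Cd d) :
    (flatData D hH x).bott φ 0 z = 0 := by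
  ext v
  rw [FlatData.bott, phiPrime_apply]
  have : (flatData D hH x).logDeriv 0 z = 0 := by
    rw [FlatData.logDeriv, show FlatData.paramVec d (0 : W) = 0 from rfl]
    simp [cdir]
  rw [this]
  simp [altSum]

theorem bott_const (K : HermitianMetric d n V)
    (φ : MultilinearMap ℂ (fun _ : Fin (m + 1) => Mat n) ℂ) (T w : W)
    (hy : y ∈ chartDom (frameDom n V) x) :
    (flatData D (isSmoothFamily_const (W := W) K) x).bott φ T (w, y) = 0 := by
  refine (bott_comp D (isSmoothFamily_const (W := W) K) (ι := fun _ => 0) contDiff_const φ T w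
    hy).trans ?_
  rw [fderiv_fun_const]
  exact bott_zero D _ φ _

end Metrics

/-! ### Integration over the parameters -/

section ParameterIntegrals

open MeasureTheory

section

variable {Z M : Type} [NormedAddCommGroup Z] [NormedSpace ℝ Z] [ProperSpace Z]
  [NormedAddCommGroup M] [NormedSpace ℝ M] [NormedSpace ℂ M] [CompleteSpace M]
  {U : Set Z} {y : Z}

/-- The complexified vector of a parameter direction. -/
def paramDir {W : Type} [NormedAddCommGroup W] (Z : Type) [NormedAddCommGroup Z] (T : W) :
    (W × Z) × (W × Z) := ((T, 0), 0)

theorem cdir_paramDir {W : Type} [NormedAddCommGroup W] [NormedSpace ℝ W] (g : W × Z → M) (T : W)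
    (z : W × Z) : cdir g (paramDir Z T) z = fderiv ℝ g z (T, 0) := by
  simp [cdir, paramDir]

theorem integral_fderiv_line {W : Type} [NormedAddCommGroup W] [NormedSpace ℝ W] {g : W × Z → M}
    (hg : ∀ w, ∀ y ∈ U, ContDiffAt ℝ ∞ g (w, y)) (hy : y ∈ U) (w T : W) :
    ∫ t in (0 : ℝ)..1, cdir g (paramDir Z T) (w + t • T, y) = g (w + T, y) - g (w, y) := by
  simp only [cdir_paramDir]
  have h1 : ∀ t : ℝ, HasDerivAt (fun t : ℝ => g (w + t • T, y))
      (fderiv ℝ g (w + t • T, y) (T, 0)) t := by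
    intro t
    have h2 : HasDerivAt (fun t : ℝ => (w + t • T, y)) (T, 0) t := by
      have h3 : HasDerivAt (fun t : ℝ => w + t • T) T t := by
        simpa using ((hasDerivAt_id t).smul_const T).const_add w
      exact h3.prodMk (hasDerivAt_const t y)
    exact ((hg _ y hy).differentiableAt (by simp)).hasFDerivAt.comp_hasDerivAt t h2
  have hc : Continuous fun t : ℝ => fderiv ℝ g (w + t • T, y) (T, 0) := by
    refine continuous_iff_continuousAt.2 fun t => ?_
    have h3 : ContDiffAt ℝ ∞ (fderiv ℝ g) (w + t • T, y) :=
      (hg _ y hy).fderiv_right (m := ∞) (by simp)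
    have h4 := h3.continuousAt.comp (f := fun t : ℝ => (w + t • T, y)) (x := t) (by fun_prop)
    exact h4.clm_apply continuousAt_const
  rw [intervalIntegral.integral_eq_sub_of_hasDerivAt (fun t _ => h1 t) (hc.intervalIntegrable _ _)]
  simp

section

variable {g : (ℝ × ℝ) × Z → M} (hU : IsOpen U)
  (hg : ∀ w, ∀ y ∈ U, ContDiffAt ℝ ∞ g (w, y))
include hg

theorem contDiffAt_reorder (t : ℝ) {z : ℝ × Z} (hz : z.2 ∈ U) :
    ContDiffAt ℝ ∞ (fun z : ℝ × ℝ × Z => g ((z.2.1, z.1), z.2.2)) (t, z) :=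
  ContDiffAt.comp (g := g) (f := fun z : ℝ × ℝ × Z => ((z.2.1, z.1), z.2.2)) (t, z)
    (hg (z.1, t) z.2 hz) (by fun_prop)

include hU

theorem contDiffAt_integral_snd {z : ℝ × Z} (hz : z.2 ∈ U) :
    ContDiffAt ℝ ∞ (fun z : ℝ × Z => ∫ t in (0 : ℝ)..1, g ((z.1, t), z.2)) z :=
  -- The remaining parameter is counted among the space variables and the integration variable is
  -- moved to the front.
  contDiffAt_integral_slab (g := fun z : ℝ × ℝ × Z => g ((z.2.1, z.1), z.2.2))
    (U := {z : ℝ × Z | z.2 ∈ U}) (hU.preimage continuous_snd)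
    (fun t _ hz => contDiffAt_reorder hg t hz) hz

theorem fderiv_integral_snd (s : ℝ) (hy : y ∈ U) :
    fderiv ℝ (fun z : ℝ × Z => ∫ t in (0 : ℝ)..1, g ((z.1, t), z.2)) (s, y) (1, 0) =
      ∫ t in (0 : ℝ)..1, fderiv ℝ g ((s, t), y) ((1, 0), 0) := by
  have h := map_fderiv_integral_slab (g := fun z : ℝ × ℝ × Z => g ((z.2.1, z.1), z.2.2))
    (U := {z : ℝ × Z | z.2 ∈ U}) (hU.preimage continuous_snd)
    (fun t _ hz => contDiffAt_reorder hg t hz) (y := (s, y)) hy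
    (ContinuousLinearMap.apply ℝ M ((1, 0) : ℝ × Z))
  refine h.trans (intervalIntegral.integral_congr fun t _ => ?_)
  have h1 : HasFDerivAt (fun z : ℝ × Z => ((z.1, t), z.2)) _ (s, y) :=
    ((hasFDerivAt_fst (𝕜 := ℝ)).prodMk (hasFDerivAt_const t _)).prodMk (hasFDerivAt_snd (𝕜 := ℝ))
  have h2 : HasFDerivAt (fun z : ℝ × Z => g ((z.1, t), z.2)) _ (s, y) :=
    ((hg (s, t) y hy).differentiableAt (by simp)).hasFDerivAt.comp (s, y) h1
  change fderiv ℝ (fun z : ℝ × Z => g ((z.1, t), z.2)) (s, y) (1, 0) = _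
  rw [h2.fderiv]
  rfl

end

/-- Stokes' formula on a square of parameters. -/
theorem integral_square {f g e e' : (ℝ × ℝ) × Z → M} (hU : IsOpen U)
    (hf : ∀ w, ∀ y ∈ U, ContDiffAt ℝ ∞ f (w, y)) (hg : ∀ w, ∀ y ∈ U, ContDiffAt ℝ ∞ g (w, y))
    (he : ∀ w, ∀ y ∈ U, ContDiffAt ℝ ∞ e (w, y)) (he' : ∀ w, ∀ y ∈ U, ContDiffAt ℝ ∞ e' (w, y))
    (h : ∀ w, ∀ y ∈ U, cdir g (paramDir Z (1, 0)) (w, y) - cdir f (paramDir Z (0, 1)) (w, y) =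
      e (w, y) + e' (w, y)) (hy : y ∈ U) :
    (∫ t in (0 : ℝ)..1, g ((1, t), y)) - ∫ t in (0 : ℝ)..1, g ((0, t), y) =
      (∫ s in (0 : ℝ)..1, f ((s, 1), y)) - (∫ s in (0 : ℝ)..1, f ((s, 0), y)) +
      ((∫ s in (0 : ℝ)..1, ∫ t in (0 : ℝ)..1, e ((s, t), y)) +
        ∫ s in (0 : ℝ)..1, ∫ t in (0 : ℝ)..1, e' ((s, t), y)) := by
  have ct : ∀ {k : (ℝ × ℝ) × Z → M}, (∀ w, ∀ y ∈ U, ContDiffAt ℝ ∞ k (w, y)) → ∀ s : ℝ,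
      Continuous fun t => k ((s, t), y) := fun hk s => continuous_iff_continuousAt.2 fun t =>
    (hk (s, t) y hy).continuousAt.comp (f := fun t => ((s, t), y)) (by fun_prop)
  have cs : ∀ {k : (ℝ × ℝ) × Z → M}, (∀ w, ∀ y ∈ U, ContDiffAt ℝ ∞ k (w, y)) → ∀ t : ℝ,
      Continuous fun s => k ((s, t), y) := fun hk t => continuous_iff_continuousAt.2 fun s =>
    (hk (s, t) y hy).continuousAt.comp (f := fun s => ((s, t), y)) (by fun_prop)
  have ci : ∀ {k : (ℝ × ℝ) × Z → M}, (∀ w, ∀ y ∈ U, ContDiffAt ℝ ∞ k (w, y)) →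
      Continuous fun s => ∫ t in (0 : ℝ)..1, k ((s, t), y) := fun hk =>
    continuous_iff_continuousAt.2 fun s => (contDiffAt_integral_snd hU hk (z := (s, y))
      hy).continuousAt.comp (f := fun s => (s, y)) (by fun_prop)
  have h1 := integral_fderiv_line (g := fun z : ℝ × Z => ∫ t in (0 : ℝ)..1, g ((z.1, t), z.2))
    (fun s y hy => contDiffAt_integral_snd hU hg hy) hy 0 1
  simp only [zero_add, smul_eq_mul, mul_one] at h1
  rw [← h1]
  have h2 : ∀ s : ℝ, cdir (fun z : ℝ × Z => ∫ t in (0 : ℝ)..1, g ((z.1, t), z.2))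
      (paramDir Z 1) (s, y) = f ((s, 1), y) - f ((s, 0), y) +
        ((∫ t in (0 : ℝ)..1, e ((s, t), y)) + ∫ t in (0 : ℝ)..1, e' ((s, t), y)) := by
    intro s
    -- For fixed `s` the derivative of `f` in `t` integrates to boundary terms, which become the
    -- edges `t = 0` and `t = 1`.
    have h3 := integral_fderiv_line hf hy (s, 0) (0, 1)
    simp only [Prod.smul_mk, mul_zero, smul_eq_mul, mul_one, Prod.mk_add_mk, add_zero,
      zero_add] at h3
    rw [cdir_paramDir, fderiv_integral_snd hU hg s hy, ← h3,
      ← intervalIntegral.integral_add ((ct he s).intervalIntegrable _ _)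
        ((ct he' s).intervalIntegrable _ _)]
    have h4 : ∀ t, fderiv ℝ g ((s, t), y) ((1, 0), 0) = cdir f (paramDir Z (0, 1)) ((s, t), y) +
        (e ((s, t), y) + e' ((s, t), y)) := fun t => by
      rw [← h (s, t) y hy, cdir_paramDir g, add_sub_cancel]
    have h5 : Continuous fun t => cdir f (paramDir Z ((0, 1) : ℝ × ℝ)) ((s, t), y) := by
      refine ct (k := fun z => cdir f (paramDir Z (0, 1)) z) (fun w y hy => ?_) s
      exact (hf w y hy).cdir _
    rw [← intervalIntegral.integral_add (h5.intervalIntegrable _ _)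
      (((ct he s).fun_add (ct he' s)).intervalIntegrable _ _)]
    exact intervalIntegral.integral_congr fun t _ => h4 t
  simp only [h2]
  rw [intervalIntegral.integral_add
      (((cs hf 1).fun_sub (cs hf 0)).intervalIntegrable _ _)
      (((ci he).fun_add (ci he')).intervalIntegrable _ _),
    intervalIntegral.integral_sub ((cs hf 1).intervalIntegrable _ _)
      ((cs hf 0).intervalIntegrable _ _),
    intervalIntegral.integral_add ((ci he).intervalIntegrable _ _)
      ((ci he').intervalIntegrable _ _)]

end

section

variable {d p : ℕ} {W : Type} [NormedAddCommGroup W] [NormedSpace ℝ W]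
  {g : W × Cd d → Cd d [⋀^Fin p]→L[ℝ] ℂ} {z : W × Cd d}

theorem contDiffAt_fderiv_slice {M : Type} [NormedAddCommGroup M] [NormedSpace ℝ M]
    {g : W × Cd d → M} (hg : ContDiffAt ℝ ∞ g z) :
    ContDiffAt ℝ ∞ (fun z : W × Cd d => fderiv ℝ (fun y => g (z.1, y)) z.2) z := by
  refine ContDiffAt.fderiv (n := ∞) (f := fun (z : W × Cd d) y => g (z.1, y)) ?_ contDiffAt_snd
    (by simp)
  exact ContDiffAt.comp (g := g) (f := fun q : (W × Cd d) × Cd d => (q.1.1, q.2)) (z, z.2) hg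
    (by fun_prop)

theorem contDiffAt_flatDel_param (hg : ContDiffAt ℝ ∞ g z) :
    ContDiffAt ℝ ∞ (fun z : W × Cd d => flatDel (fun y => g (z.1, y)) z.2) z := by
  have h := (contDiffAt_fderiv_slice hg).continuousLinearMap_comp (delCLM d p)
  exact h

theorem contDiffAt_flatDelBar_param (hg : ContDiffAt ℝ ∞ g z) :
    ContDiffAt ℝ ∞ (fun z : W × Cd d => flatDelBar (fun y => g (z.1, y)) z.2) z := by
  have h := (contDiffAt_fderiv_slice hg).continuousLinearMap_comp (delBarCLM d p)
  exact h.congr_of_eventuallyEq (Filter.Eventually.of_forall fun z => (delBarCLM_fderiv _ _).symm)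

end

section

variable {d p : ℕ} {U : Set (Cd d)} {g : (ℝ × ℝ) × Cd d → Cd d [⋀^Fin p]→L[ℝ] ℂ} (hU : IsOpen U)
  (hg : ∀ w, ∀ y ∈ U, ContDiffAt ℝ ∞ g (w, y)) {y : Cd d}
include hg

theorem contDiffAt_slab_of_square (s t : ℝ) (hy : y ∈ U) :
    ContDiffAt ℝ ∞ (fun z : ℝ × Cd d => g ((s, z.1), z.2)) (t, y) :=
  ContDiffAt.comp (g := g) (f := fun z : ℝ × Cd d => ((s, z.1), z.2)) (t, y) (hg (s, t) y hy)
    (by fun_prop)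

include hU

theorem flatDel_integral_integral (hy : y ∈ U) :
    flatDel (fun y => ∫ s in (0 : ℝ)..1, ∫ t in (0 : ℝ)..1, g ((s, t), y)) y =
      ∫ s in (0 : ℝ)..1, ∫ t in (0 : ℝ)..1, flatDel (fun y => g ((s, t), y)) y := by
  refine (flatDel_integral (g := fun z : ℝ × Cd d => ∫ t in (0 : ℝ)..1, g ((z.1, t), z.2)) hU
    (fun s y hy => contDiffAt_integral_snd hU hg hy) hy).trans ?_
  exact intervalIntegral.integral_congr fun s _ => flatDel_integral
    (g := fun z : ℝ × Cd d => g ((s, z.1), z.2)) hU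
    (fun t y hy => contDiffAt_slab_of_square hg s t hy) hy

theorem flatDelBar_integral_integral (hy : y ∈ U) :
    flatDelBar (fun y => ∫ s in (0 : ℝ)..1, ∫ t in (0 : ℝ)..1, g ((s, t), y)) y =
      ∫ s in (0 : ℝ)..1, ∫ t in (0 : ℝ)..1, flatDelBar (fun y => g ((s, t), y)) y := by
  refine (flatDelBar_integral (g := fun z : ℝ × Cd d => ∫ t in (0 : ℝ)..1, g ((z.1, t), z.2)) hU
    (fun s y hy => contDiffAt_integral_snd hU hg hy) hy).trans ?_
  exact intervalIntegral.integral_congr fun s _ => flatDelBar_integral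
    (g := fun z : ℝ × Cd d => g ((s, z.1), z.2)) hU
    (fun t y hy => contDiffAt_slab_of_square hg s t hy) hy

end

section

variable {d p : ℕ} {y : Cd d}

theorem flatDel_const_smul {η : Cd d → Cd d [⋀^Fin p]→L[ℝ] ℂ} (hη : DifferentiableAt ℝ η y)
    (c : ℂ) : flatDel (fun y => c • η y) y = c • flatDel η y := by
  ext v
  rw [ContinuousAlternatingMap.smul_apply, flatDel, flatDel, fderiv_fun_const_smul hη c,
    ContinuousAlternatingMap.alternatizeUncurryFin_apply,
    ContinuousAlternatingMap.alternatizeUncurryFin_apply, Finset.smul_sum]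
  refine Finset.sum_congr rfl fun i _ => ?_
  rw [smul_comm c]
  congr 1
  simp only [part10, _root_.smul_apply, _root_.sub_apply, ContinuousLinearMap.comp_apply,
    ContinuousAlternatingMap.smul_apply, ContinuousAlternatingMap.sub_apply, smul_eq_mul]
  ring

theorem flatDelBar_const_smul {η : Cd d → Cd d [⋀^Fin p]→L[ℝ] ℂ} (hη : DifferentiableAt ℝ η y)
    (c : ℂ) : flatDelBar (fun y => c • η y) y = c • flatDelBar η y := by
  ext v
  rw [ContinuousAlternatingMap.smul_apply, flatDelBar, flatDelBar, fderiv_fun_const_smul hη c,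
    ContinuousAlternatingMap.alternatizeUncurryFin_apply,
    ContinuousAlternatingMap.alternatizeUncurryFin_apply, Finset.smul_sum]
  refine Finset.sum_congr rfl fun i _ => ?_
  rw [smul_comm c]
  congr 1
  simp only [part01, _root_.smul_apply, _root_.add_apply, ContinuousLinearMap.comp_apply,
    ContinuousAlternatingMap.smul_apply, ContinuousAlternatingMap.add_apply, smul_eq_mul]
  ring

end

end ParameterIntegrals

/-! ### Bott–Chern forms of smooth families of metrics -/

section Transgression

variable {d n m : ℕ} {X : Type*} [TopologicalSpace X] [ChartedSpace (Cd d) X]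
  {V : X → Type*} [TopologicalSpace (TotalSpace (Fin n → ℂ) V)]
  [∀ x, AddCommGroup (V x)] [∀ x, Module ℂ (V x)] [∀ x, TopologicalSpace (V x)]
  [FiberBundle (Fin n → ℂ) V] [VectorBundle ℂ (Fin n → ℂ) V] [VectorBundle ℝ (Fin n → ℂ) V]
  [IsManifold 𝓘(ℂ, Cd d) ω X]
  [∀ x, IsTopologicalAddGroup (V x)] [∀ x, ContinuousSMul ℝ (V x)]
  [ContMDiffVectorBundle ∞ (Fin n → ℂ) V 𝓘(ℝ, Cd d)] (D : HiggsOperator d n V)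
  {x : X} {y : Cd d}

section

variable {H : ℝ → HermitianMetric d n V} (hH : IsSmoothFamily H)
  (φ : MultilinearMap ℂ (fun _ : Fin (m + 1) => Mat n) ℂ)

/-- The integral `∫₀¹ φ'(F_t, L_t) dt` for a family of metrics, in local coordinates. -/
def bottIntegral (x : X) (y : Cd d) : Cd d [⋀^Fin (2 * m)]→L[ℝ] ℂ :=
  ∫ t in (0 : ℝ)..1, (flatData D hH x).bott φ 1 (t, y)

/-- The Bott–Chern form of a smooth family of metrics parametrised by the real line. -/
def bottForm : PForm d (2 * m) X :=
  toPForm fun x y => -Complex.I • bottIntegral D hH φ x y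

variable {φ} (hφ : IsGLInvariant φ)
include hφ

theorem isFormFamily_bottIntegral :
    IsFormFamily (frameDom n V) fun x y => bottIntegral D hH φ x y :=
  isFormFamily_integral (θ := fun x z => (flatData D hH x).bott φ 1 z) isOpen_frameDom
    (fun _ _ _ hy => FlatData.smooth_bott φ 1 hy) fun t => isFormFamily_bott D hH hφ 1 t

theorem isSmoothForm_bottForm : IsSmoothForm (bottForm D hH φ) :=
  ((isFormFamily_bottIntegral D hH hφ).const_smul _).isSmoothForm isOpen_frameDom mem_frameDom

/-- Integrate the variation formula `∂_t φ(F, …, F) = ∂̄∂ φ'(F, L)` over `[0,1]` and move both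
operators out of the integral. -/
theorem chern_sub (hy : y ∈ chartDom (frameDom n V) x) :
    (flatData D hH x).chern φ (1, y) - (flatData D hH x).chern φ (0, y) =
      flatDelBar (fun y => flatDel (bottIntegral D hH φ x) y) y := by
  have hU := isOpen_chartDom (d := d) (isOpen_frameDom (n := n) (V := V)) x
  have sb : ∀ t : ℝ, ∀ y ∈ chartDom (frameDom n V) x,
      ContDiffAt ℝ ∞ ((flatData D hH x).bott φ 1) (t, y) :=
    fun _ _ hy => FlatData.smooth_bott φ 1 hy
  have h1 := integral_fderiv_line (g := (flatData D hH x).chern φ)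
    (U := chartDom (frameDom n V) x) (fun _ _ hy => FlatData.smooth_chern φ hy) hy 0 1
  simp only [zero_add, smul_eq_mul, mul_one] at h1
  rw [← h1]
  have h2 : (fun y => flatDel (bottIntegral D hH φ x) y) =ᶠ[𝓝 y]
      fun y => ∫ t in (0 : ℝ)..1, flatDel (fun y => (flatData D hH x).bott φ 1 (t, y)) y := by
    filter_upwards [hU.mem_nhds hy] with z hz
    exact flatDel_integral hU sb hz
  rw [h2.flatDelBar_eq, flatDelBar_integral (g := fun z : ℝ × Cd d =>
    flatDel (fun y => (flatData D hH x).bott φ 1 (z.1, y)) z.2) hU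
    (fun t y hy => contDiffAt_flatDel_param (sb t y hy)) hy]
  exact intervalIntegral.integral_congr fun t _ =>
    FlatData.cdir_chern hφ.isAdInvariant 1 (z := (t, y)) hy

/-- The transgression formula. -/
theorem phiHiggs_sub : phiHiggs D φ (H 1) - phiHiggs D φ (H 0) =
    Complex.I • delBar (del (bottForm D hH φ)) := by
  have hf := isFormFamily_bottIntegral D hH hφ
  have hs := hf.const_smul (-Complex.I)
  have hU := isOpen_frameDom (n := n) (V := V)
  rw [bottForm, hs.del_toPForm hU mem_frameDom,
    (hs.flatDel hU).delBar_toPForm hU mem_frameDom]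
  funext x
  have hc := center_mem_chartDom (d := d) (mem_frameDom (n := n) (V := V)) x
  refine (chern_sub D hH hφ hc).trans ?_
  have h1 : (fun y => flatDel (fun y => -Complex.I • bottIntegral D hH φ x y) y)
      =ᶠ[𝓝 (chartAt (Cd d) x x)] fun y => -Complex.I • flatDel (bottIntegral D hH φ x) y := by
    filter_upwards [(isOpen_chartDom hU x).mem_nhds hc] with z hz
    exact flatDel_const_smul ((hf.smooth x z hz).differentiableAt (by simp)) _
  change _ = Complex.I • flatDelBar
    (fun y => flatDel (fun y => -Complex.I • bottIntegral D hH φ x y) y) (chartAt (Cd d) x x)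
  rw [h1.flatDelBar_eq, flatDelBar_const_smul (((hf.flatDel hU).smooth x _ hc).differentiableAt
    (by simp)), smul_smul]
  simp

end

section

variable {H : ℝ × ℝ → HermitianMetric d n V} (hH : IsSmoothFamily H)

theorem bottIntegral_comp {ι : ℝ → ℝ × ℝ} (hι : ContDiff ℝ ∞ ι) {w T : ℝ × ℝ}
    (h : ∀ t, ι t = w + t • T) (φ : MultilinearMap ℂ (fun _ : Fin (m + 1) => Mat n) ℂ)
    (hy : y ∈ chartDom (frameDom n V) x) : bottIntegral D (hH.comp hι) φ x y =
      ∫ t in (0 : ℝ)..1, (flatData D hH x).bott φ T (w + t • T, y) := by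
  refine intervalIntegral.integral_congr fun t _ => ?_
  refine (bott_comp D hH hι φ 1 t hy).trans ?_
  have h1 : HasDerivAt ι T t := by
    have h3 : HasDerivAt (fun t : ℝ => w + t • T) T t := by
      simpa using ((hasDerivAt_id t).smul_const T).const_add w
    exact h3.congr_of_eventuallyEq (Filter.Eventually.of_forall h)
  rw [show fderiv ℝ ι t 1 = T by rw [h1.hasFDerivAt.fderiv]; simp, h]

theorem bottIntegral_const {H : ℝ → HermitianMetric d n V} (hH : IsSmoothFamily H)
    {K : HermitianMetric d n V} (h : ∀ t, H t = K)
    (φ : MultilinearMap ℂ (fun _ : Fin (m + 1) => Mat n) ℂ)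
    (hy : y ∈ chartDom (frameDom n V) x) : bottIntegral D hH φ x y = 0 := by
  obtain rfl : H = fun _ => K := funext h
  refine (intervalIntegral.integral_congr (g := fun _ => 0) fun t _ =>
    bott_const D K φ 1 t hy).trans ?_
  exact intervalIntegral.integral_zero

theorem isFormFamily_integral_integral {p : ℕ}
    {θ : X → (ℝ × ℝ) × Cd d → Cd d [⋀^Fin p]→L[ℝ] ℂ}
    (hs : ∀ x, ∀ w, ∀ y ∈ chartDom (frameDom n V) x, ContDiffAt ℝ ∞ (θ x) (w, y))
    (h : ∀ w, IsFormFamily (frameDom n V) fun x y => θ x (w, y)) :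
    IsFormFamily (frameDom n V)
      fun x y => ∫ s in (0 : ℝ)..1, ∫ t in (0 : ℝ)..1, θ x ((s, t), y) :=
  have hO := isOpen_frameDom (n := n) (V := V)
  isFormFamily_integral (θ := fun x (z : ℝ × Cd d) => ∫ t in (0 : ℝ)..1, θ x ((z.1, t), z.2)) hO
    (fun x _ _ hy => contDiffAt_integral_snd (isOpen_chartDom hO x) (hs x) hy)
    fun s => isFormFamily_integral (θ := fun x (z : ℝ × Cd d) => θ x ((s, z.1), z.2)) hO
      (fun x t _ hy => contDiffAt_slab_of_square (hs x) s t hy) fun t => h (s, t)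

theorem contDiff_right (s : ℝ) : ContDiff ℝ ∞ fun t : ℝ => (s, t) := by fun_prop

theorem contDiff_left (t : ℝ) : ContDiff ℝ ∞ fun s : ℝ => (s, t) := by fun_prop

section

variable (φ : MultilinearMap ℂ (fun _ : Fin (m + 1) => Mat n) ℂ)

theorem bottIntegral_right (s : ℝ) (hy : y ∈ chartDom (frameDom n V) x) :
    bottIntegral D (hH.comp (contDiff_right s)) φ x y =
      ∫ t in (0 : ℝ)..1, (flatData D hH x).bott φ (0, 1) ((s, t), y) := by
  rw [bottIntegral_comp D hH (contDiff_right s) (w := (s, 0)) (T := (0, 1)) (by simp) φ hy]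
  simp

theorem bottIntegral_left (t : ℝ) (hy : y ∈ chartDom (frameDom n V) x) :
    bottIntegral D (hH.comp (contDiff_left t)) φ x y =
      ∫ s in (0 : ℝ)..1, (flatData D hH x).bott φ (1, 0) ((s, t), y) := by
  rw [bottIntegral_comp D hH (contDiff_left t) (w := (0, t)) (T := (1, 0)) (by simp) φ hy]
  simp

end

variable {K : HermitianMetric d n V} (hs : ∀ t, H (0, t) = K) (ht : ∀ s, H (s, 0) = K)
include hs ht

/-- Stokes' formula on the square; the edges `s = 0` and `t = 0` are constant at `K` and contribute
nothing. The functions `e`, `e'` are kept general so that `k = 1` is covered by zeros. -/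
theorem bottIntegral_sub (φ : MultilinearMap ℂ (fun _ : Fin (m + 1) => Mat n) ℂ)
    {e e' : (ℝ × ℝ) × Cd d → Cd d [⋀^Fin (2 * m)]→L[ℝ] ℂ}
    (he : ∀ w, ∀ y ∈ chartDom (frameDom n V) x, ContDiffAt ℝ ∞ e (w, y))
    (he' : ∀ w, ∀ y ∈ chartDom (frameDom n V) x, ContDiffAt ℝ ∞ e' (w, y))
    (h : ∀ w, ∀ y ∈ chartDom (frameDom n V) x,
      cdir ((flatData D hH x).bott φ (0, 1)) (FlatData.paramVec d (1, 0)) (w, y)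
        - cdir ((flatData D hH x).bott φ (1, 0)) (FlatData.paramVec d (0, 1)) (w, y) =
        e (w, y) + e' (w, y)) (hy : y ∈ chartDom (frameDom n V) x) :
    bottIntegral D (hH.comp (contDiff_right 1)) φ x y =
      bottIntegral D (hH.comp (contDiff_left 1)) φ x y +
      ((∫ s in (0 : ℝ)..1, ∫ t in (0 : ℝ)..1, e ((s, t), y)) +
        ∫ s in (0 : ℝ)..1, ∫ t in (0 : ℝ)..1, e' ((s, t), y)) := by
  have h1 := integral_square (g := (flatData D hH x).bott φ (0, 1))
    (f := (flatData D hH x).bott φ (1, 0))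
    (isOpen_chartDom (d := d) (isOpen_frameDom (n := n) (V := V)) x)
    (fun _ _ hy => FlatData.smooth_bott φ _ hy) (fun _ _ hy => FlatData.smooth_bott φ _ hy)
    he he' h hy
  rw [← bottIntegral_right D hH φ 1 hy, ← bottIntegral_right D hH φ 0 hy,
    ← bottIntegral_left D hH φ 1 hy, ← bottIntegral_left D hH φ 0 hy,
    bottIntegral_const D (hH.comp (contDiff_right 0)) hs φ hy,
    bottIntegral_const D (hH.comp (contDiff_left 0)) ht φ hy, sub_zero, sub_zero] at h1
  exact h1

omit hs ht in
theorem neg_smul_sub_neg_smul_add {M : Type*} [AddCommGroup M] [Module ℂ M] (c : ℂ) (a b e : M) :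
    -c • a - -c • (a + (b + e)) = c • b + c • e := by module

theorem bottForm_eq {φ : MultilinearMap ℂ (fun _ : Fin 1 => Mat n) ℂ} (hφ : IsGLInvariant φ) :
    bottForm D (hH.comp (contDiff_left 1)) φ = bottForm D (hH.comp (contDiff_right 1)) φ := by
  funext x
  refine congrArg (-Complex.I • ·) ?_
  refine ((bottIntegral_sub D hH hs ht φ (e := 0) (e' := 0) (fun _ _ _ => contDiffAt_const)
    (fun _ _ _ => contDiffAt_const) (fun w y hy => ?_)
    (center_mem_chartDom (mem_frameDom (n := n) (V := V)) x)).trans ?_).symm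
  · refine (sub_eq_zero.2 (FlatData.cdir_bott_eq hφ.isAdInvariant _ _ hy)).trans ?_
    exact (add_zero _).symm
  · simp

theorem memIm_bottForm_sub {φ : MultilinearMap ℂ (fun _ : Fin (m + 2) => Mat n) ℂ}
    (hφ : IsGLInvariant φ) : ∃ α β : PForm d (2 * m + 1) X, IsSmoothForm α ∧ IsSmoothForm β ∧
      bottForm D (hH.comp (contDiff_left 1)) φ - bottForm D (hH.comp (contDiff_right 1)) φ =
        delBar α + del β := by
  have hO := isOpen_frameDom (n := n) (V := V)
  have sα : ∀ x, ∀ w, ∀ y ∈ chartDom (frameDom n V) x,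
      ContDiffAt ℝ ∞ ((flatData D hH x).alphaForm φ (1, 0) (0, 1)) (w, y) :=
    fun _ _ _ hy => FlatData.smooth_alphaForm φ _ _ hy
  have sβ : ∀ x, ∀ w, ∀ y ∈ chartDom (frameDom n V) x,
      ContDiffAt ℝ ∞ ((flatData D hH x).betaForm φ (1, 0) (0, 1)) (w, y) :=
    fun _ _ _ hy => FlatData.smooth_betaForm φ _ _ hy
  have fα := isFormFamily_integral_integral sα fun w =>
    isFormFamily_alphaForm D hH hφ (1, 0) (0, 1) w
  have fβ := isFormFamily_integral_integral sβ fun w =>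
    isFormFamily_betaForm D hH hφ (1, 0) (0, 1) w
  -- The edge `t = 1` minus the edge `s = 1` is minus the integral over the square, so the factor
  -- `-i` of the Bott–Chern form becomes `i`.
  have gα := fα.const_smul Complex.I
  have gβ := fβ.const_smul Complex.I
  refine ⟨_, _, gα.isSmoothForm hO mem_frameDom, gβ.isSmoothForm hO mem_frameDom, ?_⟩
  rw [gα.delBar_toPForm hO mem_frameDom, gβ.del_toPForm hO mem_frameDom]
  funext x
  have hy := center_mem_chartDom (d := d) (mem_frameDom (n := n) (V := V)) x
  have hU := isOpen_chartDom (d := d) hO x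
  have h := bottIntegral_sub D hH hs ht φ
    (fun w y hy => contDiffAt_flatDelBar_param (sα x w y hy))
    (fun w y hy => contDiffAt_flatDel_param (sβ x w y hy))
    (fun w y hy => FlatData.cdir_bott_sub hφ.isAdInvariant (1, 0) (0, 1) (z := (w, y)) hy) hy
  have h1 := flatDelBar_integral_integral hU (sα x) hy
  have h2 := flatDel_integral_integral hU (sβ x) hy
  rw [← h1, ← h2] at h
  change -Complex.I • bottIntegral D _ φ x _ - -Complex.I • bottIntegral D _ φ x _ =
    flatDelBar (fun y => Complex.I • ∫ s in (0 : ℝ)..1, ∫ t in (0 : ℝ)..1,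
      (flatData D hH x).alphaForm φ (1, 0) (0, 1) ((s, t), y)) _ +
    flatDel (fun y => Complex.I • ∫ s in (0 : ℝ)..1, ∫ t in (0 : ℝ)..1,
      (flatData D hH x).betaForm φ (1, 0) (0, 1) ((s, t), y)) _
  rw [flatDelBar_const_smul ((fα.smooth x _ hy).differentiableAt (by simp)),
    flatDel_const_smul ((fβ.smooth x _ hy).differentiableAt (by simp)), h]
  exact neg_smul_sub_neg_smul_add _ _ _ _

end

end Transgression

/-! ### Paths of metrics -/

section Paths

attribute [local instance] Matrix.linftyOpNormedRing matNormedAlgebra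
attribute [local instance] matTopology matRealModule

variable {d n m : ℕ} {X : Type*} [TopologicalSpace X] [ChartedSpace (Cd d) X]
  {V : X → Type*} [TopologicalSpace (TotalSpace (Fin n → ℂ) V)]
  [∀ x, AddCommGroup (V x)] [∀ x, Module ℂ (V x)] [∀ x, TopologicalSpace (V x)]
  [FiberBundle (Fin n → ℂ) V] [VectorBundle ℝ (Fin n → ℂ) V]

theorem HermitianMetric.ext_toFun {H K : HermitianMetric d n V} (h : H.toFun = K.toFun) : H = K := by
  cases H
  cases K
  cases h
  rfl

theorem contMDiff_smoothTransition {E : Type*} [NormedAddCommGroup E] [NormedSpace ℝ E] {B : Type*}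
    [TopologicalSpace B] {I : ModelWithCorners ℝ E B} {Y : Type*} [TopologicalSpace Y]
    [ChartedSpace B Y] {f : Y → ℝ} {s : Set Y} (hf : ContMDiffOn I 𝓘(ℝ, ℝ) ∞ f s) :
    ContMDiffOn I 𝓘(ℝ, ℂ) ∞ (fun y => (Real.smoothTransition (f y) : ℂ)) s := by
  have h : ContDiff ℝ ∞ fun t : ℝ => (Real.smoothTransition t : ℂ) :=
    Complex.ofRealCLM.contDiff.comp (Real.smoothTransition.contDiff (n := ⊤))
  exact h.contMDiff.comp_contMDiffOn hf

theorem contMDiffOn_complex_mul {E : Type*} [NormedAddCommGroup E] [NormedSpace ℝ E] {B : Type*}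
    [TopologicalSpace B] {I : ModelWithCorners ℝ E B} {Y : Type*} [TopologicalSpace Y]
    [ChartedSpace B Y] {f g : Y → ℂ} {s : Set Y} (hf : ContMDiffOn I 𝓘(ℝ, ℂ) ∞ f s)
    (hg : ContMDiffOn I 𝓘(ℝ, ℂ) ∞ g s) : ContMDiffOn I 𝓘(ℝ, ℂ) ∞ (fun y => f y * g y) s := by
  have h : ContDiff ℝ ∞ fun z : ℂ × ℂ => z.1 * z.2 := contDiff_fst.mul contDiff_snd
  exact h.contMDiff.comp_contMDiffOn (hf.prodMk_space hg)

/-- The convex combinations `(1 - χ t) K + χ t H` of two metrics, for the standard transition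
function `χ`. -/
def HermitianMetric.mix (K H : HermitianMetric d n V) (t : ℝ) : HermitianMetric d n V where
  toFun x := (1 - Real.smoothTransition t : ℂ) • K.toFun x +
    (Real.smoothTransition t : ℂ) • H.toFun x
  symm x u v := by
    simp only [LinearMap.add_apply, LinearMap.smul_apply, smul_eq_mul, map_add, map_mul, map_sub,
      map_one, Complex.conj_ofReal, ← K.symm x u v, ← H.symm x u v]
  pos x u hu := by
    have h0 := Real.smoothTransition.nonneg t
    have h1 := Real.smoothTransition.le_one t
    have hK := K.pos x u hu
    have hH := H.pos x u hu
    have e : ((1 - Real.smoothTransition t : ℂ)) = ((1 - Real.smoothTransition t : ℝ) : ℂ) := by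
      simp
    simp only [LinearMap.add_apply, LinearMap.smul_apply, smul_eq_mul, Complex.add_re, e,
      Complex.re_ofReal_mul]
    rcases h0.eq_or_lt with h | h
    · rw [← h]
      simpa using hK
    · have := mul_pos h hH
      have := mul_nonneg (sub_nonneg.2 h1) hK.le
      linarith
  smooth e _ i j := by
    have h1 := K.smooth e i j
    have h2 := H.smooth e i j
    exact (contMDiffOn_complex_mul contMDiffOn_const h1).add
      (contMDiffOn_complex_mul contMDiffOn_const h2)

theorem HermitianMetric.mix_zero (K H : HermitianMetric d n V) : K.mix H 0 = K :=
  HermitianMetric.ext_toFun (by funext x; simp [mix])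

theorem HermitianMetric.mix_one (K H : HermitianMetric d n V) : K.mix H 1 = H :=
  HermitianMetric.ext_toFun (by funext x; simp [mix])

theorem HermitianMetric.mix_self (K : HermitianMetric d n V) (t : ℝ) : K.mix K t = K :=
  HermitianMetric.ext_toFun (by
    funext x
    change _ • K.toFun x + _ • K.toFun x = K.toFun x
    rw [← add_smul, sub_add_cancel, one_smul])

/-- The path of convex combinations. -/
def MetricPath.segment (K H : HermitianMetric d n V) : MetricPath K H where
  toFun := K.mix H
  source := K.mix_zero H
  target := K.mix_one H
  smooth e _ i j := by
    have h1 := (K.smooth e i j).comp (t := e.baseSet) (s := Icc (0 : ℝ) 1 ×ˢ e.baseSet)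
      (contMDiffOn_snd (I := 𝓘(ℝ, ℝ))) fun q hq => hq.2
    have h2 := (H.smooth e i j).comp (t := e.baseSet) (s := Icc (0 : ℝ) 1 ×ˢ e.baseSet)
      (contMDiffOn_snd (I := 𝓘(ℝ, ℝ))) fun q hq => hq.2
    have h3 := contMDiff_smoothTransition (contMDiffOn_fst (I := 𝓘(ℝ, ℝ)) (J := 𝓘(ℝ, Cd d))
      (n := ∞) (s := Icc (0 : ℝ) 1 ×ˢ e.baseSet))
    exact (contMDiffOn_complex_mul (contMDiffOn_const.sub h3) h1).add
      (contMDiffOn_complex_mul h3 h2)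

variable [VectorBundle ℂ (Fin n → ℂ) V] {x : X} {y : Cd d}

variable [IsManifold 𝓘(ℂ, Cd d) ω X]

theorem contDiff_smoothTransition_comp {W : Type*} [NormedAddCommGroup W] [NormedSpace ℝ W]
    {f : W → ℝ} (hf : ContDiff ℝ ∞ f) :
    ContDiff ℝ ∞ fun w => (Real.smoothTransition (f w) : ℂ) :=
  Complex.ofRealCLM.contDiff.comp ((Real.smoothTransition.contDiff (n := ⊤)).comp hf)

theorem IsSmoothFamily.mix {W : Type*} [NormedAddCommGroup W] [NormedSpace ℝ W]
    {H K : W → HermitianMetric d n V} (hK : IsSmoothFamily K) (hH : IsSmoothFamily H) {f : W → ℝ}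
    (hf : ContDiff ℝ ∞ f) : IsSmoothFamily fun w => (K w).mix (H w) (f w) := by
  intro x w y hy
  have h1 : ContDiffAt ℝ ∞ (fun z : W × Cd d => (Real.smoothTransition (f z.1) : ℂ)) (w, y) :=
    (contDiff_smoothTransition_comp hf).contDiffAt.comp (w, y) contDiffAt_fst
  exact ((contDiffAt_const.sub h1).smul (hK x w y hy)).add (h1.smul (hH x w y hy))

/-- `Real.smoothTransition` maps the whole line into `[0,1]`, so smoothness of the path on the
closed interval suffices for a smooth family on all of `ℝ`. -/
theorem MetricPath.isSmoothFamily {K H : HermitianMetric d n V} (γ : MetricPath K H) :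
    IsSmoothFamily fun t => γ.toFun (Real.smoothTransition t) := by
  intro x t y hy
  refine contDiffAt_pi.2 fun j => contDiffAt_pi.2 fun i => ?_
  let e := trivializationAt (Fin n → ℂ) V x
  let S : Set (ℝ × Cd d) := {z | z.2 ∈ chartDom (frameDom n V) x}
  have hS : IsOpen S := (isOpen_chartDom isOpen_frameDom x).preimage continuous_snd
  have h1 : ContMDiffOn 𝓘(ℝ, ℝ × Cd d) 𝓘(ℝ, ℝ) ∞
      (fun z : ℝ × Cd d => Real.smoothTransition z.1) S :=
    ((Real.smoothTransition.contDiff (n := ⊤)).comp contDiff_fst).contMDiff.contMDiffOn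
  have h2 : ContMDiffOn 𝓘(ℝ, ℝ × Cd d) 𝓘(ℝ, Cd d) ∞
      (fun z : ℝ × Cd d => (chartAt (Cd d) x).symm z.2) S :=
    (contMDiffOn_chart_symm (I := 𝓘(ℝ, Cd d)) (n := ∞) (x := x)).comp
      (contDiff_snd.contMDiff.contMDiffOn (s := S)) fun z hz => hz.1
  have h3 := (γ.smooth e i j).comp (h1.prodMk h2) fun z hz =>
    ⟨⟨Real.smoothTransition.nonneg _, Real.smoothTransition.le_one _⟩, hz.2⟩
  exact (contMDiffOn_iff_contDiffOn.1 h3).contDiffAt (hS.mem_nhds hy)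

theorem MetricPath.differentiableWithinAt_gram {K H : HermitianMetric d n V} (γ : MetricPath K H)
    (hy : y ∈ chartDom (frameDom n V) x) {t : ℝ} (ht : t ∈ Icc (0 : ℝ) 1) :
    DifferentiableWithinAt ℝ (fun s => gram (γ.toFun s) x y) (Icc 0 1) t := by
  refine differentiableWithinAt_pi.2 fun j => differentiableWithinAt_pi.2 fun i => ?_
  have h1 := (γ.smooth (trivializationAt (Fin n → ℂ) V x) i j).comp (s := Icc (0 : ℝ) 1)
    (g := fun q : ℝ × X => _) (f := fun s : ℝ => (s, (chartAt (Cd d) x).symm y))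
    (contMDiffOn_id.prodMk (contMDiffOn_const (I := 𝓘(ℝ, ℝ)) (I' := 𝓘(ℝ, Cd d))))
    fun s hs => ⟨hs, hy.2⟩
  exact (contMDiffOn_iff_contDiffOn.1 h1).differentiableOn (by simp) t ht

/-- The family of metrics on the real line obtained from a path by a change of parameter has the
expected logarithmic derivative. -/
theorem MetricPath.logDeriv_eq [∀ x, IsTopologicalAddGroup (V x)] [∀ x, ContinuousSMul ℝ (V x)]
    [ContMDiffVectorBundle ∞ (Fin n → ℂ) V 𝓘(ℝ, Cd d)] (D : HiggsOperator d n V)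
    {K H : HermitianMetric d n V} (γ : MetricPath K H) (t : ℝ) (x : X) :
    (flatData D γ.isSmoothFamily x).logDeriv 1 (t, chartAt (Cd d) x x) =
      ((deriv Real.smoothTransition t : ℝ) : ℂ) • metricLogDeriv γ (Real.smoothTransition t) x := by
  set y := chartAt (Cd d) x x with hydef
  have hy : y ∈ chartDom (frameDom n V) x := center_mem_chartDom mem_frameDom x
  have hG := (γ.isSmoothFamily x t y hy).differentiableAt (by simp)
  have h1 : HasDerivAt (fun s => gram (γ.toFun (Real.smoothTransition s)) x y)
      (fderiv ℝ (fun z : ℝ × Cd d => gram (γ.toFun (Real.smoothTransition z.1)) x z.2) (t, y)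
        (1, 0)) t :=
    hG.hasFDerivAt.comp_hasDerivAt (f := fun s : ℝ => (s, y)) t
      ((hasDerivAt_id t).prodMk (hasDerivAt_const t y))
  have ht : ∀ t, Real.smoothTransition t ∈ Icc (0 : ℝ) 1 := fun t =>
    ⟨Real.smoothTransition.nonneg t, Real.smoothTransition.le_one t⟩
  have hχ : HasDerivAt Real.smoothTransition (deriv Real.smoothTransition t) t :=
    ((Real.smoothTransition.contDiff (n := ⊤)).differentiable (by simp) t).hasDerivAt
  -- The path has only a derivative within `[0,1]`. The chain rule still gives an ordinary
  -- derivative, since the inner function never leaves the interval.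
  have h2 := (γ.differentiableWithinAt_gram hy (ht t)).hasDerivWithinAt.scomp_hasDerivAt t hχ ht
  have h3 := h1.unique h2
  have h4 := cdir_of hG (FlatData.paramVec d (1 : ℝ))
  rw [FlatData.logDeriv, metricLogDeriv, ← Matrix.mul_smul]
  refine congrArg₂ (· * ·) rfl (h4.trans ?_)
  have h5 : cdir (fun z : ℝ × Cd d => gram (γ.toFun (Real.smoothTransition z.1)) x z.2)
      (FlatData.paramVec d (1 : ℝ)) (t, y) =
      fderiv ℝ (fun z : ℝ × Cd d => gram (γ.toFun (Real.smoothTransition z.1)) x z.2) (t, y)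
        (1, 0) := cdir_paramDir _ (1 : ℝ) (t, y)
  rw [h5, h3]
  rfl

end Paths

/-! ### The Bott–Chern form of a path -/

section BottChern

variable {d n m : ℕ}

/-- Invariance of path integrals under the reparametrization by the standard transition
function. -/
theorem integral_smoothTransition {M : Type*} [NormedAddCommGroup M] [NormedSpace ℝ M] (g : ℝ → M) :
    ∫ t in (0 : ℝ)..1, deriv Real.smoothTransition t • g (Real.smoothTransition t) =
      ∫ t in (0 : ℝ)..1, g t := by
  -- Substitution along a monotone function needs no regularity of `g`.
  have h := MeasureTheory.integral_Icc_deriv_smul_of_deriv_nonneg (a := 0) (b := 1) (g := g)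
    (f := Real.smoothTransition) (f' := deriv Real.smoothTransition)
    Real.smoothTransition.continuous.continuousOn
    (fun t _ => ((Real.smoothTransition.contDiff (n := ⊤)).differentiable (by simp) t).hasDerivAt)
    (fun t _ => Real.smoothTransition.monotone.deriv_nonneg) zero_le_one
  rw [Real.smoothTransition.zero, Real.smoothTransition.one] at h
  rw [intervalIntegral.integral_of_le zero_le_one, intervalIntegral.integral_of_le zero_le_one,
    ← MeasureTheory.integral_Icc_eq_integral_Ioc, ← MeasureTheory.integral_Icc_eq_integral_Ioc, h]

theorem phiPrime_smul (φ : MultilinearMap ℂ (fun _ : Fin (m + 1) => Mat n) ℂ)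
    (F : Cd d →L[ℝ] Cd d →L[ℝ] Arr n) (c : ℝ) (L : Mat n) :
    phiPrime φ F ((c : ℂ) • L) = c • phiPrime φ F L := by
  ext v
  rw [ContinuousAlternatingMap.smul_apply, phiPrime_apply, phiPrime_apply, map_smul]
  simp only [altSum, _root_.smul_apply, smul_eq_mul, Complex.real_smul, Finset.mul_sum]
  refine Finset.sum_congr rfl fun σ _ => ?_
  simp only [mul_smul_comm, mul_left_comm]

variable {X : Type*} [TopologicalSpace X] [ChartedSpace (Cd d) X]
  {V : X → Type*} [TopologicalSpace (TotalSpace (Fin n → ℂ) V)]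
  [∀ x, AddCommGroup (V x)] [∀ x, Module ℂ (V x)] [∀ x, TopologicalSpace (V x)]
  [FiberBundle (Fin n → ℂ) V] [VectorBundle ℂ (Fin n → ℂ) V] [VectorBundle ℝ (Fin n → ℂ) V]
  [IsManifold 𝓘(ℂ, Cd d) ω X]
  [∀ x, IsTopologicalAddGroup (V x)] [∀ x, ContinuousSMul ℝ (V x)]
  [ContMDiffVectorBundle ∞ (Fin n → ℂ) V 𝓘(ℝ, Cd d)] (D : HiggsOperator d n V)
  (φ : MultilinearMap ℂ (fun _ : Fin (m + 1) => Mat n) ℂ)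

theorem bottForm_congr {H H' : ℝ → HermitianMetric d n V} (hH : IsSmoothFamily H)
    (hH' : IsSmoothFamily H') (h : ∀ t, H t = H' t) : bottForm D hH φ = bottForm D hH' φ := by
  obtain rfl : H = H' := funext h
  rfl

variable {K H : HermitianMetric d n V}

/-- The reparametrised family has logarithmic derivative `χ'(t) L` at parameter `χ(t)`, where `χ` is
the transition function; the factor `χ'` is that of the substitution `t ↦ χ(t)`. -/
theorem bottChern_eq_bottForm (γ : MetricPath K H) :
    bottChern D φ γ = bottForm D γ.isSmoothFamily φ := by
  funext x
  refine congrArg (-Complex.I • ·) (Eq.symm ?_)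
  refine Eq.trans ?_ (integral_smoothTransition (M := Cd d [⋀^Fin (2 * m)]→L[ℝ] ℂ)
    fun t => phiPrime φ (higgsCurvature D (γ.toFun t) x) (metricLogDeriv γ t x))
  refine intervalIntegral.integral_congr fun t _ => ?_
  change phiPrime φ _ ((flatData D γ.isSmoothFamily x).logDeriv 1 (t, chartAt (Cd d) x x)) = _
  rw [γ.logDeriv_eq, phiPrime_smul]
  rfl

variable {φ} (hφ : IsGLInvariant φ)
include hφ

theorem isSmoothForm_bottChern (γ : MetricPath K H) : IsSmoothForm (bottChern D φ γ) := by
  rw [bottChern_eq_bottForm]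
  exact isSmoothForm_bottForm D γ.isSmoothFamily hφ

theorem phiHiggs_sub_eq_bottChern (γ : MetricPath K H) :
    phiHiggs D φ H - phiHiggs D φ K = Complex.I • delBar (del (bottChern D φ γ)) := by
  rw [bottChern_eq_bottForm, ← phiHiggs_sub D γ.isSmoothFamily hφ, Real.smoothTransition.one,
    Real.smoothTransition.zero, γ.source, γ.target]

/-- The Bott–Chern form of a path is independent of the path modulo the images of `∂̄` and `∂`. -/
theorem memIm_bottForm_sub_bottChern (γ : MetricPath K H) :
    MemImDelBarAddImDel (bottForm D ((isSmoothFamily_const K).mix (isSmoothFamily_const H)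
      (contDiff_id (E := ℝ))) φ - bottChern D φ γ) := by
  -- A square from `K` to the moving endpoint of `γ`: it is `K` for `s = 0` and for `t = 0`, runs
  -- along `γ` for `s = 1`, and along the convex combinations of `K` and `H` for `t = 1`.
  let P : ℝ × ℝ → HermitianMetric d n V := fun w =>
    K.mix (γ.toFun (Real.smoothTransition w.2)) w.1
  have hP : IsSmoothFamily P :=
    (isSmoothFamily_const K).mix (γ.isSmoothFamily.comp contDiff_snd) contDiff_fst
  have hs : ∀ t, P (0, t) = K := fun t => K.mix_zero _
  have ht : ∀ s, P (s, 0) = K := fun s => by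
    change K.mix (γ.toFun (Real.smoothTransition 0)) s = K
    rw [Real.smoothTransition.zero, γ.source, K.mix_self]
  have h1 : bottForm D (hP.comp (contDiff_right 1)) φ = bottChern D φ γ := by
    rw [bottChern_eq_bottForm]
    exact bottForm_congr D φ _ _ fun t => K.mix_one _
  have h2 : bottForm D (hP.comp (contDiff_left 1)) φ =
      bottForm D ((isSmoothFamily_const K).mix (isSmoothFamily_const H)
        (contDiff_id (E := ℝ))) φ :=
    bottForm_congr D φ _ _ fun s => by
      change K.mix (γ.toFun (Real.smoothTransition 1)) s = K.mix H s
      rw [Real.smoothTransition.one, γ.target]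
  rw [← h1, ← h2]
  -- For `k = 1` there are no forms of degree `-1`, and the difference is exactly zero.
  cases m with
  | zero => exact sub_eq_zero.2 (bottForm_eq D hP hs ht hφ)
  | succ m => exact memIm_bottForm_sub D hP hs ht hφ

end BottChern

end

theorem mainTheorem6 {d n m : ℕ} {X : Type*} [TopologicalSpace X] [ChartedSpace (Cd d) X]
    [IsManifold 𝓘(ℂ, Cd d) ω X]
    {V : X → Type*} [TopologicalSpace (TotalSpace (Fin n → ℂ) V)]
    [∀ x, AddCommGroup (V x)] [∀ x, Module ℂ (V x)] [∀ x, TopologicalSpace (V x)]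
    [∀ x, IsTopologicalAddGroup (V x)] [∀ x, ContinuousSMul ℝ (V x)]
    [FiberBundle (Fin n → ℂ) V] [VectorBundle ℂ (Fin n → ℂ) V] [VectorBundle ℝ (Fin n → ℂ) V]
    [ContMDiffVectorBundle ∞ (Fin n → ℂ) V 𝓘(ℝ, Cd d)]
    (D : HiggsOperator d n V)
    (φ : MultilinearMap ℂ (fun _ : Fin (m + 1) => Mat n) ℂ) (hφ : IsGLInvariant φ) :
    ∃ R : HermitianMetric d n V → HermitianMetric d n V → PForm d (2 * m) X,
      ∀ H K : HermitianMetric d n V,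
        IsSmoothForm (R H K) ∧
        Nonempty (MetricPath K H) ∧
        (∀ γ : MetricPath K H,
          IsSmoothForm (bottChern D φ γ) ∧
          MemImDelBarAddImDel (R H K - bottChern D φ γ) ∧
          phiHiggs D φ H - phiHiggs D φ K = Complex.I • delBar (del (bottChern D φ γ))) ∧
        phiHiggs D φ H - phiHiggs D φ K = Complex.I • delBar (del (R H K)) := by

  -- The chosen representative is the form of the convex combinations from `K` to `H`.
  refine ⟨fun H K => bottForm D ((isSmoothFamily_const K).mix (isSmoothFamily_const H)
    (contDiff_id (E := ℝ))) φ, fun H K => ⟨isSmoothForm_bottForm D _ hφ, ⟨.segment K H⟩,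
      fun γ => ⟨isSmoothForm_bottChern D hφ γ, memIm_bottForm_sub_bottChern D hφ γ,
        phiHiggs_sub_eq_bottChern D hφ γ⟩, ?_⟩⟩
  have h := phiHiggs_sub D ((isSmoothFamily_const K).mix (isSmoothFamily_const H)
    (contDiff_id (E := ℝ))) hφ
  simp only [id, HermitianMetric.mix_zero, HermitianMetric.mix_one] at h
  exact h
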